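/- Let $k$ be a commutative ring and $\mathcal{A}=(A=\bigoplus_{i\in\mathbb{Z}}A^i,d)$ a differential graded (dg) $k$-algebra such that $A^i=0$ for $i<0$, the ring $A^0$ is semisimple, and $d(A^0)=0$. Let $\mathrm{dgMod}$ be the category of dg right $\mathcal{A}$-modules (morphisms: $A$-linear maps of degree $0$ commuting with the differentials) and $\mathrm{dgHot}$ its homotopy category. Write $(\{l\}M)^i=M^{i+l}$ with $d_{\{l\}M}=(-1)^l d_M$. For a simple right $A^0$-module $L$, placed in degree $0$ with zero differential, let $\hat L=L\otimes_{A^0}\mathcal{A}$. Consider the following two full subcategories of $\mathrm{dgHot}$: - $\mathrm{dgFilt}$, whose objects are the dg modules $M$ admitting a finite filtration $0=F_0\subset F_1\subset\dots\subset F_n=M$ by dg submodules such that $F_i/F_{i-1}\cong\{l_i\}\hat L_i$ in $\mathrm{dgMod}$ for suitable integers $l_1\ge l_2\ge\dots\ge l_n$ and simple right $A^0$-modules $L_1,\dots,L_n$; - $\mathrm{dgPer}$, the smallest strict full triangulated subcategory of $\mathrm{dgHot}$ that contains $\mathcal{A}$ and is closed under direct summands. An object is called indecomposable if it is nonzero and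 in each decomposition of it as a direct sum of two objects one of the two summands is zero. A Krull–Remak–Schmidt category is an additive category in which every object is isomorphic to a finite direct sum of objects with local endomorphism rings. Proposition 8.6. 1. Let $M$ be an object of $\mathrm{dgFilt}$ that is indecomposable in $\mathrm{dgMod}$ or in $\mathrm{dgFilt}$. Then every element of $\operatorname{End}_{\mathrm{dgMod}}(M)$ is either an isomorphism or nilpotent, the nilpotent endomorphisms form a two-sided ideal in $\operatorname{End}_{\mathrm{dgMod}}(M)$, and $\operatorname{End}_{\mathrm{dgMod}}(M)$ is a local ring. The same statements hold for $\operatorname{End}_{\mathrm{dgHot}}(N)$ if $N$ is an indecomposable object of $\mathrm{dgPer}$. 2. Every object of $\mathrm{dgFilt}$ is a finite direct sum, both in $\mathrm{dgMod}$ and in $\mathrm{dgFilt}$, of objects of $\mathrm{dgFilt}$ that are indecomposable both in $\mathrm{dgMod}$ and in $\mathrm{dgFilt}$. Every object of $\mathrm{dgPer}$ is a finite direct sum in $\mathrm{dgPer}$ of indecomposable objects of $\mathrm{dgPer}$. 3. $\mathrm{dgFilt}$ and $\mathrm{dgPer}$ are Krull–Remak–Schmidt categories. -/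

import Mathlib

open CategoryTheory CategoryTheory.Limits MulOpposite
open scoped TensorProduct RightActions DirectSum

universe u w

/-! ### Gradings by subgroups -/

/-- A family of subgroups is an (internal) direct sum decomposition as soon as it spans and there
are projections onto its members. -/
theorem isInternal_of_proj {M : Type*} [AddCommGroup M] (gr : ℤ → AddSubgroup M)
    (p : ℤ → M →+ M) (hp : ∀ i, ∀ m ∈ gr i, p i m = m)
    (hp' : ∀ i j, ∀ m ∈ gr j, i ≠ j → p i m = 0) (hs : ∀ m, m ∈ ⨆ i, gr i) :
    DirectSum.IsInternal gr := by
  have key : ∀ (x : ⨁ i, gr i) (i : ℤ), p i (DirectSum.coeAddMonoidHom gr x) = x i := by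
    intro x i
    induction x using DirectSum.induction_on with
    | zero => simp
    | of j y =>
      rw [DirectSum.coeAddMonoidHom_of]
      by_cases h : i = j
      · subst h
        rw [hp _ _ y.2, DirectSum.of_eq_same]
      · rw [hp' i j _ y.2 h, DirectSum.of_eq_of_ne _ _ _ h]
        rfl
    | add x y hx hy => rw [map_add, map_add, hx, hy, DirectSum.add_apply, AddSubgroup.coe_add]
  refine ⟨fun x y hxy => ?_, fun m => ?_⟩
  · ext i
    rw [← key, ← key, hxy]
  · have hm := hs m
    induction hm using AddSubgroup.iSup_induction' with
    | hp i x hx => exact ⟨DirectSum.of (fun i => gr i) i ⟨x, hx⟩, by simp⟩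
    | h1 => exact ⟨0, by simp⟩
    | hadd x y hx hy h1 h2 =>
      obtain ⟨a, rfl⟩ := h1
      obtain ⟨b, rfl⟩ := h2
      exact ⟨a + b, by simp⟩

theorem exists_proj_of_isInternal {M : Type*} [AddCommGroup M] {gr : ℤ → AddSubgroup M}
    (h : DirectSum.IsInternal gr) :
    ∃ p : ℤ → M →+ M, (∀ i m, p i m ∈ gr i) ∧ (∀ i, ∀ m ∈ gr i, p i m = m) ∧
      (∀ i j, ∀ m ∈ gr j, i ≠ j → p i m = 0) := by
  let _ := h.chooseDecomposition
  refine ⟨fun i => AddMonoidHom.mk' (fun m => (DirectSum.decompose gr m i : M)) ?_, ?_, ?_, ?_⟩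
  · intro a b
    simp
  · intro i m
    exact (DirectSum.decompose gr m i).2
  · intro i m hm
    exact DirectSum.decompose_of_mem_same gr hm
  · intro i j m hm hij
    exact DirectSum.decompose_of_mem_ne gr hm (Ne.symm hij)

theorem mem_iSup_of_isInternal {M : Type*} [AddCommGroup M] {gr : ℤ → AddSubgroup M}
    (h : DirectSum.IsInternal gr) (m : M) : m ∈ ⨆ i, gr i := by
  obtain ⟨x, rfl⟩ := h.2 m
  induction x using DirectSum.induction_on with
  | zero => simp
  | of j y =>
    rw [DirectSum.coeAddMonoidHom_of]
    exact AddSubgroup.mem_iSup_of_mem j y.2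
  | add x y hx hy => rw [map_add]; exact add_mem hx hy

/-! ### Differential graded algebras -/

/-- A structure of differential (`ℤ`-)graded `k`-algebra on the `k`-algebra `A`. -/
structure DGAlgebra (k : Type w) (A : Type u) [CommRing k] [Ring A] [Algebra k A] where
  /-- the homogeneous components `A^i` -/
  gr : ℤ → Submodule k A
  graded : GradedAlgebra gr
  /-- the differential -/
  d : A →ₗ[k] A
  d_mem : ∀ {i : ℤ} {a : A}, a ∈ gr i → d a ∈ gr (i + 1)
  d_d : ∀ a, d (d a) = 0
  leibniz : ∀ {i : ℤ} {a : A}, a ∈ gr i → ∀ b, d (a * b) = d a * b + i.negOnePow • (a * d b)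

section

variable {k : Type w} {A : Type u} [CommRing k] [Ring A] [Algebra k A]

instance (𝒜 : DGAlgebra k A) : GradedAlgebra 𝒜.gr := 𝒜.graded

namespace DGAlgebra

/-- The standing conditions: `A` is positively graded, the ring `A^0` is semisimple, and the
differential vanishes on `A^0`. -/
structure IsPosSemisimple (𝒜 : DGAlgebra k A) : Prop where
  pos : ∀ i : ℤ, i < 0 → 𝒜.gr i = ⊥
  semisimple : IsSemisimpleRing (𝒜.gr 0)
  d_zero : ∀ a ∈ 𝒜.gr 0, 𝒜.d a = 0

end DGAlgebra

/-! ### Differential graded modules -/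

/-- A differential graded right module over `𝒜`. (Its `k`-module structure is the one induced from
`k → A`; the Leibniz rule makes `d` automatically `k`-linear.) -/
structure DGMod (𝒜 : DGAlgebra k A) where
  carrier : Type u
  [addCommGroup : AddCommGroup carrier]
  [module : Module Aᵐᵒᵖ carrier]
  /-- the homogeneous components `M^i` -/
  gr : ℤ → AddSubgroup carrier
  internal : DirectSum.IsInternal gr
  smul_mem : ∀ {i j : ℤ} {m : carrier} {a : A}, m ∈ gr i → a ∈ 𝒜.gr j → m <• a ∈ gr (i + j)
  /-- the differential -/
  d : carrier →+ carrier
  d_mem : ∀ {i : ℤ} {m : carrier}, m ∈ gr i → d m ∈ gr (i + 1)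
  d_d : ∀ m, d (d m) = 0
  leibniz : ∀ {i : ℤ} {m : carrier}, m ∈ gr i → ∀ a : A,
    d (m <• a) = d m <• a + i.negOnePow • (m <• 𝒜.d a)

attribute [instance] DGMod.addCommGroup DGMod.module

namespace DGMod

variable {𝒜 : DGAlgebra k A}

/-- Morphisms of dg modules: `A`-linear maps of degree zero that commute with the differentials. -/
@[ext]
structure Hom (M N : DGMod 𝒜) where
  map : M.carrier →ₗ[Aᵐᵒᵖ] N.carrier
  map_mem : ∀ {i : ℤ} {m : M.carrier}, m ∈ M.gr i → map m ∈ N.gr i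
  comm : ∀ m, map (M.d m) = N.d (map m)

/-- The category `dgMod(𝒜)`. -/
instance : Category (DGMod 𝒜) where
  Hom := Hom
  id M := ⟨LinearMap.id, fun h => h, fun _ => rfl⟩
  comp f g := ⟨g.map ∘ₗ f.map, fun h => g.map_mem (f.map_mem h), fun m => by
    simp [f.comm, g.comm]⟩

/-- The underlying linear map of a morphism of dg modules. -/
def lin {M N : DGMod 𝒜} (f : M ⟶ N) : M.carrier →ₗ[Aᵐᵒᵖ] N.carrier := Hom.map f

theorem lin_mem {M N : DGMod 𝒜} (f : M ⟶ N) {i : ℤ} {m : M.carrier} (h : m ∈ M.gr i) :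
    lin f m ∈ N.gr i := Hom.map_mem f h

theorem lin_comm {M N : DGMod 𝒜} (f : M ⟶ N) (m : M.carrier) :
    lin f (M.d m) = N.d (lin f m) := Hom.comm f m

@[simp] theorem lin_id (M : DGMod 𝒜) : lin (𝟙 M) = LinearMap.id := rfl

@[simp] theorem lin_comp {M N P : DGMod 𝒜} (f : M ⟶ N) (g : N ⟶ P) :
    lin (f ≫ g) = lin g ∘ₗ lin f := rfl

theorem lin_injective {M N : DGMod 𝒜} :
    Function.Injective (lin : (M ⟶ N) → (M.carrier →ₗ[Aᵐᵒᵖ] N.carrier)) :=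
  fun _ _ h => Hom.ext h

/-- Build a morphism from its underlying linear map. -/
def ofLin {M N : DGMod 𝒜} (f : M.carrier →ₗ[Aᵐᵒᵖ] N.carrier)
    (h : ∀ {i : ℤ} {m : M.carrier}, m ∈ M.gr i → f m ∈ N.gr i)
    (hd : ∀ m, f (M.d m) = N.d (f m)) : M ⟶ N := Hom.mk f h hd

instance (M N : DGMod 𝒜) : Zero (M ⟶ N) :=
  ⟨ofLin 0 (fun _ => zero_mem _) (fun _ => by simp)⟩

instance (M N : DGMod 𝒜) : Add (M ⟶ N) :=
  ⟨fun f g => ofLin (lin f + lin g) (fun h => add_mem (lin_mem f h) (lin_mem g h))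
    (fun _ => by simp [lin_comm])⟩

instance (M N : DGMod 𝒜) : Neg (M ⟶ N) :=
  ⟨fun f => ofLin (-lin f) (fun h => neg_mem (lin_mem f h)) (fun _ => by simp [lin_comm])⟩

instance (M N : DGMod 𝒜) : Sub (M ⟶ N) :=
  ⟨fun f g => ofLin (lin f - lin g) (fun h => sub_mem (lin_mem f h) (lin_mem g h))
    (fun _ => by simp [lin_comm])⟩

instance (M N : DGMod 𝒜) : SMul ℕ (M ⟶ N) :=
  ⟨fun n f => ofLin (n • lin f) (fun h => nsmul_mem (lin_mem f h) n)
    (fun _ => by simp [lin_comm])⟩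

instance (M N : DGMod 𝒜) : SMul ℤ (M ⟶ N) :=
  ⟨fun n f => ofLin (n • lin f) (fun h => zsmul_mem (lin_mem f h) n)
    (fun _ => by simp [lin_comm])⟩

instance (M N : DGMod 𝒜) : AddCommGroup (M ⟶ N) :=
  lin_injective.addCommGroup lin rfl (fun _ _ => rfl) (fun _ => rfl) (fun _ _ => rfl)
    (fun _ _ => rfl) (fun _ _ => rfl)

@[simp] theorem lin_add {M N : DGMod 𝒜} (f g : M ⟶ N) : lin (f + g) = lin f + lin g := rfl

@[simp] theorem lin_zero {M N : DGMod 𝒜} : lin (0 : M ⟶ N) = 0 := rfl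

instance : Preadditive (DGMod 𝒜) where
  add_comp _ _ _ f f' g := lin_injective (by simp [LinearMap.comp_add])
  comp_add _ _ _ f g g' := lin_injective (by simp [LinearMap.add_comp])

/-! ### The homotopy category -/

/-- Two morphisms of dg modules are homotopic if their difference is `d h + h d` for some
`A`-linear map `h` of degree `-1`. -/
def Homotopic : HomRel (DGMod 𝒜) := fun M N f g =>
  ∃ h : M.carrier →ₗ[Aᵐᵒᵖ] N.carrier, (∀ (i : ℤ), ∀ m ∈ M.gr i, h m ∈ N.gr (i - 1)) ∧
    ∀ m, lin f m = lin g m + (N.d (h m) + h (M.d m))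

theorem Homotopic.add {M N : DGMod 𝒜} (f₁ f₂ g₁ g₂ : M ⟶ N) (hf : Homotopic f₁ f₂)
    (hg : Homotopic g₁ g₂) : Homotopic (f₁ + g₁) (f₂ + g₂) := by
  obtain ⟨s, hs, hs'⟩ := hf
  obtain ⟨t, ht, ht'⟩ := hg
  refine ⟨s + t, fun i m hm => add_mem (hs i m hm) (ht i m hm), fun m => ?_⟩
  simp only [lin_add, LinearMap.add_apply, hs', ht', map_add]
  abel

instance : Congruence (Homotopic (𝒜 := 𝒜)) where
  equivalence := by
    intro M N
    refine ⟨fun f => ⟨0, fun _ _ _ => zero_mem _, fun m => by simp⟩, ?_, ?_⟩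
    · rintro f g ⟨h, hd, hh⟩
      refine ⟨-h, fun i m hm => neg_mem (hd i m hm), fun m => ?_⟩
      simp only [hh, LinearMap.neg_apply, map_neg]
      abel
    · rintro f g e ⟨h, hd, hh⟩ ⟨h₂, hd₂, hh₂⟩
      refine ⟨h + h₂, fun i m hm => add_mem (hd i m hm) (hd₂ i m hm), fun m => ?_⟩
      simp only [hh, hh₂, LinearMap.add_apply, map_add]
      abel
  comp_left := by
    rintro M N P f g g' ⟨h, hd, hh⟩
    exact ⟨h ∘ₗ lin f, fun i m hm => hd i _ (lin_mem f hm), fun m => by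
      simp [hh, lin_comm]⟩
  comp_right := by
    rintro M N P f f' g ⟨h, hd, hh⟩
    exact ⟨lin g ∘ₗ h, fun i m hm => lin_mem g (hd i _ hm), fun m => by
      simp [hh, lin_comm]⟩

end DGMod

/-- The homotopy category `dgHot(𝒜)`: dg modules, and homotopy classes of morphisms. -/
abbrev DGHot (𝒜 : DGAlgebra k A) := CategoryTheory.Quotient (DGMod.Homotopic (𝒜 := 𝒜))

instance (𝒜 : DGAlgebra k A) : Preadditive (DGHot 𝒜) :=
  CategoryTheory.Quotient.preadditive _ (fun _ _ => DGMod.Homotopic.add)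

/-- The canonical functor `dgMod(𝒜) ⥤ dgHot(𝒜)`, the identity on objects. -/
abbrev DGHot.functor (𝒜 : DGAlgebra k A) : DGMod 𝒜 ⥤ DGHot 𝒜 :=
  CategoryTheory.Quotient.functor _

namespace DGMod

variable {𝒜 : DGAlgebra k A}

/-! ### Constructions with dg modules -/

/-- `𝒜` as a dg right module over itself. -/
def ofAlgebra (𝒜 : DGAlgebra k A) : DGMod 𝒜 where
  carrier := A
  gr i := (𝒜.gr i).toAddSubgroup
  internal := DirectSum.Decomposition.isInternal 𝒜.gr
  smul_mem hm ha := SetLike.mul_mem_graded (A := 𝒜.gr) hm ha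
  d := 𝒜.d.toAddMonoidHom
  d_mem := 𝒜.d_mem
  d_d := 𝒜.d_d
  leibniz := 𝒜.leibniz

/-- The shift `{n}M`: `({n}M)^i = M^(i+n)`, with differential `(-1)^n d`. -/
def shift (n : ℤ) (M : DGMod 𝒜) : DGMod 𝒜 where
  carrier := M.carrier
  gr i := M.gr (i + n)
  internal := by
    obtain ⟨p, hm, h1, h2⟩ := exists_proj_of_isInternal M.internal
    refine isInternal_of_proj _ (fun i => p (i + n)) (fun i => h1 (i + n))
      (fun i j m hm hij => h2 _ _ m hm (by omega)) (fun m => ?_)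
    have := mem_iSup_of_isInternal M.internal m
    rwa [← (Equiv.addRight n).iSup_comp (g := M.gr)] at this
  smul_mem {i j m a} hm ha := by
    have := M.smul_mem hm ha
    rwa [show i + n + j = i + j + n by ring] at this
  d := n.negOnePow • M.d
  d_mem {i m} hm := by
    have h := M.d_mem hm
    rw [show i + n + 1 = i + 1 + n by ring] at h
    rcases Int.even_or_odd n with hn | hn
    · simpa [Int.negOnePow_even n hn] using h
    · simpa [Int.negOnePow_odd n hn] using h
  d_d m := by
    rcases Int.even_or_odd n with hn | hn
    · simp [Int.negOnePow_even n hn, M.d_d]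
    · simp [Int.negOnePow_odd n hn, M.d_d]
  leibniz {i m} hm a := by
    have h := M.leibniz hm a
    rcases Int.even_or_odd n with hn | hn
    · simpa [Int.negOnePow_add, Int.negOnePow_even n hn] using h
    · simp only [Int.negOnePow_add, Int.negOnePow_odd n hn] at h ⊢
      simp [h]
      abel

/-- The mapping cone of `f : M ⟶ N`: `cone(f)^i = N^i ⊕ M^(i+1)`, with differential
`(n, m) ↦ (d n + f m, - d m)`. -/
def cone {M N : DGMod 𝒜} (f : M ⟶ N) : DGMod 𝒜 where
  carrier := N.carrier × M.carrier
  gr i := (N.gr i).prod (M.gr (i + 1))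
  internal := by
    obtain ⟨p, hp, h1, h2⟩ := exists_proj_of_isInternal N.internal
    obtain ⟨q, hq, h1', h2'⟩ := exists_proj_of_isInternal M.internal
    refine isInternal_of_proj _ (fun i => (p i).prodMap (q (i + 1))) ?_ ?_ ?_
    · rintro i ⟨x, y⟩ ⟨hx, hy⟩
      exact Prod.ext (h1 _ _ hx) (h1' _ _ hy)
    · rintro i j ⟨x, y⟩ ⟨hx, hy⟩ hij
      exact Prod.ext (h2 _ _ _ hx hij) (h2' _ _ _ hy (by omega))
    · rintro ⟨x, y⟩
      have hx : ((x, 0) : N.carrier × M.carrier) ∈ ⨆ i, (N.gr i).prod (M.gr (i + 1)) := by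
        have := mem_iSup_of_isInternal N.internal x
        have h : (⨆ i, N.gr i) ≤ (⨆ i, (N.gr i).prod (M.gr (i + 1))).comap
            (AddMonoidHom.inl N.carrier M.carrier) :=
          iSup_le fun i z hz => AddSubgroup.mem_iSup_of_mem i ⟨hz, zero_mem _⟩
        exact h this
      have hy : ((0, y) : N.carrier × M.carrier) ∈ ⨆ i, (N.gr i).prod (M.gr (i + 1)) := by
        have := mem_iSup_of_isInternal M.internal y
        have h : (⨆ i, M.gr i) ≤ (⨆ i, (N.gr i).prod (M.gr (i + 1))).comap
            (AddMonoidHom.inr N.carrier M.carrier) :=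
          iSup_le fun i z hz => AddSubgroup.mem_iSup_of_mem (i - 1)
            ⟨zero_mem _, by simpa using hz⟩
        exact h this
      simpa using add_mem hx hy
  smul_mem {i j m a} hm ha := by
    refine ⟨N.smul_mem hm.1 ha, ?_⟩
    have := M.smul_mem hm.2 ha
    rwa [show i + 1 + j = i + j + 1 by ring] at this
  d := AddMonoidHom.mk' (fun x => (N.d x.1 + lin f x.2, - M.d x.2)) (fun x y => by
    ext
    · simp only [Prod.fst_add, Prod.snd_add, map_add]; abel
    · simp only [Prod.snd_add, map_add]; abel)
  d_mem {i m} hm := 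
    ⟨add_mem (N.d_mem hm.1) (lin_mem f hm.2), (M.gr (i + 1 + 1)).neg_mem (M.d_mem hm.2)⟩
  d_d m := by
    ext
    · simp [N.d_d, lin_comm]
    · simp [M.d_d]
  leibniz {i m} hm a := by
    ext
    · have h := N.leibniz hm.1 a
      simp only [AddMonoidHom.mk'_apply, Prod.smul_fst, Prod.smul_snd, Prod.fst_add, h, map_smul,
        smul_add]
      abel
    · have h := M.leibniz hm.2 a
      simp only [AddMonoidHom.mk'_apply, Prod.smul_snd, Prod.snd_add, h, smul_neg,
        Int.negOnePow_succ, Units.neg_smul]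
      abel

/-- A dg submodule of `M`: a graded `A`-submodule stable under the differential. -/
structure DGSubmodule (M : DGMod 𝒜) extends Submodule Aᵐᵒᵖ M.carrier where
  homogeneous : ∀ m ∈ toSubmodule, m ∈ ⨆ i, M.gr i ⊓ toSubmodule.toAddSubgroup
  d_mem : ∀ m ∈ toSubmodule, M.d m ∈ toSubmodule

/-- A dg submodule, considered as a dg module. -/
def DGSubmodule.toDGMod {M : DGMod 𝒜} (F : DGSubmodule M) : DGMod 𝒜 where
  carrier := F.toSubmodule
  gr i := (M.gr i).comap F.toSubmodule.toAddSubgroup.subtype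
  internal := by
    obtain ⟨p, hp, h1, h2⟩ := exists_proj_of_isInternal M.internal
    have hF : ∀ i, ∀ m ∈ F.toSubmodule, p i m ∈ F.toSubmodule := by
      intro i m hm
      have h := F.homogeneous m hm
      have h' : (⨆ i, M.gr i ⊓ F.toSubmodule.toAddSubgroup) ≤
          F.toSubmodule.toAddSubgroup.comap (p i) := by
        refine iSup_le fun j z hz => ?_
        change p i z ∈ F.toSubmodule
        by_cases hij : i = j
        · subst hij
          rw [h1 _ _ hz.1]
          exact hz.2
        · rw [h2 _ _ _ hz.1 hij]
          exact zero_mem _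
      exact h' h
    refine isInternal_of_proj _ (fun i => AddMonoidHom.mk'
      (fun m => (⟨p i m, hF i m m.2⟩ : F.toSubmodule)) (fun a b => by ext; simp)) ?_ ?_ ?_
    · intro i m hm
      exact Subtype.ext (h1 _ _ hm)
    · intro i j m hm hij
      exact Subtype.ext (h2 _ _ _ hm hij)
    · rintro ⟨m, hm⟩
      have h := F.homogeneous m hm
      have h' : (⨆ i, M.gr i ⊓ F.toSubmodule.toAddSubgroup) ≤
          (⨆ i, (M.gr i).comap F.toSubmodule.toAddSubgroup.subtype).map
            F.toSubmodule.toAddSubgroup.subtype :=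
        iSup_le fun i z hz => ⟨⟨z, hz.2⟩, AddSubgroup.mem_iSup_of_mem i hz.1, rfl⟩
      obtain ⟨y, hy, hy'⟩ := h' h
      have : y = ⟨m, hm⟩ := Subtype.ext hy'
      exact this ▸ hy
  smul_mem hm ha := M.smul_mem hm ha
  d := AddMonoidHom.mk' (fun m => ⟨M.d m, F.d_mem m m.2⟩) (fun a b => by ext; simp)
  d_mem hm := M.d_mem hm
  d_d m := Subtype.ext (M.d_d m)
  leibniz {i m} hm a := Subtype.ext (by
    have h := M.leibniz (i := i) (m := (m : M.carrier)) hm a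
    rcases Int.even_or_odd i with hn | hn
    · simpa [Int.negOnePow_even i hn] using h
    · simpa [Int.negOnePow_odd i hn] using h)

/-! ### The dg modules `L ⊗_{A^0} A` -/

section Hat

variable (𝒜) (L : Type u) [AddCommGroup L] [Module (𝒜.gr 0)ᵐᵒᵖ L]

/-- The relations `l ⊗ a₀ a = l a₀ ⊗ a` (`a₀ ∈ A^0`). Here and below, `l ⊗ a` is written with
the two factors exchanged, as `a ⊗ₜ l`, so that the right action of `A` on `A` induces the
right action of `A` on the tensor product. -/
def hatRelSet : Set (A ⊗[ℤ] L) :=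
  {t | ∃ (a₀ : 𝒜.gr 0) (a : A) (l : L), t = ((a₀ : A) * a) ⊗ₜ[ℤ] l - a ⊗ₜ[ℤ] (l <• a₀)}

/-- The submodule generated by the relations defining `L ⊗_{A^0} A`. -/
def hatRel : Submodule Aᵐᵒᵖ (A ⊗[ℤ] L) where
  carrier := AddSubgroup.closure (hatRelSet 𝒜 L)
  zero_mem' := zero_mem _
  add_mem' := add_mem
  smul_mem' b t ht := by
    induction ht using AddSubgroup.closure_induction with
    | mem x hx =>
      obtain ⟨a₀, a, l, rfl⟩ := hx
      refine AddSubgroup.subset_closure ⟨a₀, a * b.unop, l, ?_⟩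
      rw [smul_sub, TensorProduct.smul_tmul', TensorProduct.smul_tmul', MulOpposite.smul_eq_mul_unop,
        MulOpposite.smul_eq_mul_unop, mul_assoc]
    | zero => simp
    | add x y _ _ hx hy => rw [smul_add]; exact add_mem hx hy
    | neg x _ hx => rw [smul_neg]; exact neg_mem hx

/-- The right `A`-module `L ⊗_{A^0} A`. -/
abbrev HatCarrier : Type u := (A ⊗[ℤ] L) ⧸ hatRel 𝒜 L

variable {L} in
/-- The pure tensor `l ⊗ a` in `L ⊗_{A^0} A`. -/
def hatMk (l : L) (a : A) : HatCarrier 𝒜 L := (hatRel 𝒜 L).mkQ (a ⊗ₜ[ℤ] l)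

/-- The map `l ⊗ a ↦ l ⊗ φ a` induced by an additive map `φ` that commutes with left
multiplication by elements of `A^0`. -/
def hatMap (φ : A →+ A) (hφ : ∀ a₀ ∈ 𝒜.gr 0, ∀ a, φ (a₀ * a) = a₀ * φ a) :
    HatCarrier 𝒜 L →+ HatCarrier 𝒜 L :=
  QuotientAddGroup.map (hatRel 𝒜 L).toAddSubgroup (hatRel 𝒜 L).toAddSubgroup
    (LinearMap.rTensor L φ.toIntLinearMap).toAddMonoidHom (by
      intro t ht
      change t ∈ AddSubgroup.closure (hatRelSet 𝒜 L) at ht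
      change LinearMap.rTensor L φ.toIntLinearMap t ∈ AddSubgroup.closure (hatRelSet 𝒜 L)
      induction ht using AddSubgroup.closure_induction with
      | mem x hx =>
        obtain ⟨a₀, a, l, rfl⟩ := hx
        refine AddSubgroup.subset_closure ⟨a₀, φ a, l, ?_⟩
        simp [hφ _ a₀.2]
      | zero => simp
      | add x y _ _ hx hy => rw [map_add]; exact add_mem hx hy
      | neg x _ hx => rw [map_neg]; exact neg_mem hx)

@[simp] theorem hatMap_mk (φ : A →+ A) (hφ : ∀ a₀ ∈ 𝒜.gr 0, ∀ a, φ (a₀ * a) = a₀ * φ a)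
    (l : L) (a : A) : hatMap 𝒜 L φ hφ (hatMk 𝒜 l a) = hatMk 𝒜 l (φ a) := rfl

variable {𝒜 L}

theorem hatMk_add (l : L) (a b : A) : hatMk 𝒜 l (a + b) = hatMk 𝒜 l a + hatMk 𝒜 l b := by
  simp [hatMk, TensorProduct.add_tmul]

theorem hatMk_smul (l : L) (a b : A) : hatMk 𝒜 l a <• b = hatMk 𝒜 l (a * b) := rfl

theorem hatMk_mul (l : L) (a₀ : 𝒜.gr 0) (a : A) :
    hatMk 𝒜 l ((a₀ : A) * a) = hatMk 𝒜 (l <• a₀) a := by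
  refine (Submodule.Quotient.eq _).2 ?_
  exact AddSubgroup.subset_closure ⟨a₀, a, l, rfl⟩

theorem hat_induction {P : HatCarrier 𝒜 L → Prop} (h0 : P 0)
    (hmk : ∀ l a, P (hatMk 𝒜 l a)) (hadd : ∀ x y, P x → P y → P (x + y)) (x : HatCarrier 𝒜 L) :
    P x := by
  obtain ⟨t, rfl⟩ := (hatRel 𝒜 L).mkQ_surjective x
  induction t using TensorProduct.induction_on with
  | zero => simpa using h0
  | tmul a l => exact hmk l a
  | add x y hx hy => rw [map_add]; exact hadd _ _ hx hy

variable (𝒜 L)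

/-- The degree `i` component of `L ⊗_{A^0} A`: it is spanned by the `l ⊗ a` with `a ∈ A^i`. -/
def hatGr (i : ℤ) : AddSubgroup (HatCarrier 𝒜 L) :=
  AddSubgroup.closure {t | ∃ (l : L) (a : A), a ∈ 𝒜.gr i ∧ t = hatMk 𝒜 l a}

/-- The dg module `L ⊗_{A^0} A`, for `L` a right `A^0`-module placed in degree zero; the
differential is `l ⊗ a ↦ l ⊗ d a`. -/
def hat (h : 𝒜.IsPosSemisimple) : DGMod 𝒜 where
  carrier := HatCarrier 𝒜 L
  gr := hatGr 𝒜 L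
  internal := by
    refine isInternal_of_proj _ (fun i => hatMap 𝒜 L (GradedRing.proj 𝒜.gr i) ?_) ?_ ?_ ?_
    · intro a₀ h₀ a
      simp only [GradedRing.proj_apply]
      exact DirectSum.coe_decompose_mul_of_left_mem_zero 𝒜.gr h₀
    · intro i m hm
      induction hm using AddSubgroup.closure_induction with
      | mem x hx =>
        obtain ⟨l, a, ha, rfl⟩ := hx
        rw [hatMap_mk, GradedRing.proj_apply, DirectSum.decompose_of_mem_same _ ha]
      | zero => simp
      | add x y _ _ hx hy => rw [map_add, hx, hy]
      | neg x _ hx => rw [map_neg, hx]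
    · intro i j m hm hij
      induction hm using AddSubgroup.closure_induction with
      | mem x hx =>
        obtain ⟨l, a, ha, rfl⟩ := hx
        rw [hatMap_mk, GradedRing.proj_apply, DirectSum.decompose_of_mem_ne _ ha (Ne.symm hij)]
        simp [hatMk]
      | zero => simp
      | add x y _ _ hx hy => rw [map_add, hx, hy, add_zero]
      | neg x _ hx => rw [map_neg, hx, neg_zero]
    · intro m
      induction m using hat_induction with
      | h0 => exact zero_mem _
      | hmk l a =>
        induction a using DirectSum.Decomposition.inductionOn 𝒜.gr with
        | zero => simp [hatMk]
        | homogeneous a =>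
          exact AddSubgroup.mem_iSup_of_mem _ (AddSubgroup.subset_closure ⟨l, _, a.2, rfl⟩)
        | add a b ha hb => rw [hatMk_add]; exact add_mem ha hb
      | hadd x y hx hy => exact add_mem hx hy
  smul_mem {i j m a} hm ha := by
    induction hm using AddSubgroup.closure_induction with
    | mem x hx =>
      obtain ⟨l, b, hb, rfl⟩ := hx
      exact AddSubgroup.subset_closure ⟨l, b * a, SetLike.mul_mem_graded hb ha, rfl⟩
    | zero => rw [smul_zero]; exact zero_mem _
    | add x y _ _ hx hy => rw [smul_add]; exact add_mem hx hy
    | neg x _ hx => rw [smul_neg]; exact neg_mem hx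
  d := hatMap 𝒜 L 𝒜.d.toAddMonoidHom (by
    intro a₀ h₀ a
    have := 𝒜.leibniz h₀ a
    simpa [h.d_zero _ h₀] using this)
  d_mem {i m} hm := by
    induction hm using AddSubgroup.closure_induction with
    | mem x hx =>
      obtain ⟨l, b, hb, rfl⟩ := hx
      exact AddSubgroup.subset_closure ⟨l, 𝒜.d b, 𝒜.d_mem hb, rfl⟩
    | zero => rw [map_zero]; exact zero_mem _
    | add x y _ _ hx hy => rw [map_add]; exact add_mem hx hy
    | neg x _ hx => rw [map_neg]; exact neg_mem hx
  d_d m := by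
    induction m using hat_induction with
    | h0 => simp
    | hmk l a =>
      simp only [hatMap_mk, LinearMap.toAddMonoidHom_coe, 𝒜.d_d]
      simp [hatMk]
    | hadd x y hx hy => rw [map_add, map_add, hx, hy, add_zero]
  leibniz {i m} hm a := by
    induction hm using AddSubgroup.closure_induction with
    | mem x hx =>
      obtain ⟨l, b, hb, rfl⟩ := hx
      have hl := 𝒜.leibniz hb a
      simp only [hatMk_smul, hatMap_mk, LinearMap.toAddMonoidHom_coe, hl, hatMk_add]
      rcases Int.even_or_odd i with hn | hn
      · simp [Int.negOnePow_even i hn]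
      · simp [Int.negOnePow_odd i hn, hatMk, TensorProduct.neg_tmul]
    | zero => simp
    | add x y _ _ hx hy =>
      simp only [smul_add, map_add, hx, hy]
      abel
    | neg x _ hx =>
      simp only [smul_neg, map_neg, hx]
      abel

end Hat

/-! ### The categories `dgFilt` and `dgPer` -/

/-- For dg submodules `F ⊆ G` of `M`: the subquotient `G/F` is isomorphic in `dgMod(𝒜)` to
`{l}(L ⊗_{A^0} A)` for some simple right `A^0`-module `L`, i.e. there is a surjective morphism
of dg modules `G ⟶ {l}(L ⊗_{A^0} A)` with kernel `F`. -/
def IsSimpleHatSubquotient (h : 𝒜.IsPosSemisimple) {M : DGMod 𝒜} (F G : DGSubmodule M) (l : ℤ) :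
    Prop :=
  F.toSubmodule ≤ G.toSubmodule ∧
    ∃ (L : Type u) (_ : AddCommGroup L) (_ : Module (𝒜.gr 0)ᵐᵒᵖ L),
      IsSimpleModule (𝒜.gr 0)ᵐᵒᵖ L ∧
      ∃ π : G.toDGMod ⟶ shift l (hat 𝒜 L h), Function.Surjective (lin π) ∧
        ∀ m : G.toSubmodule, lin π m = 0 ↔ (m : M.carrier) ∈ F.toSubmodule

/-- `M` admits a finite filtration `0 = F_0 ⊆ F_1 ⊆ ⋯ ⊆ F_n = M` by dg submodules with
`F_i / F_{i-1} ≅ {l_i}(L_i ⊗_{A^0} A)`, where the `L_i` are simple right `A^0`-modules and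
`l_1 ≥ l_2 ≥ ⋯ ≥ l_n`. -/
def HasHatFiltration (h : 𝒜.IsPosSemisimple) (M : DGMod 𝒜) : Prop :=
  ∃ (n : ℕ) (F : Fin (n + 1) → DGSubmodule M) (l : Fin n → ℤ),
    (F 0).toSubmodule = ⊥ ∧ (F (Fin.last n)).toSubmodule = ⊤ ∧ Antitone l ∧
      ∀ i : Fin n, IsSimpleHatSubquotient h (F i.castSucc) (F i.succ) (l i)

end DGMod

/-! ### Additive categories -/

section Additive

variable {C : Type*} [Category C] [Preadditive C]

/-- `X` is the direct sum of the finite family `Y`. -/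
def IsFiniteDirectSum {n : ℕ} (X : C) (Y : Fin n → C) : Prop :=
  ∃ b : Bicone Y, Nonempty b.IsBilimit ∧ Nonempty (X ≅ b.pt)

/-- `X` is the direct sum of `Y` and `Z`. -/
def IsBinaryDirectSum (X Y Z : C) : Prop :=
  ∃ b : BinaryBicone Y Z, Nonempty b.IsBilimit ∧ Nonempty (X ≅ b.pt)

/-- `X` is indecomposable: it is nonzero, and in every decomposition `X ≅ Y ⊕ Z` one of the
summands is zero. -/
def IsIndecomposable (X : C) : Prop :=
  ¬ IsZero X ∧ ∀ Y Z : C, IsBinaryDirectSum X Y Z → IsZero Y ∨ IsZero Z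

/-- Every endomorphism of `X` is an isomorphism or nilpotent, the nilpotent endomorphisms form a
two-sided ideal, and the endomorphism ring is local. -/
def HasFittingEnd (X : C) : Prop :=
  (∀ f : End X, IsIso (f : X ⟶ X) ∨ IsNilpotent f) ∧
    (∃ I : TwoSidedIdeal (End X), ∀ f : End X, f ∈ I ↔ IsNilpotent f) ∧
    IsLocalRing (End X)

variable (C) in
/-- A Krull-Remak-Schmidt category: an additive category in which every object is a finite direct
sum of objects with local endomorphism rings. -/
structure IsKrullRemakSchmidt : Prop where
  hasFiniteBiproducts : HasFiniteBiproducts C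
  exists_decomposition : ∀ X : C, ∃ (n : ℕ) (Y : Fin n → C),
    (∀ i, IsLocalRing (End (Y i))) ∧ IsFiniteDirectSum X Y

end Additive

/-- The full subcategory of `dgHot(𝒜)` on the objects satisfying `P` is a strict triangulated
subcategory: `P` is invariant under isomorphisms, nonempty, stable under all shifts, and contains
the cone of `f` (the third vertex of the standard distinguished triangle on `f`) whenever it
contains the source and the target of `f`. -/
structure IsTriangulatedSubcategory {𝒜 : DGAlgebra k A} (P : ObjectProperty (DGHot 𝒜)) :
    Prop where
  of_iso : ∀ X Y : DGHot 𝒜, (X ≅ Y) → P X → P Y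
  nonempty : ∃ X, P X
  shift : ∀ (n : ℤ) (M : DGMod 𝒜),
    P ((DGHot.functor 𝒜).obj M) → P ((DGHot.functor 𝒜).obj (M.shift n))
  cone : ∀ (M N : DGMod 𝒜) (f : M ⟶ N), P ((DGHot.functor 𝒜).obj M) →
    P ((DGHot.functor 𝒜).obj N) → P ((DGHot.functor 𝒜).obj (DGMod.cone f))

/-- The objects of `dgPer(𝒜)`: those of the smallest full triangulated subcategory of `dgHot(𝒜)`
that contains `𝒜` and is closed under taking direct summands. -/
def dgPer (𝒜 : DGAlgebra k A) : ObjectProperty (DGHot 𝒜) := fun X =>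
  ∀ P : ObjectProperty (DGHot 𝒜), IsTriangulatedSubcategory P →
    (∀ Y Z W : DGHot 𝒜, IsBinaryDirectSum Y Z W → P Y → P Z) →
    P ((DGHot.functor 𝒜).obj (DGMod.ofAlgebra 𝒜)) → P X

/-- The objects of `dgFilt(𝒜)`, as a full subcategory of `dgHot(𝒜)`. -/
def dgFilt {𝒜 : DGAlgebra k A} (h : 𝒜.IsPosSemisimple) : ObjectProperty (DGHot 𝒜) := fun X =>
  DGMod.HasHatFiltration h X.as

end

/-!
An endomorphism ring satisfies Fitting's lemma as soon as it is strongly `π`-regular, that is, as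
soon as each element `a` has a Drazin inverse: the resulting idempotent splits off the part on which
`a` is invertible, and the rest of `a` is nilpotent.

For `M` in `dgFilt`, the graded `A`-linear endomorphisms act on `M / M A⁺`, a semisimple module of
finite length. Its endomorphism ring is artinian, the kernel of the action is nil because `M` is
generated in finitely many degrees, and the Drazin inverse of an endomorphism commuting with `d`
again commutes with `d`. Hence `End M` is strongly `π`-regular, and so is its quotient in `dgHot`.

A dg module lies in `dgFilt` if and only if it is finitely generated, projective and generated in
increasing degrees by elements whose differentials lie in the part generated so far. This condition
is inherited by direct summands and forces `d M ⊆ M A⁺`, so that a contractible object of `dgFilt`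
is zero and indecomposability in `dgFilt` amounts to indecomposability in `dgMod`. Idempotents of
`dgHot` lift to `dgMod`, where they split. As the retracts in `dgHot` of objects of `dgFilt` are
closed under shifts and cones, every object of `dgPer` is homotopy equivalent to one of `dgFilt`.
-/

/-! ### Drazin inverses -/

section Monoid

variable {R S : Type*} [Monoid R] [Monoid S]

/-- `b` is a Drazin inverse of `a`. Such a `b` is unique, and `a * b` is the idempotent that
projects onto the part of the Fitting decomposition of `a` on which `a` is invertible. -/
structure IsDrazinInverse (a b : R) : Prop where
  commute : Commute a b
  mul_mul_self : b * a * b = b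
  exists_pow : ∃ n : ℕ, a ^ (n + 1) * b = a ^ n

variable (R) in
/-- A monoid is strongly `π`-regular if each of its elements has a Drazin inverse. For a ring this
is equivalent to the stabilization of the chains `a R ⊇ a ^ 2 R ⊇ ⋯`. -/
def IsStronglyPiRegular : Prop :=
  ∀ a : R, ∃ b, IsDrazinInverse a b

theorem exists_isDrazinInverse_of_pow {a x y : R} {n : ℕ} (hx : a ^ n = a ^ (n + 1) * x)
    (hy : a ^ n = y * a ^ (n + 1)) : ∃ b, IsDrazinInverse a b := by
  have hxj : ∀ j, a ^ (n + j) * x ^ j = a ^ n := fun j => by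
    induction j with
    | zero => simp
    | succ j ih =>
      rw [pow_succ', ← mul_assoc, ← add_assoc, add_right_comm, add_comm (n + 1), pow_add,
        mul_assoc _ _ x, ← hx, ← pow_add, add_comm j, ih]
  have hyj : ∀ j, y ^ j * a ^ (n + j) = a ^ n := fun j => by
    induction j with
    | zero => simp
    | succ j ih =>
      rw [pow_succ, mul_assoc, ← add_assoc, add_right_comm, pow_add, ← mul_assoc y, ← hy,
        ← pow_add, ih]
  have hxy : a ^ n * x ^ (n + 1) = y ^ (n + 1) * a ^ n := by
    calc a ^ n * x ^ (n + 1) = y ^ (n + 1) * a ^ (n + (n + 1)) * x ^ (n + 1) := by rw [hyj]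
      _ = y ^ (n + 1) * a ^ n := by rw [mul_assoc, hxj]
  have hab : a * (a ^ n * x ^ (n + 1)) = a ^ n * x ^ n := by
    rw [← mul_assoc, ← pow_succ', pow_succ' x, ← mul_assoc, ← hx]
  have hba : a ^ n * x ^ (n + 1) * a = y ^ n * a ^ n := by
    rw [hxy, mul_assoc, ← pow_succ, pow_succ y, mul_assoc, ← hy]
  have hyx : y ^ n * a ^ n = a ^ n * x ^ n := by
    calc y ^ n * a ^ n = y ^ n * (a ^ (n + n) * x ^ n) := by rw [hxj]
      _ = a ^ n * x ^ n := by rw [← mul_assoc, hyj]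
  refine ⟨a ^ n * x ^ (n + 1), hab.trans (hyx.symm.trans hba.symm), ?_, n, ?_⟩
  · rw [hba, mul_assoc, ← mul_assoc (a ^ n), ← pow_add, pow_succ x, ← mul_assoc (a ^ (n + n)), hxj,
      ← mul_assoc, hyx, mul_assoc, ← pow_succ]
  · rw [← mul_assoc, ← pow_add, add_comm (n + 1), hxj]

namespace IsDrazinInverse

variable {a b : R}

theorem isIdempotentElem_mul (h : IsDrazinInverse a b) : IsIdempotentElem (a * b) := by
  rw [IsIdempotentElem, mul_assoc, ← mul_assoc b, h.mul_mul_self]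

theorem exists_pow_mul (h : IsDrazinInverse a b) : ∃ n : ℕ, a ^ n * (a * b) = a ^ n := by
  obtain ⟨n, hn⟩ := h.exists_pow
  exact ⟨n, by rwa [← mul_assoc, ← pow_succ]⟩

theorem mul_eq_pow_mul_pow (h : IsDrazinInverse a b) (n : ℕ) :
    a * b = a ^ (n + 1) * b ^ (n + 1) := by
  rw [← h.commute.mul_pow, h.isIdempotentElem_mul.pow_succ_eq]

theorem commute_right (h : IsDrazinInverse a b) {c : R} (hc : Commute c a) : Commute c b := by
  obtain ⟨n, hn⟩ := h.exists_pow_mul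
  have hp : a ^ (n + 1) * (a * b) = a ^ (n + 1) := by rw [pow_succ', mul_assoc, hn]
  have hp' : a * b * a ^ (n + 1) = a ^ (n + 1) := by
    rw [← (((Commute.refl a).mul_right h.commute).pow_left (n + 1)).eq, hp]
  have hcn : c * a ^ (n + 1) = a ^ (n + 1) * c := (hc.pow_right _).eq
  have hpc : c * (a * b) = a * b * c * (a * b) := by
    calc c * (a * b) = c * a ^ (n + 1) * b ^ (n + 1) := by rw [h.mul_eq_pow_mul_pow n, mul_assoc]
      _ = a * b * a ^ (n + 1) * c * b ^ (n + 1) := by rw [hcn, hp']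
      _ = a * b * c * (a * b) := by
        rw [mul_assoc _ _ c, ← hcn, h.mul_eq_pow_mul_pow n]; simp only [mul_assoc]
  have hcp : a * b * c = a * b * c * (a * b) := by
    have hba : a * b = b ^ (n + 1) * a ^ (n + 1) := by
      rw [h.mul_eq_pow_mul_pow n, (h.commute.pow_pow _ _).eq]
    calc a * b * c = b ^ (n + 1) * (c * a ^ (n + 1)) := by rw [hba, mul_assoc, hcn]
      _ = b ^ (n + 1) * (a ^ (n + 1) * c) * (a * b) := by rw [← hcn, mul_assoc, mul_assoc, hp]
      _ = a * b * c * (a * b) := by rw [hba]; simp only [mul_assoc]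
  have hb : a * b * b = b := by rw [h.commute.eq, h.mul_mul_self]
  calc c * b = c * (a * b) * b := by rw [mul_assoc, hb]
    _ = b * (a * c) * b := by rw [hpc, ← hcp, h.commute.eq, mul_assoc b]
    _ = b * (c * (a * b)) := by rw [← hc.eq]; simp only [mul_assoc]
    _ = b * (a * b * c) := by rw [hpc, ← hcp]
    _ = b * c := by rw [← mul_assoc, ← mul_assoc, h.mul_mul_self]

theorem map {F : Type*} [FunLike F R S] [MonoidHomClass F R S] (f : F)
    (h : IsDrazinInverse a b) : IsDrazinInverse (f a) (f b) where
  commute := h.commute.map f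
  mul_mul_self := by rw [← map_mul, ← map_mul, h.mul_mul_self]
  exists_pow := by
    obtain ⟨n, hn⟩ := h.exists_pow
    exact ⟨n, by rw [← map_pow, ← map_pow, ← map_mul, hn]⟩

theorem of_map {F : Type*} [FunLike F R S] [MonoidHomClass F R S] {f : F}
    (hf : Function.Injective f) (h : IsDrazinInverse (f a) (f b)) : IsDrazinInverse a b where
  commute := hf (by simpa only [map_mul] using h.commute.eq)
  mul_mul_self := hf (by simpa only [map_mul] using h.mul_mul_self)
  exists_pow := by
    obtain ⟨n, hn⟩ := h.exists_pow
    exact ⟨n, hf (by rwa [map_mul, map_pow, map_pow])⟩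

theorem mul_eq_of_isIdempotentElem (h : IsDrazinInverse a b) (ha : IsIdempotentElem a) :
    a * b = a := by
  obtain ⟨n, hn⟩ := h.exists_pow_mul
  have hn' : a ^ (n + 1) * (a * b) = a ^ (n + 1) := by rw [pow_succ', mul_assoc, hn]
  rwa [ha.pow_succ_eq, ← mul_assoc, ha.eq] at hn'

end IsDrazinInverse

namespace IsStronglyPiRegular

theorem of_surjective (hR : IsStronglyPiRegular R) (f : R →* S) (hf : Function.Surjective f) :
    IsStronglyPiRegular S := by
  intro s
  obtain ⟨a, rfl⟩ := hf s
  obtain ⟨b, hb⟩ := hR a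
  exact ⟨f b, hb.map f⟩

theorem exists_lift_isIdempotentElem (hR : IsStronglyPiRegular R) (f : R →* S)
    (hf : Function.Surjective f) {e : S} (he : IsIdempotentElem e) :
    ∃ p : R, IsIdempotentElem p ∧ f p = e := by
  obtain ⟨a, rfl⟩ := hf e
  obtain ⟨b, hb⟩ := hR a
  exact ⟨a * b, hb.isIdempotentElem_mul, by
    rw [map_mul, (hb.map f).mul_eq_of_isIdempotentElem he]⟩

end IsStronglyPiRegular

theorem isNilpotent_or_isUnit_of_isDrazinInverse {R : Type*} [MonoidWithZero R] {a b : R}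
    (h : IsDrazinInverse a b) (he : a * b = 0 ∨ a * b = 1) : IsNilpotent a ∨ IsUnit a := by
  refine he.imp (fun h0 => ?_) fun h1 => ?_
  · obtain ⟨n, hn⟩ := h.exists_pow_mul
    exact ⟨n, by rw [← hn, h0, mul_zero]⟩
  · exact ⟨⟨a, b, h1, h.commute.eq ▸ h1⟩, rfl⟩

theorem not_isNilpotent_left_of_mul_eq_one {R : Type*} [MonoidWithZero R] [Nontrivial R]
    {x y : R} (h : x * y = 1) :
    ¬ IsNilpotent x := fun ⟨n, hn⟩ =>
  not_isRightRegular_zero (hn ▸ (isRightRegular_of_mul_eq_one h).pow n)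

theorem not_isNilpotent_right_of_mul_eq_one {R : Type*} [MonoidWithZero R] [Nontrivial R]
    {x y : R} (h : x * y = 1) :
    ¬ IsNilpotent y := fun ⟨n, hn⟩ =>
  not_isLeftRegular_zero (hn ▸ (isLeftRegular_of_mul_eq_one h).pow n)

end Monoid

/-! ### Strongly π-regular and local rings -/

section Ring

variable {R S : Type*} [Ring R] [Ring S]

theorem exists_pow_eq_pow_mul_of_sub_pow_eq_zero {g x : R} {m n : ℕ}
    (h : (g - g ^ m * x) ^ n = 0) : ∃ y, g ^ n = g ^ m * y := by
  suffices ∀ n, ∃ y, (g - g ^ m * x) ^ n = g ^ n - g ^ m * y by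
    obtain ⟨y, hy⟩ := this n
    exact ⟨y, sub_eq_zero.1 (hy ▸ h)⟩
  intro n
  induction n with
  | zero => exact ⟨0, by simp⟩
  | succ n ih =>
    obtain ⟨y, hy⟩ := ih
    have hcomm : g ^ n * (g ^ m * x) = g ^ m * (g ^ n * x) := by
      rw [← mul_assoc, ← mul_assoc, ← pow_add, ← pow_add, add_comm]
    refine ⟨g ^ n * x + y * (g - g ^ m * x), ?_⟩
    rw [pow_succ, hy, sub_mul, mul_sub, hcomm, ← pow_succ, mul_add, mul_assoc, sub_sub]

theorem exists_pow_eq_mul_pow_of_sub_pow_eq_zero {g x : R} {m n : ℕ}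
    (h : (g - x * g ^ m) ^ n = 0) : ∃ y, g ^ n = y * g ^ m := by
  have h' : (MulOpposite.op g - MulOpposite.op g ^ m * MulOpposite.op x) ^ n = 0 := by
    rw [← op_pow, ← op_mul, ← MulOpposite.op_sub, ← op_pow, h, MulOpposite.op_zero]
  obtain ⟨y, hy⟩ := exists_pow_eq_pow_mul_of_sub_pow_eq_zero h'
  exact ⟨y.unop, MulOpposite.op_injective (by rw [op_pow, hy, op_mul, op_pow, MulOpposite.op_unop])⟩

theorem exists_isDrazinInverse_of_map (f : R →+* S) {N : ℕ} (hN : ∀ x, f x = 0 → x ^ N = 0)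
    {a c : R} (h : IsDrazinInverse (f a) (f c)) : ∃ b, IsDrazinInverse a b := by
  obtain ⟨n, hn⟩ := h.exists_pow_mul
  -- Modulo the kernel, `g` is divisible on both sides by `g ^ (N + 1)`.
  obtain ⟨g, hg⟩ : ∃ g, g = a ^ (n + 1) := ⟨_, rfl⟩
  obtain ⟨x, hx⟩ : ∃ x, x = c ^ ((n + 1) * N) := ⟨_, rfl⟩
  have hfg : f g ^ (N + 1) * f x = f g := by
    have hk : ∀ k, f a ^ (n + 1) * (f a * f c) ^ k = f a ^ (n + 1) := fun k => by
      induction k with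
      | zero => simp
      | succ k ih =>
        rw [pow_succ (f a * f c) k, ← mul_assoc, ih, pow_succ', mul_assoc, hn]
    rw [hg, hx, map_pow, map_pow, ← pow_mul, mul_add_one, add_comm, pow_add, mul_assoc,
      ← h.commute.mul_pow, hk]
  have hcomm : Commute (f g ^ (N + 1)) (f x) := by
    rw [hg, hx, map_pow, map_pow]
    exact ((h.commute.pow_left _).pow_left _).pow_right _
  obtain ⟨y, hy⟩ := exists_pow_eq_pow_mul_of_sub_pow_eq_zero
    (hN (g - g ^ (N + 1) * x) (by rw [map_sub, map_mul, map_pow, hfg, sub_self]))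
  obtain ⟨z, hz⟩ := exists_pow_eq_mul_pow_of_sub_pow_eq_zero
    (hN (g - x * g ^ (N + 1)) (by rw [map_sub, map_mul, map_pow, ← hcomm.eq, hfg, sub_self]))
  have hm : (n + 1) * (N + 1) = (n + 1) * N + 1 + n := by ring
  rw [hg, ← pow_mul, ← pow_mul, hm] at hy hz
  rw [pow_add _ _ n, mul_assoc] at hy
  rw [add_comm _ n, pow_add, ← mul_assoc] at hz
  exact exists_isDrazinInverse_of_pow hy hz

theorem exists_pow_eq_mul_pow_succ [IsArtinianRing R] (a : R) :
    ∃ (n : ℕ) (y : R), a ^ n = y * a ^ (n + 1) := by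
  have hanti : Antitone fun n : ℕ => Ideal.span {a ^ n} := antitone_nat_of_succ_le fun n =>
    (Ideal.span_singleton_le_iff_mem _).2 (Ideal.mem_span_singleton'.2 ⟨a, (pow_succ' a n).symm⟩)
  obtain ⟨n, hn⟩ := IsArtinian.monotone_stabilizes (R := R) (M := R) ⟨_, hanti⟩
  have hmem : a ^ n ∈ Ideal.span {a ^ (n + 1)} :=
    (hn (n + 1) n.le_succ).ge (Ideal.mem_span_singleton_self _)
  obtain ⟨y, hy⟩ := Ideal.mem_span_singleton'.1 hmem
  exact ⟨n, y, hy.symm⟩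

theorem isStronglyPiRegular_of_isSemisimpleRing [IsSemisimpleRing R] : IsStronglyPiRegular R := by
  intro a
  obtain ⟨n, y, hy⟩ := exists_pow_eq_mul_pow_succ a
  obtain ⟨m, x, hx⟩ := exists_pow_eq_mul_pow_succ (MulOpposite.op a)
  replace hx : a ^ m = a ^ (m + 1) * x.unop := by
    simpa using congrArg MulOpposite.unop hx
  refine exists_isDrazinInverse_of_pow (n := m + n) (x := x.unop) (y := y) ?_ ?_
  · rw [add_comm m n, pow_add, hx, add_assoc, pow_add a n, mul_assoc]
  · rw [add_comm m n, add_right_comm, pow_add, hy, pow_add _ _ m, mul_assoc]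

theorem isLocalRing_of_isNilpotent_or_isUnit [Nontrivial R]
    (h : ∀ a : R, IsNilpotent a ∨ IsUnit a) : IsLocalRing R :=
  IsLocalRing.of_isUnit_or_isUnit_one_sub_self fun a =>
    (h a).symm.imp_right IsNilpotent.isUnit_one_sub

theorem exists_twoSidedIdeal_mem_iff_isNilpotent [Nontrivial R]
    (h : ∀ a : R, IsNilpotent a ∨ IsUnit a) :
    ∃ I : TwoSidedIdeal R, ∀ a : R, a ∈ I ↔ IsNilpotent a := by
  have := isLocalRing_of_isNilpotent_or_isUnit h
  have hiff (a : R) : IsNilpotent a ↔ a ∈ nonunits R :=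
    ⟨fun ha hu => hu.not_isNilpotent ha, (h a).resolve_right⟩
  refine ⟨TwoSidedIdeal.mk' {a | IsNilpotent a} IsNilpotent.zero (fun {x y} hx hy => ?_)
    (fun hx => hx.neg) (fun {x y} hy => ?_) (fun {x y} hx => ?_),
    fun a => TwoSidedIdeal.mem_mk' _ _ _ _ _ _ _⟩
  · exact (hiff _).2 (IsLocalRing.nonunits_add ((hiff x).1 hx) ((hiff y).1 hy))
  · refine (hiff _).2 fun hu => ?_
    obtain ⟨z, hz⟩ := hu.exists_left_inv
    exact not_isNilpotent_right_of_mul_eq_one ((mul_assoc z x y).trans hz) hy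
  · refine (hiff _).2 fun hu => ?_
    obtain ⟨z, hz⟩ := hu.exists_right_inv
    exact not_isNilpotent_left_of_mul_eq_one ((mul_assoc x y z).symm.trans hz) hx

theorem isLocalRing_of_surjective_of_nontrivial [IsLocalRing R] [Nontrivial S] (f : R →+* S)
    (hf : Function.Surjective f) : IsLocalRing S :=
  IsLocalRing.of_isUnit_or_isUnit_one_sub_self fun s => by
    obtain ⟨a, rfl⟩ := hf s
    rw [← map_one f, ← map_sub]
    exact (IsLocalRing.isUnit_or_isUnit_of_add_one (add_sub_cancel a 1)).imp
      (fun h => h.map f) (fun h => h.map f)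

theorem eq_zero_or_one_of_isIdempotentElem [IsLocalRing R] {e : R} (he : IsIdempotentElem e) :
    e = 0 ∨ e = 1 := by
  rcases IsLocalRing.isUnit_or_isUnit_of_add_one (add_sub_cancel e 1) with h | h
  · exact Or.inr ((IsIdempotentElem.iff_eq_one_of_isUnit h).1 he)
  · exact Or.inl (sub_eq_self.1 ((IsIdempotentElem.iff_eq_one_of_isUnit h).1 he.one_sub))

end Ring

theorem exists_simple_injective (R : Type*) (V : Type u) [Ring R] [IsSemisimpleRing R]
    [AddCommGroup V] [Module R V] [Nontrivial V] :
    ∃ (L : Type u) (_ : AddCommGroup L) (_ : Module R L), IsSimpleModule R L ∧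
      ∃ φ : L →ₗ[R] V, Function.Injective φ := by
  obtain ⟨L, hL⟩ := IsSemisimpleModule.exists_simple_submodule R V
  exact ⟨L, inferInstance, inferInstance, hL, L.subtype, L.subtype_injective⟩

/-! ### Direct sums and indecomposable objects -/

section Retract

variable {C : Type*} [Category C] {X Y Z : C}

theorem isIdempotentElem_of_retract (ρ : Retract X Y) :
    IsIdempotentElem (M := End Y) (ρ.r ≫ ρ.i) := by
  change (ρ.r ≫ ρ.i) ≫ ρ.r ≫ ρ.i = ρ.r ≫ ρ.i
  rw [Category.assoc, ρ.retract_assoc]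

theorem nonempty_iso_of_comp_eq (ρ : Retract X Z) (σ : Retract Y Z)
    (h : ρ.r ≫ ρ.i = σ.r ≫ σ.i) : Nonempty (X ≅ Y) := by
  refine ⟨ρ.i ≫ σ.r, σ.i ≫ ρ.r, ?_, ?_⟩
  · calc (ρ.i ≫ σ.r) ≫ σ.i ≫ ρ.r = ρ.i ≫ (σ.r ≫ σ.i) ≫ ρ.r := by simp only [Category.assoc]
      _ = 𝟙 X := by simp [← h]
  · calc (σ.i ≫ ρ.r) ≫ ρ.i ≫ σ.r = σ.i ≫ (ρ.r ≫ ρ.i) ≫ σ.r := by simp only [Category.assoc]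
      _ = 𝟙 Y := by simp [h]

end Retract

section Preadditive

variable {C D : Type*} [Category C] [Preadditive C] [Category D] [Preadditive D]

namespace IsBinaryDirectSum

variable {X Y Z : C}

theorem of_total (i : Y ⟶ X) (r : X ⟶ Y) (i' : Z ⟶ X) (r' : X ⟶ Z) (hir : i ≫ r = 𝟙 Y)
    (hir' : i' ≫ r' = 𝟙 Z) (h : i ≫ r' = 0) (h' : i' ≫ r = 0) (htotal : r ≫ i + r' ≫ i' = 𝟙 X) :
    IsBinaryDirectSum X Y Z :=
  ⟨⟨X, r, r', i, i', hir, h, h', hir'⟩, ⟨isBinaryBilimitOfTotal _ htotal⟩, ⟨Iso.refl _⟩⟩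

theorem exists_total (h : IsBinaryDirectSum X Y Z) :
    ∃ (i : Y ⟶ X) (r : X ⟶ Y) (i' : Z ⟶ X) (r' : X ⟶ Z), i ≫ r = 𝟙 Y ∧ i' ≫ r' = 𝟙 Z ∧
      i ≫ r' = 0 ∧ i' ≫ r = 0 ∧ r ≫ i + r' ≫ i' = 𝟙 X := by
  obtain ⟨b, ⟨hb⟩, ⟨e⟩⟩ := h
  refine ⟨b.inl ≫ e.inv, e.hom ≫ b.fst, b.inr ≫ e.inv, e.hom ≫ b.snd, by simp, by simp, by simp,
    by simp, ?_⟩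
  calc (e.hom ≫ b.fst) ≫ b.inl ≫ e.inv + (e.hom ≫ b.snd) ≫ b.inr ≫ e.inv
      = e.hom ≫ (b.fst ≫ b.inl + b.snd ≫ b.inr) ≫ e.inv := by
        simp only [Preadditive.comp_add, Preadditive.add_comp, Category.assoc]
    _ = 𝟙 X := by rw [IsBilimit.binary_total hb, Category.id_comp, e.hom_inv_id]

theorem of_split {e : X ⟶ X} {i : Y ⟶ X} {r : X ⟶ Y} {i' : Z ⟶ X} {r' : X ⟶ Z}
    (hir : i ≫ r = 𝟙 Y) (hri : r ≫ i = e) (hir' : i' ≫ r' = 𝟙 Z) (hri' : r' ≫ i' = 𝟙 X - e) :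
    IsBinaryDirectSum X Y Z := by
  have hi : i ≫ e = i := by rw [← hri, reassoc_of% hir]
  have hr : e ≫ r = r := by rw [← hri, Category.assoc, hir, Category.comp_id]
  refine of_total i r i' r' hir hir' ?_ ?_ (by rw [hri, hri', add_sub_cancel])
  · calc i ≫ r' = i ≫ (r' ≫ i') ≫ r' := by rw [Category.assoc, hir', Category.comp_id]
      _ = 0 := by rw [hri', ← Category.assoc, Preadditive.comp_sub, hi, Category.comp_id, sub_self,
        zero_comp]
  · calc i' ≫ r = i' ≫ (r' ≫ i') ≫ r := by rw [← Category.assoc, ← Category.assoc, hir',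
        Category.id_comp]
      _ = 0 := by rw [hri', Preadditive.sub_comp, hr, Category.id_comp, sub_self, comp_zero]

theorem symm (h : IsBinaryDirectSum X Y Z) : IsBinaryDirectSum X Z Y := by
  obtain ⟨i, r, i', r', hir, hir', h, h', htotal⟩ := h.exists_total
  exact of_total i' r' i r hir' hir h' h (by rw [add_comm, htotal])

theorem map (h : IsBinaryDirectSum X Y Z) (F : C ⥤ D) [F.Additive] :
    IsBinaryDirectSum (F.obj X) (F.obj Y) (F.obj Z) := by
  have := preservesBinaryBiproducts_of_preservesBiproducts F
  obtain ⟨b, ⟨hb⟩, ⟨e⟩⟩ := h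
  exact ⟨F.mapBinaryBicone b, ⟨isBinaryBilimitOfPreserves F hb⟩, ⟨F.mapIso e⟩⟩

theorem of_map (F : C ⥤ D) [F.Additive] [F.Full] [F.Faithful]
    (h : IsBinaryDirectSum (F.obj X) (F.obj Y) (F.obj Z)) : IsBinaryDirectSum X Y Z := by
  obtain ⟨i, r, i', r', hir, hir', h, h', htotal⟩ := h.exists_total
  refine of_total (F.preimage i) (F.preimage r) (F.preimage i') (F.preimage r') ?_ ?_ ?_ ?_ ?_ <;>
    apply F.map_injective <;> simpa

end IsBinaryDirectSum

theorem isZero_of_map {X : C} (F : C ⥤ D) [F.Additive] [F.Faithful] (hX : IsZero (F.obj X)) :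
    IsZero X := by
  rw [IsZero.iff_id_eq_zero] at hX ⊢
  exact F.map_injective (by rw [F.map_id, hX, F.map_zero])

theorem nontrivial_end_iff {X : C} : Nontrivial (End X) ↔ ¬ IsZero X := by
  rw [IsZero.iff_id_eq_zero]
  exact ⟨fun _ => one_ne_zero (α := End X), fun h => ⟨⟨1, 0, h⟩⟩⟩

theorem isIndecomposable_of_isLocalRing_end {X : C} [IsLocalRing (End X)] : IsIndecomposable X := by
  refine ⟨nontrivial_end_iff.1 inferInstance, fun Y Z h => ?_⟩
  obtain ⟨i, r, i', r', hir, hir', -, hi'r, -⟩ := h.exists_total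
  have he : IsIdempotentElem (M := End X) (r ≫ i) := isIdempotentElem_of_retract ⟨i, r, hir⟩
  rw [IsZero.iff_id_eq_zero, IsZero.iff_id_eq_zero]
  refine (eq_zero_or_one_of_isIdempotentElem he).imp (fun h0 => ?_) fun h1 => ?_
  · calc 𝟙 Y = i ≫ (r ≫ i) ≫ r := by rw [Category.assoc, hir, Category.comp_id, hir]
      _ = 0 := by rw [show r ≫ i = 0 from h0, zero_comp, comp_zero]
  · calc 𝟙 Z = i' ≫ (r ≫ i) ≫ r' := by rw [show r ≫ i = 𝟙 X from h1, Category.id_comp, hir']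
      _ = 0 := by rw [Category.assoc, reassoc_of% hi'r, zero_comp]

theorem IsIndecomposable.eq_zero_or_one [IsIdempotentComplete C] {X : C} (hX : IsIndecomposable X)
    {e : End X} (he : IsIdempotentElem e) : e = 0 ∨ e = 1 := by
  obtain ⟨Y, i, r, hir, hri⟩ := IsIdempotentComplete.idempotents_split X e he
  obtain ⟨Z, i', r', hir', hri'⟩ :=
    IsIdempotentComplete.idempotents_split X (1 - e : End X) he.one_sub
  refine (hX.2 Y Z (.of_split hir hri hir' hri')).imp (fun h => ?_) fun h => ?_
  · rw [← hri, h.eq_of_src i 0, comp_zero]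
  · have h0 : (1 - e : End X) = 0 := by
      rw [← hri', h.eq_of_src i' 0, comp_zero]
    exact (sub_eq_zero.1 h0).symm

theorem hasFittingEnd_of_isStronglyPiRegular {X : C} (hX : ¬ IsZero X)
    (h : IsStronglyPiRegular (End X)) (he : ∀ e : End X, IsIdempotentElem e → e = 0 ∨ e = 1) :
    HasFittingEnd X := by
  have := nontrivial_end_iff.2 hX
  have key (f : End X) : IsNilpotent f ∨ IsUnit f := by
    obtain ⟨g, hg⟩ := h f
    exact isNilpotent_or_isUnit_of_isDrazinInverse hg (he _ hg.isIdempotentElem_mul)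
  exact ⟨fun f => (key f).symm.imp_left (isUnit_iff_isIso f).1,
    exists_twoSidedIdeal_mem_iff_isNilpotent key, isLocalRing_of_isNilpotent_or_isUnit key⟩

theorem isLocalRing_end_obj {X : C} (F : C ⥤ D) [F.Additive] [F.Full] [IsLocalRing (End X)]
    (h : ¬ IsZero (F.obj X)) : IsLocalRing (End (F.obj X)) :=
  have := nontrivial_end_iff.2 h
  isLocalRing_of_surjective_of_nontrivial
    { F.mapEnd X with
      map_zero' := F.map_zero X X
      map_add' := fun _ _ => F.map_add } F.map_surjective

theorem isLocalRing_end_of_obj {X : C} (F : C ⥤ D) [F.Additive] [F.Full] [F.Faithful]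
    [hX : IsLocalRing (End (F.obj X))] : IsLocalRing (End X) := by
  have : Nontrivial (End X) := nontrivial_end_iff.2 fun h =>
    nontrivial_end_iff.1 hX.toNontrivial (F.map_isZero h)
  exact isLocalRing_of_surjective_of_nontrivial (R := End (F.obj X))
    { toFun := fun f => F.preimage f
      map_one' := F.preimage_id
      map_mul' := fun f g => F.preimage_comp g f
      map_zero' := F.map_injective (by simp)
      map_add' := fun f g => F.map_injective (by rw [F.map_add]; simp) }
    fun f => ⟨F.map f, F.preimage_map f⟩

/-- `X` is the direct sum of the family `Y`, indexed by an arbitrary finite type. This is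
`IsFiniteDirectSum` in terms of inclusions and projections. -/
def IsDirectSumOf {ι : Type*} [Fintype ι] (X : C) (Y : ι → C) : Prop :=
  ∃ (i : ∀ j, Y j ⟶ X) (r : ∀ j, X ⟶ Y j), (∀ j, i j ≫ r j = 𝟙 (Y j)) ∧
    (∀ j l, j ≠ l → i j ≫ r l = 0) ∧ ∑ j, r j ≫ i j = 𝟙 X

namespace IsDirectSumOf

variable {ι κ : Type*} [Fintype ι] [Fintype κ]

theorem isFiniteDirectSum {n : ℕ} {X : C} {Y : Fin n → C} (h : IsDirectSumOf X Y) :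
    IsFiniteDirectSum X Y := by
  obtain ⟨i, r, hir, hir', htotal⟩ := h
  refine ⟨⟨X, r, i, fun j l => ?_⟩, ⟨isBilimitOfTotal _ htotal⟩, ⟨Iso.refl _⟩⟩
  split_ifs with hjl
  · subst hjl
    exact hir j
  · exact hir' j l hjl

theorem reindex {X : C} {Y : ι → C} (h : IsDirectSumOf X Y) (e : κ ≃ ι) :
    IsDirectSumOf X (Y ∘ e) := by
  obtain ⟨i, r, hir, hir', htotal⟩ := h
  exact ⟨fun l => i (e l), fun l => r (e l), fun l => hir (e l),
    fun j l hjl => hir' _ _ (e.injective.ne hjl), (e.sum_comp fun j => r j ≫ i j).trans htotal⟩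

theorem map {X : C} {Y : ι → C} (h : IsDirectSumOf X Y) (F : C ⥤ D) [F.Additive] :
    IsDirectSumOf (F.obj X) (fun j => F.obj (Y j)) := by
  obtain ⟨i, r, hir, hir', htotal⟩ := h
  refine ⟨fun j => F.map (i j), fun j => F.map (r j), fun j => ?_, fun j l hjl => ?_, ?_⟩
  · rw [← F.map_comp, hir, F.map_id]
  · rw [← F.map_comp, hir' j l hjl, F.map_zero]
  · simp only [← F.map_comp, ← F.map_sum, htotal, F.map_id]

theorem of_map {X : C} {Y : ι → C} (F : C ⥤ D) [F.Additive] [F.Full] [F.Faithful]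
    (h : IsDirectSumOf (F.obj X) (fun j => F.obj (Y j))) : IsDirectSumOf X Y := by
  obtain ⟨i, r, hir, hir', htotal⟩ := h
  refine ⟨fun j => F.preimage (i j), fun j => F.preimage (r j), fun j => ?_, fun j l hjl => ?_, ?_⟩
  · exact F.map_injective (by simpa using hir j)
  · exact F.map_injective (by simpa using hir' j l hjl)
  · exact F.map_injective (by simpa [F.map_sum] using htotal)

theorem of_iso {X X' : C} {Y : ι → C} (h : IsDirectSumOf X Y) (e : X ≅ X') :
    IsDirectSumOf X' Y := by
  obtain ⟨i, r, hir, hir', htotal⟩ := h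
  refine ⟨fun j => i j ≫ e.hom, fun j => e.inv ≫ r j, fun j => ?_, fun j l hjl => ?_, ?_⟩
  · simpa using hir j
  · simpa using hir' j l hjl
  · calc ∑ j, (e.inv ≫ r j) ≫ i j ≫ e.hom = e.inv ≫ (∑ j, r j ≫ i j) ≫ e.hom := by
          simp only [Preadditive.comp_sum, Preadditive.sum_comp, Category.assoc]
      _ = 𝟙 X' := by rw [htotal, Category.id_comp, e.inv_hom_id]

theorem of_isZero {X : C} (hX : IsZero X) (Y : Fin 0 → C) : IsDirectSumOf X Y :=
  ⟨fun j => j.elim0, fun j => j.elim0, fun j => j.elim0, fun j => j.elim0, hX.eq_of_src _ _⟩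

theorem single (X : C) : IsDirectSumOf X (fun _ : Fin 1 => X) :=
  ⟨fun _ => 𝟙 X, fun _ => 𝟙 X, fun _ => Category.comp_id _,
    fun j l hjl => (hjl (Subsingleton.elim j l)).elim, by simp⟩

theorem sum {X X₁ X₂ : C} {Y : ι → C} {Z : κ → C} (h : IsBinaryDirectSum X X₁ X₂)
    (hY : IsDirectSumOf X₁ Y) (hZ : IsDirectSumOf X₂ Z) : IsDirectSumOf X (Sum.elim Y Z) := by
  obtain ⟨i₁, r₁, i₂, r₂, h₁, h₂, h₁₂, h₂₁, htotal⟩ := h.exists_total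
  obtain ⟨i, r, hir, hir', htotal₁⟩ := hY
  obtain ⟨j, s, hjs, hjs', htotal₂⟩ := hZ
  refine ⟨Sum.rec (fun a => i a ≫ i₁) (fun a => j a ≫ i₂),
    Sum.rec (fun a => r₁ ≫ r a) (fun a => r₂ ≫ s a), ?_, ?_, ?_⟩
  · rintro (a | a)
    · simp [reassoc_of% h₁, hir]
    · simp [reassoc_of% h₂, hjs]
  · rintro (a | a) (b | b) hab
    · change (i a ≫ i₁) ≫ r₁ ≫ r b = 0
      rw [Category.assoc, reassoc_of% h₁, hir' a b fun e => hab (e ▸ rfl)]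
    · change (i a ≫ i₁) ≫ r₂ ≫ s b = 0
      rw [Category.assoc, reassoc_of% h₁₂, zero_comp, comp_zero]
    · change (j a ≫ i₂) ≫ r₁ ≫ r b = 0
      rw [Category.assoc, reassoc_of% h₂₁, zero_comp, comp_zero]
    · change (j a ≫ i₂) ≫ r₂ ≫ s b = 0
      rw [Category.assoc, reassoc_of% h₂, hjs' a b fun e => hab (e ▸ rfl)]
  · calc _ = r₁ ≫ (∑ a, r a ≫ i a) ≫ i₁ + r₂ ≫ (∑ a, s a ≫ j a) ≫ i₂ := by
          simp [Fintype.sum_sum_type, Preadditive.comp_sum, Preadditive.sum_comp]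
      _ = 𝟙 X := by rw [htotal₁, htotal₂, Category.id_comp, Category.id_comp, htotal]

end IsDirectSumOf

theorem exists_isDirectSumOf_isIndecomposable {α : Type*} [LT α] [WellFoundedLT α]
    (P : ObjectProperty C) (len : C → α)
    (hP : ∀ X Y Z, P X → IsBinaryDirectSum X Y Z → P Y)
    (hlen : ∀ X Y Z, P X → IsBinaryDirectSum X Y Z → ¬ IsZero Z → len Y < len X)
    {X : C} (hX : P X) :
    ∃ (n : ℕ) (Y : Fin n → C), (∀ i, P (Y i) ∧ IsIndecomposable (Y i)) ∧ IsDirectSumOf X Y := by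
  induction hl : len X using WellFoundedLT.induction generalizing X with
  | _ l ih =>
    subst hl
    by_cases hX0 : IsZero X
    · exact ⟨0, fun i => i.elim0, fun i => i.elim0, .of_isZero hX0 _⟩
    by_cases hXi : IsIndecomposable X
    · exact ⟨1, fun _ => X, fun _ => ⟨hX, hXi⟩, .single X⟩
    obtain ⟨Y, Z, hYZ, hY, hZ⟩ : ∃ Y Z, IsBinaryDirectSum X Y Z ∧ ¬ IsZero Y ∧ ¬ IsZero Z := by
      simpa [IsIndecomposable, hX0] using hXi
    obtain ⟨m, U, hU, hYU⟩ := ih _ (hlen X Y Z hX hYZ hZ) (hP X Y Z hX hYZ) rfl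
    obtain ⟨n, V, hV, hZV⟩ := ih _ (hlen X Z Y hX hYZ.symm hY) (hP X Z Y hX hYZ.symm) rfl
    refine ⟨m + n, Sum.elim U V ∘ finSumFinEquiv.symm, fun i => ?_,
      (IsDirectSumOf.sum hYZ hYU hZV).reindex _⟩
    rcases h : finSumFinEquiv.symm i with j | j
    · simpa [h] using hU j
    · simpa [h] using hV j

theorem hasFiniteBiproducts_of_isBinaryDirectSum (hzero : ∃ Z : C, IsZero Z)
    (h : ∀ Y Z : C, ∃ X, IsBinaryDirectSum X Y Z) : HasFiniteBiproducts C := by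
  have : HasZeroObject C := ⟨hzero⟩
  have : HasBinaryBiproducts C := ⟨fun Y Z => by
    obtain ⟨X, b, ⟨hb⟩, -⟩ := h Y Z
    exact ⟨⟨⟨b, hb⟩⟩⟩⟩
  have : HasFiniteProducts C := hasFiniteProducts_of_has_binary_and_terminal
  exact HasFiniteBiproducts.of_hasFiniteProducts

theorem hasFiniteBiproducts_fullSubcategory (P : ObjectProperty C) [P.ContainsZero]
    (hP : ∀ X Y, P X → P Y → ∃ Z, P Z ∧ IsBinaryDirectSum Z X Y) :
    HasFiniteBiproducts P.FullSubcategory := by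
  obtain ⟨Z, hZ, hPZ⟩ := P.exists_prop_of_containsZero
  refine hasFiniteBiproducts_of_isBinaryDirectSum ⟨⟨Z, hPZ⟩, isZero_of_map P.ι hZ⟩ fun X Y => ?_
  obtain ⟨W, hW, hs⟩ := hP X.obj Y.obj X.property Y.property
  exact ⟨⟨W, hW⟩, .of_map P.ι hs⟩

end Preadditive

/-! ### Homogeneous components of dg modules -/

section GradedModules

variable {k : Type w} {A : Type u} [CommRing k] [Ring A] [Algebra k A] {𝒜 : DGAlgebra k A}

namespace DGMod

noncomputable instance (M : DGMod 𝒜) : DirectSum.Decomposition M.gr :=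
  M.internal.chooseDecomposition

/-- The projection of a dg module onto its homogeneous component of degree `i`, as an additive
endomorphism. -/
noncomputable def proj (M : DGMod 𝒜) (i : ℤ) : M.carrier →+ M.carrier :=
  (M.gr i).subtype.comp
    ((DFinsupp.evalAddMonoidHom i).comp (DirectSum.decomposeAddEquiv M.gr).toAddMonoidHom)

theorem proj_mem (M : DGMod 𝒜) (i : ℤ) (m : M.carrier) : M.proj i m ∈ M.gr i :=
  (DirectSum.decompose M.gr m i).2

theorem proj_of_mem (M : DGMod 𝒜) {i : ℤ} {m : M.carrier} (hm : m ∈ M.gr i) : M.proj i m = m :=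
  DirectSum.decompose_of_mem_same M.gr hm

theorem proj_of_mem_ne (M : DGMod 𝒜) {i j : ℤ} {m : M.carrier} (hm : m ∈ M.gr j) (h : i ≠ j) :
    M.proj i m = 0 :=
  DirectSum.decompose_of_mem_ne M.gr hm h.symm

theorem homogeneous_induction (M : DGMod 𝒜) {P : M.carrier → Prop}
    (hom : ∀ i, ∀ m ∈ M.gr i, P m) (add : ∀ x y, P x → P y → P (x + y)) (m : M.carrier) : P m :=
  DirectSum.Decomposition.inductionOn M.gr (hom 0 0 (zero_mem _)) (fun m => hom _ m m.2)
    (fun x y hx hy => add x y hx hy) m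

theorem mem_of_proj (M : DGMod 𝒜) {S : Type*} [SetLike S M.carrier]
    [AddSubmonoidClass S M.carrier] (F : S) {m : M.carrier} (h : ∀ i, M.proj i m ∈ F) : m ∈ F := by
  classical
  rw [← DirectSum.sum_support_decompose M.gr m]
  exact sum_mem fun i _ => h i

theorem eq_zero_of_proj (M : DGMod 𝒜) {m : M.carrier} (h : ∀ i, M.proj i m = 0) : m = 0 :=
  M.mem_of_proj (⊥ : AddSubgroup M.carrier) h

theorem map_proj {M N : DGMod 𝒜} (f : M.carrier →+ N.carrier) (e : ℤ)
    (hf : ∀ i, ∀ m ∈ M.gr i, f m ∈ N.gr (i + e)) (i : ℤ) (m : M.carrier) :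
    f (M.proj i m) = N.proj (i + e) (f m) := by
  induction m using M.homogeneous_induction with
  | hom j m hm =>
    rcases eq_or_ne i j with rfl | h
    · rw [M.proj_of_mem hm, N.proj_of_mem (hf _ _ hm)]
    · rw [M.proj_of_mem_ne hm h, N.proj_of_mem_ne (hf _ _ hm) (by omega), map_zero]
  | add x y hx hy => simp only [map_add, hx, hy]

theorem proj_lin {M N : DGMod 𝒜} (f : M ⟶ N) (i : ℤ) (m : M.carrier) :
    N.proj i (lin f m) = lin f (M.proj i m) := by
  have := map_proj (N := N) (lin f).toAddMonoidHom 0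
    (fun j m hm => by simpa using lin_mem f hm) i m
  simpa using this.symm

theorem proj_smul (M : DGMod 𝒜) (m : M.carrier) {s : ℤ} {a : A} (ha : a ∈ 𝒜.gr s) (j : ℤ) :
    M.proj j (m <• a) = M.proj (j - s) m <• a := by
  simpa using (map_proj (DistribSMul.toAddMonoidHom M.carrier (op a)) s
    (fun _ _ hm => M.smul_mem hm ha) (j - s) m).symm

/-- An additive map that is linear for homogeneous scalars is linear. -/
def linearOfHomogeneous {X Y : Type*} [AddCommGroup X] [AddCommGroup Y] [Module Aᵐᵒᵖ X]
    [Module Aᵐᵒᵖ Y] (𝒜 : DGAlgebra k A) (f : X →+ Y)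
    (hf : ∀ s, ∀ a ∈ 𝒜.gr s, ∀ m, f (m <• a) = f m <• a) : X →ₗ[Aᵐᵒᵖ] Y where
  toFun := f
  map_add' := map_add f
  map_smul' b m := by
    change f (m <• b.unop) = f m <• b.unop
    induction b.unop using DirectSum.Decomposition.inductionOn 𝒜.gr with
    | zero => simp
    | homogeneous a => exact hf _ _ a.2 m
    | add a b ha hb => rw [MulOpposite.op_add, add_smul, add_smul, map_add, ha, hb]

/-- The submodule of all elements whose homogeneous components lie in prescribed subgroups. -/
def ofComponents (M : DGMod 𝒜) (S : ℤ → AddSubgroup M.carrier)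
    (hS : ∀ i j, ∀ m ∈ S i, ∀ a ∈ 𝒜.gr j, m <• a ∈ S (i + j)) : Submodule Aᵐᵒᵖ M.carrier where
  carrier := {m | ∀ i, M.proj i m ∈ S i}
  zero_mem' i := by simp
  add_mem' hx hy i := by
    rw [map_add]
    exact add_mem (hx i) (hy i)
  smul_mem' b m hm i := by
    change M.proj i (m <• b.unop) ∈ S i
    induction b.unop using DirectSum.Decomposition.inductionOn 𝒜.gr with
    | zero => simp
    | @homogeneous s a =>
      rw [M.proj_smul m a.2]
      simpa using hS _ s _ (hm (i - s)) _ a.2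
    | add a b ha hb =>
      rw [MulOpposite.op_add, add_smul, map_add]
      exact add_mem ha hb

theorem exists_gradedPart {M N : DGMod 𝒜} (e : ℤ) (g : M.carrier →ₗ[Aᵐᵒᵖ] N.carrier) :
    ∃ f : M.carrier →ₗ[Aᵐᵒᵖ] N.carrier, ∀ i, ∀ m ∈ M.gr i, f m = N.proj (i + e) (g m) := by
  let f : M.carrier →+ N.carrier := (DirectSum.toAddMonoid fun i =>
    (N.proj (i + e)).comp (g.toAddMonoidHom.comp (M.gr i).subtype)).comp
      (DirectSum.decomposeAddEquiv M.gr).toAddMonoidHom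
  have hf : ∀ i, ∀ m ∈ M.gr i, f m = N.proj (i + e) (g m) := fun i m hm => by
    simp [f, DirectSum.decompose_of_mem M.gr hm]
  refine ⟨linearOfHomogeneous 𝒜 f fun s a ha m => ?_, hf⟩
  induction m using M.homogeneous_induction with
  | hom i m hm =>
    rw [hf i m hm, hf _ _ (M.smul_mem hm ha), map_smul, N.proj_smul _ ha,
      show i + s + e - s = i + e by ring]
  | add x y hx hy => simp only [map_add, smul_add, hx, hy]

/-! ### Generation in bounded degrees, and the submodule `M A⁺` -/

/-- The submodule generated by the homogeneous elements of degree at most `i`. -/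
def genLE (M : DGMod 𝒜) (i : ℤ) : Submodule Aᵐᵒᵖ M.carrier :=
  Submodule.span Aᵐᵒᵖ {x | ∃ j ≤ i, x ∈ M.gr j}

theorem mem_genLE (M : DGMod 𝒜) {i j : ℤ} (h : j ≤ i) {m : M.carrier} (hm : m ∈ M.gr j) :
    m ∈ M.genLE i :=
  Submodule.subset_span ⟨j, h, hm⟩

theorem genLE_mono (M : DGMod 𝒜) : Monotone M.genLE := fun _ _ h =>
  Submodule.span_mono fun _ ⟨r, hr, hx⟩ => ⟨r, hr.trans h, hx⟩

theorem genLE_eq_bot (M : DGMod 𝒜) {i : ℤ} (h : ∀ j ≤ i, M.gr j = ⊥) : M.genLE i = ⊥ := by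
  refine eq_bot_iff.2 (Submodule.span_le.2 ?_)
  rintro x ⟨j, hj, hx⟩
  rwa [h j hj] at hx

/-- The submodule `M A⁺`, where `A⁺` is the ideal spanned by the elements of positive degree. -/
def plus (M : DGMod 𝒜) : Submodule Aᵐᵒᵖ M.carrier :=
  Submodule.span Aᵐᵒᵖ {x | ∃ (m : M.carrier) (i : ℤ) (a : A), 0 < i ∧ a ∈ 𝒜.gr i ∧ x = m <• a}

theorem smul_mem_plus (M : DGMod 𝒜) (m : M.carrier) {i : ℤ} (hi : 0 < i) {a : A}
    (ha : a ∈ 𝒜.gr i) : m <• a ∈ M.plus :=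
  Submodule.subset_span ⟨m, i, a, hi, ha, rfl⟩

theorem plus_le_comap {M N : DGMod 𝒜} (f : M.carrier →ₗ[Aᵐᵒᵖ] N.carrier) :
    M.plus ≤ N.plus.comap f := by
  refine Submodule.span_le.2 ?_
  rintro x ⟨m, i, a, hi, ha, rfl⟩
  change f (m <• a) ∈ N.plus
  rw [map_smul]
  exact N.smul_mem_plus _ hi ha

theorem proj_mem_plus (M : DGMod 𝒜) (j : ℤ) {m : M.carrier} (hm : m ∈ M.plus) :
    M.proj j m ∈ M.plus := by
  suffices M.plus ≤ M.ofComponents (fun _ => M.plus.toAddSubgroup)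
      (fun _ _ m hm a _ => M.plus.smul_mem _ hm) from this hm j
  refine Submodule.span_le.2 ?_
  rintro x ⟨m, i, a, hi, ha, rfl⟩ j
  rw [M.proj_smul m ha]
  exact M.smul_mem_plus _ hi ha

end DGMod

namespace DGAlgebra.IsPosSemisimple

theorem nonneg_or_eq_zero (h : 𝒜.IsPosSemisimple) {i : ℤ} {a : A} (ha : a ∈ 𝒜.gr i) :
    0 ≤ i ∨ a = 0 :=
  (le_or_gt 0 i).imp_right fun hi => (Submodule.mem_bot k).1 (h.pos i hi ▸ ha)

theorem induction (h : 𝒜.IsPosSemisimple) {P : A → Prop}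
    (zero : ∀ a ∈ 𝒜.gr 0, P a) (pos : ∀ i, 0 < i → ∀ a ∈ 𝒜.gr i, P a)
    (add : ∀ a b, P a → P b → P (a + b)) (a : A) : P a := by
  induction a using DirectSum.Decomposition.inductionOn 𝒜.gr with
  | zero => exact zero 0 (zero_mem _)
  | @homogeneous i a =>
    rcases h.nonneg_or_eq_zero a.2 with hi | ha
    · rcases hi.eq_or_lt with rfl | hi
      · exact zero _ a.2
      · exact pos i hi _ a.2
    · exact ha ▸ zero 0 (zero_mem _)
  | add a b ha hb => exact add a b ha hb

theorem semisimple_op (h : 𝒜.IsPosSemisimple) : IsSemisimpleRing (𝒜.gr 0)ᵐᵒᵖ :=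
  have := h.semisimple
  inferInstance

end DGAlgebra.IsPosSemisimple

/-- The inclusion of the ring `A⁰` into `A`. -/
def DGAlgebra.zeroHom (𝒜 : DGAlgebra k A) : 𝒜.gr 0 →+* A where
  toFun a := a
  map_one' := rfl
  map_mul' _ _ := rfl
  map_zero' := rfl
  map_add' _ _ := rfl

namespace DGMod

theorem proj_mem_genLE_of_mem_plus (h : 𝒜.IsPosSemisimple) (M : DGMod 𝒜) (j : ℤ) {m : M.carrier}
    (hm : m ∈ M.plus) : M.proj j m ∈ M.genLE (j - 1) := by
  have hS : ∀ i j, ∀ m ∈ M.genLE (i - 1), ∀ a ∈ 𝒜.gr j, m <• a ∈ M.genLE (i + j - 1) := by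
    intro i j m hm a ha
    rcases h.nonneg_or_eq_zero ha with hj | rfl
    · exact M.genLE_mono (by omega) ((M.genLE _).smul_mem _ hm)
    · simp
  suffices M.plus ≤ M.ofComponents (fun i => (M.genLE (i - 1)).toAddSubgroup) hS from this hm j
  refine Submodule.span_le.2 ?_
  rintro x ⟨m, i, a, hi, ha, rfl⟩ j
  rw [M.proj_smul m ha]
  exact (M.genLE _).smul_mem _ (M.mem_genLE (by omega) (M.proj_mem _ _))

theorem mem_genLE_of_mem_plus (h : 𝒜.IsPosSemisimple) (M : DGMod 𝒜) {j : ℤ} {m : M.carrier}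
    (hm : m ∈ M.plus) (hj : m ∈ M.gr j) : m ∈ M.genLE (j - 1) :=
  M.proj_of_mem hj ▸ M.proj_mem_genLE_of_mem_plus h j hm

theorem mem_plus_of_mem_genLE (h : 𝒜.IsPosSemisimple) (M : DGMod 𝒜) {i j : ℤ} (hij : i < j)
    {m : M.carrier} (hm : m ∈ M.genLE i) (hj : m ∈ M.gr j) : m ∈ M.plus := by
  suffices M.proj j m ∈ M.plus from M.proj_of_mem hj ▸ this
  clear hj
  induction hm using Submodule.span_induction with
  | mem x hx =>
    obtain ⟨r, hr, hx⟩ := hx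
    simp [M.proj_of_mem_ne hx (show j ≠ r by omega)]
  | zero => simp
  | add x y _ _ hx hy =>
    rw [map_add]
    exact add_mem hx hy
  | smul b x _ hx =>
    change M.proj j (x <• b.unop) ∈ M.plus
    induction b.unop using h.induction with
    | zero a ha => simpa [M.proj_smul x ha] using M.plus.smul_mem (op a) hx
    | pos s hs a ha => exact M.proj_smul x ha j ▸ M.smul_mem_plus _ hs ha
    | add a b ha hb =>
      rw [MulOpposite.op_add, add_smul, map_add]
      exact add_mem ha hb

theorem d_smul_of_mem_zero (h : 𝒜.IsPosSemisimple) (M : DGMod 𝒜) (m : M.carrier) {a : A}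
    (ha : a ∈ 𝒜.gr 0) : M.d (m <• a) = M.d m <• a := by
  induction m using M.homogeneous_induction with
  | hom j m hm => simp [M.leibniz hm, h.d_zero a ha]
  | add x y hx hy => simp only [smul_add, map_add, hx, hy]

theorem d_smul_mem_plus (M : DGMod 𝒜) (m : M.carrier) {i : ℤ} (hi : 0 < i) {a : A}
    (ha : a ∈ 𝒜.gr i) : M.d (m <• a) ∈ M.plus := by
  induction m using M.homogeneous_induction with
  | hom j m hm =>
    rw [M.leibniz hm, Units.smul_def]
    exact add_mem (M.smul_mem_plus _ hi ha)
      (zsmul_mem (M.smul_mem_plus m (by omega) (𝒜.d_mem ha)) _)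
  | add x y hx hy =>
    rw [smul_add, map_add]
    exact add_mem hx hy

/-- The submodule of the elements whose differential lies in `M A⁺`. -/
def dPlus (h : 𝒜.IsPosSemisimple) (M : DGMod 𝒜) : Submodule Aᵐᵒᵖ M.carrier where
  carrier := {m | M.d m ∈ M.plus}
  zero_mem' := by simp
  add_mem' hx hy := by
    change M.d _ ∈ M.plus
    rw [map_add]
    exact add_mem hx hy
  smul_mem' b m hm := by
    change M.d (m <• b.unop) ∈ M.plus
    induction b.unop using h.induction with
    | zero a ha => exact M.d_smul_of_mem_zero h m ha ▸ M.plus.smul_mem _ hm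
    | pos i hi a ha => exact M.d_smul_mem_plus m hi ha
    | add a b ha hb =>
      rw [MulOpposite.op_add, add_smul, map_add]
      exact add_mem ha hb

theorem isSemisimpleModule_quotient_plus (h : 𝒜.IsPosSemisimple) (M : DGMod 𝒜) :
    IsSemisimpleModule Aᵐᵒᵖ (M.carrier ⧸ M.plus) := by
  let I := Module.annihilator Aᵐᵒᵖ (M.carrier ⧸ M.plus)
  have hI : ∀ i, 0 < i → ∀ a ∈ 𝒜.gr i, op a ∈ I := fun i hi a ha =>
    Module.mem_annihilator.2 fun x => by
      obtain ⟨m, rfl⟩ := M.plus.mkQ_surjective x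
      rw [← map_smul]
      exact (Submodule.Quotient.mk_eq_zero _).2 (M.smul_mem_plus m hi ha)
  have hsurj : Function.Surjective ((Ideal.Quotient.mk I).comp 𝒜.zeroHom.op) := fun y => by
    obtain ⟨b, rfl⟩ := Ideal.Quotient.mk_surjective y
    rw [← op_unop b]
    induction b.unop using h.induction with
    | zero a ha => exact ⟨op ⟨a, ha⟩, rfl⟩
    | pos i hi a ha => exact ⟨0, by rw [map_zero, Ideal.Quotient.eq_zero_iff_mem.2 (hI i hi a ha)]⟩
    | add a b ha hb =>
      obtain ⟨x, hx⟩ := ha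
      obtain ⟨y, hy⟩ := hb
      exact ⟨x + y, by rw [map_add, hx, hy, MulOpposite.op_add, map_add]⟩
  have := h.semisimple_op
  have : IsSemisimpleRing (Aᵐᵒᵖ ⧸ I) := RingHom.isSemisimpleRing_of_surjective _ hsurj
  have hann : Module.IsTorsionBySet Aᵐᵒᵖ (M.carrier ⧸ M.plus) I :=
    Module.isTorsionBySet_annihilator _ _
  let _ := hann.module
  exact hann.isSemisimpleModule_iff.1 inferInstance

/-! ### Finitely generated dg modules are bounded below -/

theorem exists_genLE_eq_top (M : DGMod 𝒜) [Module.Finite Aᵐᵒᵖ M.carrier] :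
    ∃ b : ℤ, M.genLE b = ⊤ := by
  obtain ⟨n, hn⟩ := Module.Finite.fg_top.stabilizes_of_iSup_eq
    ⟨fun n : ℕ => M.genLE n, fun _ _ hmn => M.genLE_mono (by exact_mod_cast hmn)⟩
    (eq_top_iff.2 fun x _ => M.mem_of_proj (⨆ n : ℕ, M.genLE n) fun i =>
      Submodule.mem_iSup_of_mem i.toNat (M.mem_genLE (Int.self_le_toNat i) (M.proj_mem i x)))
  exact ⟨n, hn.symm⟩

/-- The submodule of the elements without components of degree less than `c`. -/
def supportedGE (h : 𝒜.IsPosSemisimple) (M : DGMod 𝒜) (c : ℤ) : Submodule Aᵐᵒᵖ M.carrier where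
  carrier := {m | ∀ i < c, M.proj i m = 0}
  zero_mem' i _ := map_zero _
  add_mem' hx hy i hi := by rw [map_add, hx i hi, hy i hi, add_zero]
  smul_mem' b m hm i hi := by
    change M.proj i (m <• b.unop) = 0
    induction b.unop using DirectSum.Decomposition.inductionOn 𝒜.gr with
    | zero => simp
    | homogeneous a =>
      rcases h.nonneg_or_eq_zero a.2 with hj | ha
      · rw [M.proj_smul m a.2, hm _ (by omega), smul_zero]
      · simp [ha]
    | add a b ha hb => rw [MulOpposite.op_add, add_smul, map_add, ha, hb, add_zero]

theorem mem_supportedGE (h : 𝒜.IsPosSemisimple) (M : DGMod 𝒜) {c i : ℤ} (hc : c ≤ i)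
    {m : M.carrier} (hm : m ∈ M.gr i) : m ∈ supportedGE h M c :=
  fun _ hj => M.proj_of_mem_ne hm (by omega)

theorem exists_gr_eq_bot (h : 𝒜.IsPosSemisimple) (M : DGMod 𝒜) [Module.Finite Aᵐᵒᵖ M.carrier] :
    ∃ c : ℤ, ∀ i < c, M.gr i = ⊥ := by
  obtain ⟨n, hn⟩ := Module.Finite.fg_top.stabilizes_of_iSup_eq
    ⟨fun n : ℕ => supportedGE h M (-n), fun _ _ hmn _ hx i hi => hx i (by omega)⟩
    (eq_top_iff.2 fun x _ => M.mem_of_proj (⨆ n : ℕ, supportedGE h M (-n)) fun i =>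
      Submodule.mem_iSup_of_mem (-i).toNat (mem_supportedGE h M (by omega) (M.proj_mem i x)))
  refine ⟨-n, fun i hi => eq_bot_iff.2 fun x hx => ?_⟩
  have hx' : x ∈ supportedGE h M (-n) := hn.le trivial
  exact M.proj_of_mem hx ▸ hx' i hi

theorem exists_lowest_degree (h : 𝒜.IsPosSemisimple) (M : DGMod 𝒜) [Module.Finite Aᵐᵒᵖ M.carrier]
    [Nontrivial M.carrier] :
    ∃ a : ℤ, (∀ i < a, M.gr i = ⊥) ∧ (∃ x ∈ M.gr a, x ≠ 0) ∧
      ∀ x ∈ M.gr a, x ∈ M.plus → x = 0 := by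
  obtain ⟨c, hc⟩ := exists_gr_eq_bot h M
  have hne : ∃ i, M.gr i ≠ ⊥ := by
    by_contra! hall
    obtain ⟨x, hx⟩ := exists_ne (0 : M.carrier)
    exact hx (M.eq_zero_of_proj fun i => by simpa [hall i] using M.proj_mem i x)
  obtain ⟨a, ha, hmin⟩ := Int.exists_least_of_bdd (P := fun i => M.gr i ≠ ⊥)
    ⟨c, fun i hi => not_lt.1 fun hlt => hi (hc i hlt)⟩ hne
  have hlow : ∀ i < a, M.gr i = ⊥ := fun i hi => not_not.1 fun hi' => hi.not_ge (hmin i hi')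
  obtain ⟨x, hx⟩ := AddSubgroup.ne_bot_iff_exists_ne_zero.1 ha
  refine ⟨a, hlow, ⟨x, x.2, by simpa using hx⟩, fun x hx hx' => ?_⟩
  have := M.mem_genLE_of_mem_plus h hx' hx
  rwa [M.genLE_eq_bot fun j hj => hlow j (by omega), Submodule.mem_bot] at this

/-! ### Endomorphism rings -/

/-- The ring of graded `A`-linear endomorphisms of `M`, not necessarily compatible with the
differential. -/
def gradedEnd (M : DGMod 𝒜) : Subring (Module.End Aᵐᵒᵖ M.carrier) where
  carrier := {f | ∀ i, ∀ m ∈ M.gr i, f m ∈ M.gr i}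
  mul_mem' hf hg i m hm := hf i _ (hg i m hm)
  one_mem' _ _ hm := hm
  add_mem' hf hg i m hm := add_mem (hf i m hm) (hg i m hm)
  zero_mem' _ _ _ := zero_mem _
  neg_mem' hf i m hm := neg_mem (hf i m hm)

/-- The action of the graded endomorphisms of `M` on `M / M A⁺`. -/
def gradedEndToQuotient (M : DGMod 𝒜) :
    M.gradedEnd →+* Module.End Aᵐᵒᵖ (M.carrier ⧸ M.plus) where
  toFun f := M.plus.mapQ M.plus f (plus_le_comap _)
  map_one' := Submodule.mapQ_id _
  map_mul' _ _ := Submodule.mapQ_comp _ _ _ _ _ _ _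
  map_zero' := Submodule.mapQ_zero _ _
  map_add' _ _ := Submodule.linearMap_qext _ rfl

theorem apply_mem_genLE_sub_one (h : 𝒜.IsPosSemisimple) {M : DGMod 𝒜} (f : M.gradedEnd)
    (hf : ∀ m, f.1 m ∈ M.plus) (i : ℤ) : M.genLE i ≤ (M.genLE (i - 1)).comap f.1 := by
  refine Submodule.span_le.2 ?_
  rintro x ⟨j, hj, hx⟩
  exact M.genLE_mono (by omega) (M.mem_genLE_of_mem_plus h (hf x) (f.2 j x hx))

theorem exists_pow_eq_zero_of_gradedEndToQuotient_eq_zero (h : 𝒜.IsPosSemisimple) (M : DGMod 𝒜)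
    [Module.Finite Aᵐᵒᵖ M.carrier] :
    ∃ N : ℕ, ∀ f : M.gradedEnd, M.gradedEndToQuotient f = 0 → f ^ N = 0 := by
  obtain ⟨b, hb⟩ := M.exists_genLE_eq_top
  obtain ⟨c, hc⟩ := exists_gr_eq_bot h M
  refine ⟨(b - c + 1).toNat, fun f hf => Subtype.ext (LinearMap.ext fun m => ?_)⟩
  have hplus : ∀ m, f.1 m ∈ M.plus := fun m =>
    (Submodule.Quotient.mk_eq_zero _).1 (LinearMap.congr_fun hf (M.plus.mkQ m))
  have hpow : ∀ n : ℕ, (f.1 ^ n) m ∈ M.genLE (b - n) := fun n => by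
    induction n with
    | zero => simp [hb]
    | succ n ih =>
      rw [pow_succ', Module.End.mul_apply]
      simpa [sub_sub] using apply_mem_genLE_sub_one h f hplus _ ih
  have := hpow (b - c + 1).toNat
  rwa [M.genLE_eq_bot fun j hj => hc j (by omega), Submodule.mem_bot] at this

end DGMod

theorem IsDrazinInverse.apply_comm {R M : Type*} [Semiring R] [AddCommGroup M] [Module R M]
    {f g : Module.End R M} (h : IsDrazinInverse f g) (δ : M →+ M)
    (hδ : ∀ m, f (δ m) = δ (f m)) (m : M) : g (δ m) = δ (g m) := by
  have hcomm : @Commute (AddMonoid.End M) _ δ (Module.toAddMonoidEnd (Module.End R M) M f) :=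
    AddMonoidHom.ext fun m => (hδ m).symm
  exact (DFunLike.congr_fun ((h.map _).commute_right hcomm).eq m).symm

namespace DGMod

/-- The homogeneous part of degree zero of a lift of `ψ` is again a lift of `ψ`, because `ψ`
preserves the grading of `M / M A⁺`. -/
theorem exists_gradedEndToQuotient_eq (M : DGMod 𝒜) [Module.Projective Aᵐᵒᵖ M.carrier]
    (f : M.gradedEnd) {ψ : Module.End Aᵐᵒᵖ (M.carrier ⧸ M.plus)}
    (hψ : IsDrazinInverse (M.gradedEndToQuotient f) ψ) : ∃ g, M.gradedEndToQuotient g = ψ := by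
  obtain ⟨s, hs⟩ := Module.projective_lifting_property M.plus.mkQ (ψ ∘ₗ M.plus.mkQ)
    M.plus.mkQ_surjective
  obtain ⟨g, hg⟩ := exists_gradedPart 0 s
  simp only [add_zero] at hg
  refine ⟨⟨g, fun i m hm => hg i m hm ▸ M.proj_mem i _⟩, Submodule.linearMap_qext _ ?_⟩
  refine LinearMap.ext fun m => ?_
  change M.plus.mkQ (g m) = ψ (M.plus.mkQ m)
  induction m using M.homogeneous_induction with
  | hom i m hm =>
    let p : (M.carrier ⧸ M.plus) →+ (M.carrier ⧸ M.plus) :=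
      QuotientAddGroup.map _ _ (M.proj i) fun x hx => M.proj_mem_plus i hx
    have hfp : ∀ x, M.gradedEndToQuotient f (p x) = p (M.gradedEndToQuotient f x) := fun x => by
      obtain ⟨x, rfl⟩ := M.plus.mkQ_surjective x
      refine congrArg M.plus.mkQ ?_
      simpa using map_proj (N := M) f.1.toAddMonoidHom 0
        (fun i m hm => by simpa using f.2 i m hm) i x
    calc M.plus.mkQ (g m) = p (M.plus.mkQ (s m)) := congrArg M.plus.mkQ (hg i m hm)
      _ = p (ψ (M.plus.mkQ m)) := congrArg p (LinearMap.congr_fun hs m)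
      _ = ψ (M.plus.mkQ (M.proj i m)) := (hψ.apply_comm p hfp _).symm
      _ = ψ (M.plus.mkQ m) := by rw [M.proj_of_mem hm]
  | add x y hx hy => rw [map_add, map_add, hx, hy, map_add, map_add]

theorem isStronglyPiRegular_gradedEnd (h : 𝒜.IsPosSemisimple) (M : DGMod 𝒜)
    [Module.Finite Aᵐᵒᵖ M.carrier] [Module.Projective Aᵐᵒᵖ M.carrier] :
    IsStronglyPiRegular M.gradedEnd := fun f => by
  have := isSemisimpleModule_quotient_plus h M
  have : IsSemisimpleRing (Module.End Aᵐᵒᵖ (M.carrier ⧸ M.plus)) := .moduleEnd ..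
  obtain ⟨ψ, hψ⟩ := isStronglyPiRegular_of_isSemisimpleRing (M.gradedEndToQuotient f)
  obtain ⟨g, rfl⟩ := exists_gradedEndToQuotient_eq M f hψ
  obtain ⟨N, hN⟩ := exists_pow_eq_zero_of_gradedEndToQuotient_eq_zero h M
  exact exists_isDrazinInverse_of_map M.gradedEndToQuotient hN hψ

/-- The inclusion of the endomorphisms of the dg module `M` into the graded endomorphisms. -/
def endToGradedEnd (M : DGMod 𝒜) : End M →* M.gradedEnd where
  toFun f := ⟨lin f, fun _ _ => lin_mem f⟩
  map_one' := rfl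
  map_mul' _ _ := rfl

theorem isStronglyPiRegular_end (h : 𝒜.IsPosSemisimple) (M : DGMod 𝒜)
    [Module.Finite Aᵐᵒᵖ M.carrier] [Module.Projective Aᵐᵒᵖ M.carrier] :
    IsStronglyPiRegular (End M) := fun f => by
  obtain ⟨g, hg⟩ := isStronglyPiRegular_gradedEnd h M (M.endToGradedEnd f)
  refine ⟨ofLin g.1 (g.2 _ _) ((hg.map M.gradedEnd.subtype).apply_comm M.d (lin_comm f)), ?_⟩
  exact hg.of_map fun _ _ hfg => lin_injective (congrArg Subtype.val hfg)

end DGMod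

end GradedModules

/-! ### The dg modules `L ⊗_{A⁰} A` -/

section Hat

variable {k : Type w} {A : Type u} [CommRing k] [Ring A] [Algebra k A] {𝒜 : DGAlgebra k A}

namespace DGMod

variable (L : Type u) [AddCommGroup L] [Module (𝒜.gr 0)ᵐᵒᵖ L]

theorem hatMk_eq_smul (l : L) (a : A) : hatMk 𝒜 l a = hatMk 𝒜 l 1 <• a := by
  rw [hatMk_smul, one_mul]

/-- The map `l ↦ l ⊗ 1`. -/
def hatUnit : L →+ HatCarrier 𝒜 L :=
  AddMonoidHom.mk' (fun l => hatMk 𝒜 l 1) fun l l' => by simp [hatMk, TensorProduct.tmul_add]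

theorem hatUnit_smul (a : 𝒜.gr 0) (l : L) :
    hatUnit (𝒜 := 𝒜) L (l <• a) = hatUnit L l <• (a : A) := by
  change hatMk 𝒜 (l <• a) 1 = hatMk 𝒜 l 1 <• (a : A)
  rw [← hatMk_mul, hatMk_smul, one_mul, mul_one]

variable {L}

/-- The `A`-linear map `A ⊗_ℤ L → Y`, `a ⊗ l ↦ φ(l) a`, induced by an additive map `φ : L → Y`. -/
def tensorLift {Y : Type*} [AddCommGroup Y] [Module Aᵐᵒᵖ Y] (φ : L →+ Y) :
    A ⊗[ℤ] L →ₗ[Aᵐᵒᵖ] Y where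
  __ := TensorProduct.liftAddHom
    (AddMonoidHom.mk' (fun a : A => (DistribSMul.toAddMonoidHom Y (op a)).comp φ) fun a b => by
      ext l
      simp [add_smul])
    fun r a l => by
      simp only [AddMonoidHom.mk'_apply, map_zsmul, AddMonoidHom.smul_apply]
  map_smul' b t := by
    induction t using TensorProduct.induction_on with
    | zero => simp
    | tmul a l =>
      change φ l <• (a * b.unop) = (φ l <• a) <• b.unop
      rw [op_mul, mul_smul]
    | add x y hx hy =>
      rw [smul_add]
      simp_all

theorem exists_hatLift {Y : Type*} [AddCommGroup Y] [Module Aᵐᵒᵖ Y] (φ : L →+ Y)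
    (hφ : ∀ (a : 𝒜.gr 0) (l : L), φ (l <• a) = φ l <• (a : A)) :
    ∃ Φ : HatCarrier 𝒜 L →ₗ[Aᵐᵒᵖ] Y, ∀ l, Φ (hatMk 𝒜 l 1) = φ l := by
  refine ⟨(hatRel 𝒜 L).liftQ (tensorLift φ) fun t ht => ?_, fun l => one_smul Aᵐᵒᵖ (φ l)⟩
  change t ∈ AddSubgroup.closure (hatRelSet 𝒜 L) at ht
  rw [LinearMap.mem_ker]
  induction ht using AddSubgroup.closure_induction with
  | mem x hx =>
    obtain ⟨a₀, a, l, rfl⟩ := hx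
    rw [map_sub]
    change φ l <• ((a₀ : A) * a) - φ (l <• a₀) <• a = 0
    rw [hφ, op_mul, mul_smul, sub_self]
  | zero => simp
  | add x y _ _ hx hy => rw [map_add, hx, hy, add_zero]
  | neg x _ hx => rw [map_neg, hx, neg_zero]

theorem hat_hom_ext {Y : Type*} [AddCommGroup Y] [Module Aᵐᵒᵖ Y]
    {f g : HatCarrier 𝒜 L →ₗ[Aᵐᵒᵖ] Y} (hfg : ∀ l, f (hatMk 𝒜 l 1) = g (hatMk 𝒜 l 1)) :
    f = g := by
  refine LinearMap.ext fun x => ?_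
  induction x using hat_induction with
  | h0 => simp
  | hmk l a => rw [hatMk_eq_smul, map_smul, map_smul, hfg]
  | hadd x y hx hy => rw [map_add, map_add, hx, hy]

variable (L)

theorem projective_hat (h : 𝒜.IsPosSemisimple) : Module.Projective Aᵐᵒᵖ (HatCarrier 𝒜 L) := by
  have := h.semisimple_op
  have := Module.projective_of_isSemisimpleRing (𝒜.gr 0)ᵐᵒᵖ L
  refine Module.Projective.of_lifting_property fun {X Y} _ _ _ _ f g hf => ?_
  let _ := Module.compHom X 𝒜.zeroHom.op
  let _ := Module.compHom Y 𝒜.zeroHom.op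
  let f₀ : X →ₗ[(𝒜.gr 0)ᵐᵒᵖ] Y :=
    { f.toAddMonoidHom with map_smul' := fun a => map_smul f (𝒜.zeroHom.op a) }
  let g₀ : L →ₗ[(𝒜.gr 0)ᵐᵒᵖ] Y :=
    { g.toAddMonoidHom.comp (hatUnit L) with
      map_smul' := fun a l =>
        (congrArg g (hatUnit_smul L a.unop l)).trans (map_smul g (𝒜.zeroHom.op a) _) }
  obtain ⟨u, hu⟩ := Module.projective_lifting_property f₀ g₀ hf
  obtain ⟨U, hU⟩ := exists_hatLift u.toAddMonoidHom fun a l => map_smul u (op a) l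
  exact ⟨U, hat_hom_ext fun l => (congrArg f (hU l)).trans (LinearMap.congr_fun hu l)⟩

theorem finite_hat [IsSimpleModule (𝒜.gr 0)ᵐᵒᵖ L] : Module.Finite Aᵐᵒᵖ (HatCarrier 𝒜 L) := by
  have := IsSimpleModule.nontrivial (𝒜.gr 0)ᵐᵒᵖ L
  obtain ⟨l₀, hl₀⟩ := exists_ne (0 : L)
  refine ⟨{hatMk 𝒜 l₀ 1}, Submodule.eq_top_iff'.2 fun x => ?_⟩
  rw [Finset.coe_singleton]
  induction x using hat_induction with
  | h0 => exact zero_mem _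
  | hmk l a =>
    obtain ⟨b, rfl⟩ := Submodule.mem_span_singleton.1
      ((IsSimpleModule.span_singleton_eq_top (𝒜.gr 0)ᵐᵒᵖ hl₀).ge (Submodule.mem_top (x := l)))
    exact Submodule.mem_span_singleton.2 ⟨op ((b.unop : A) * a), by
      change _ = hatMk 𝒜 (l₀ <• b.unop) a
      rw [← hatMk_mul, hatMk_eq_smul L l₀ ((b.unop : A) * a)]⟩
  | hadd x y hx hy => exact add_mem hx hy

variable (h : 𝒜.IsPosSemisimple)

theorem hatMk_mem (l : L) {i : ℤ} {a : A} (ha : a ∈ 𝒜.gr i) : hatMk 𝒜 l a ∈ (hat 𝒜 L h).gr i :=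
  AddSubgroup.subset_closure ⟨l, a, ha, rfl⟩

theorem hatMk_one_mem (l : L) : hatMk 𝒜 l 1 ∈ (hat 𝒜 L h).gr 0 :=
  hatMk_mem L h l SetLike.GradedOne.one_mem

theorem hat_gr_eq_bot {i : ℤ} (hi : i < 0) : (hat 𝒜 L h).gr i = ⊥ := by
  refine AddSubgroup.closure_eq_bot_iff.2 ?_
  rintro _ ⟨l, a, ha, rfl⟩
  rw [h.pos i hi, Submodule.mem_bot] at ha
  simp [ha, hatMk]

theorem exists_hatMk_of_mem_zero {x : HatCarrier 𝒜 L} (hx : x ∈ (hat 𝒜 L h).gr 0) :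
    ∃ l, x = hatMk 𝒜 l 1 := by
  have hle : hatGr 𝒜 L 0 ≤ (hatUnit L).range := (AddSubgroup.closure_le _).2 <| by
    rintro _ ⟨l, a, ha, rfl⟩
    exact ⟨l <• (⟨a, ha⟩ : 𝒜.gr 0), by
      change hatMk 𝒜 (l <• (⟨a, ha⟩ : 𝒜.gr 0)) 1 = hatMk 𝒜 l a
      rw [← hatMk_mul, mul_one]⟩
  obtain ⟨l, rfl⟩ := hle hx
  exact ⟨l, rfl⟩

theorem hat_d_hatMk_one (l : L) : (hat 𝒜 L h).d (hatMk 𝒜 l 1) = 0 := by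
  change hatMk 𝒜 l (𝒜.d 1) = 0
  rw [h.d_zero 1 SetLike.GradedOne.one_mem]
  simp [hatMk]

theorem exists_mkQ_eq_mkQ_hatMk_one (x : HatCarrier 𝒜 L) :
    ∃ l, (hat 𝒜 L h).plus.mkQ (hatMk 𝒜 l 1) = (hat 𝒜 L h).plus.mkQ x := by
  let u : L →+ ((hat 𝒜 L h).carrier ⧸ (hat 𝒜 L h).plus) :=
    (hat 𝒜 L h).plus.mkQ.toAddMonoidHom.comp (hatUnit L)
  change (hat 𝒜 L h).plus.mkQ x ∈ u.range
  induction x using hat_induction with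
  | h0 => exact zero_mem _
  | hmk l a =>
    induction a using h.induction with
    | zero a ha =>
      obtain ⟨l', hl'⟩ := exists_hatMk_of_mem_zero L h (hatMk_mem L h l ha)
      exact ⟨l', congrArg (hat 𝒜 L h).plus.mkQ hl'.symm⟩
    | pos i hi a ha =>
      rw [hatMk_eq_smul]
      refine ⟨0, (map_zero u).trans ?_⟩
      exact ((Submodule.Quotient.mk_eq_zero _).2 ((hat 𝒜 L h).smul_mem_plus _ hi ha)).symm
    | add a b ha hb =>
      rw [hatMk_add]
      exact add_mem ha hb
  | hadd x y hx hy => exact add_mem hx hy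

theorem hat_proj_zero_of_mem_plus {x : HatCarrier 𝒜 L} (hx : x ∈ (hat 𝒜 L h).plus) :
    (hat 𝒜 L h).proj 0 x = 0 := by
  have := (hat 𝒜 L h).proj_mem_genLE_of_mem_plus h 0 hx
  rwa [(hat 𝒜 L h).genLE_eq_bot fun i hi => hat_gr_eq_bot L h (by omega),
    Submodule.mem_bot] at this

variable {L}

theorem exists_retraction (M : DGMod 𝒜) [Module.Projective Aᵐᵒᵖ M.carrier] {b : ℤ}
    (φ : L →+ M.carrier) (hφ : ∀ (a : 𝒜.gr 0) (l : L), φ (l <• a) = φ l <• (a : A))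
    (hmem : ∀ l, φ l ∈ M.gr b) (hinj : ∀ l, φ l ∈ M.plus → l = 0) :
    ∃ ρ : M.carrier →ₗ[Aᵐᵒᵖ] HatCarrier 𝒜 L,
      (∀ i, ∀ m ∈ M.gr i, ρ m ∈ (hat 𝒜 L h).gr (i + -b)) ∧ ∀ l, ρ (φ l) = hatMk 𝒜 l 1 := by
  let H := hat 𝒜 L h
  have := isSemisimpleModule_quotient_plus h M
  obtain ⟨Φ, hΦ⟩ := exists_hatLift φ hφ
  let Φ' := H.plus.mapQ M.plus Φ (plus_le_comap (M := H) (N := M) Φ)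
  have hΦ' : Function.Injective Φ' := (injective_iff_map_eq_zero Φ').2 fun x hx => by
    obtain ⟨x, rfl⟩ := H.plus.mkQ_surjective x
    obtain ⟨l, hl⟩ := exists_mkQ_eq_mkQ_hatMk_one L h x
    have hl0 : M.plus.mkQ (φ l) = 0 := by
      rw [← hΦ, ← hx, ← hl]
      rfl
    rw [← hl, hinj l ((Submodule.Quotient.mk_eq_zero _).1 hl0)]
    exact (congrArg H.plus.mkQ (hatUnit L).map_zero).trans (map_zero _)
  obtain ⟨r, hr⟩ := IsSemisimpleModule.extension_property Φ' hΦ' LinearMap.id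
  obtain ⟨σ, hσ⟩ := Module.projective_lifting_property H.plus.mkQ (r ∘ₗ M.plus.mkQ)
    H.plus.mkQ_surjective
  obtain ⟨ρ, hρ⟩ := exists_gradedPart (N := H) (-b) σ
  refine ⟨ρ, fun i m hm => hρ i m hm ▸ H.proj_mem _ _, fun l => ?_⟩
  set y : H.carrier := hatMk 𝒜 l 1
  have hl : σ (φ l) - y ∈ H.plus := by
    rw [← Submodule.Quotient.eq, ← hΦ]
    exact (LinearMap.congr_fun hσ _).trans (LinearMap.congr_fun hr (H.plus.mkQ y))
  calc ρ (φ l) = H.proj 0 (σ (φ l)) := by rw [hρ b _ (hmem l), add_neg_cancel]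
    _ = H.proj 0 y :=
      sub_eq_zero.1 ((map_sub (H.proj 0) _ _).symm.trans (hat_proj_zero_of_mem_plus L h hl))
    _ = y := H.proj_of_mem (hatMk_one_mem L h l)

end DGMod

end Hat

/-! ### An intrinsic characterization of `dgFilt` -/

section HatFiltered

variable {k : Type w} {A : Type u} [CommRing k] [Ring A] [Algebra k A] {𝒜 : DGAlgebra k A}

namespace DGMod

/-- The intrinsic form of the condition defining `dgFilt`: `M` is finitely generated and
projective over `A`, and `M` is generated step by step, in increasing degrees `j`, by homogeneous
elements whose differentials lie in the submodule generated so far. Unlike the existence of a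
filtration, this condition is visibly stable under direct summands. -/
structure IsHatFiltered (M : DGMod 𝒜) : Prop where
  finite : Module.Finite Aᵐᵒᵖ M.carrier
  projective : Module.Projective Aᵐᵒᵖ M.carrier
  induction : ∀ (j : ℤ) (F : Submodule Aᵐᵒᵖ M.carrier), (∀ i < j, ∀ x ∈ M.gr i, x ∈ F) →
    (∀ x ∈ M.gr j, M.d x ∈ F → x ∈ F) → ∀ x ∈ M.gr j, x ∈ F

theorem IsHatFiltered.of_surjective {M N : DGMod 𝒜} (hM : M.IsHatFiltered) (q : M ⟶ N)
    (hq : Function.Surjective (lin q)) [hN : Module.Projective Aᵐᵒᵖ N.carrier] :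
    N.IsHatFiltered where
  finite :=
    have := hM.finite
    Module.Finite.of_surjective (lin q) hq
  projective := hN
  induction j F h₁ h₂ y hy := by
    obtain ⟨x, rfl⟩ := hq y
    rw [← N.proj_of_mem hy, proj_lin]
    refine hM.induction j (F.comap (lin q)) (fun i hi x hx => h₁ i hi _ (lin_mem q hx))
      (fun x hx hdx => h₂ _ (lin_mem q hx) ?_) _ (M.proj_mem _ _)
    rw [← lin_comm]
    exact hdx

theorem IsHatFiltered.of_retract {M N : DGMod 𝒜} (hM : M.IsHatFiltered) (i : N ⟶ M) (q : M ⟶ N)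
    (hiq : i ≫ q = 𝟙 N) : N.IsHatFiltered := by
  have hl : lin q ∘ₗ lin i = LinearMap.id := congrArg lin hiq
  have := hM.projective
  have : Module.Projective Aᵐᵒᵖ N.carrier := Module.Projective.of_split (lin i) (lin q) hl
  exact hM.of_surjective q fun x => ⟨lin i x, LinearMap.congr_fun hl x⟩

theorem IsHatFiltered.d_mem_plus (h : 𝒜.IsPosSemisimple) {M : DGMod 𝒜} (hM : M.IsHatFiltered)
    (m : M.carrier) : M.d m ∈ M.plus := by
  have := hM.finite
  obtain ⟨c, hc⟩ := exists_gr_eq_bot h M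
  have hlt : ∀ (n : ℕ), ∀ j < c + n, ∀ x ∈ M.gr j, x ∈ dPlus h M := fun n => by
    induction n with
    | zero =>
      intro j hj x hx
      rw [hc j (by omega), AddSubgroup.mem_bot] at hx
      exact hx ▸ zero_mem _
    | succ n ih =>
      intro j hj x hx
      refine (hM.induction j (M.genLE j ⊓ dPlus h M)
        (fun i hi y hy => ⟨M.mem_genLE hi.le hy, ih i (by omega) y hy⟩)
        (fun y hy hdy => ⟨M.mem_genLE le_rfl hy, ?_⟩) x hx).2
      exact M.mem_plus_of_mem_genLE h (lt_add_one j) hdy.1 (M.d_mem hy)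
  exact M.mem_of_proj (dPlus h M) fun i => hlt (i + 1 - c).toNat i (by omega) _ (M.proj_mem i m)

theorem isHatFiltered_of_genLE_eq_top {M : DGMod 𝒜} [Module.Finite Aᵐᵒᵖ M.carrier]
    [Module.Projective Aᵐᵒᵖ M.carrier] {j : ℤ} (hj : M.genLE j = ⊤) (hlow : ∀ i < j, M.gr i = ⊥)
    (hd : ∀ x ∈ M.gr j, M.d x = 0) : M.IsHatFiltered where
  finite := inferInstance
  projective := inferInstance
  induction i F h₁ h₂ x hx := by
    rcases lt_trichotomy i j with hi | rfl | hi
    · rw [hlow i hi, AddSubgroup.mem_bot] at hx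
      exact hx ▸ zero_mem F
    · exact h₂ x hx (hd x hx ▸ zero_mem F)
    · suffices M.genLE j ≤ F from this (hj.ge trivial)
      exact Submodule.span_le.2 fun y ⟨s, hs, hy⟩ => h₁ s (by omega) y hy

theorem isHatFiltered_ofAlgebra (h : 𝒜.IsPosSemisimple) : (ofAlgebra 𝒜).IsHatFiltered := by
  have : Module.Finite Aᵐᵒᵖ (ofAlgebra 𝒜).carrier :=
    Module.Finite.equiv (opLinearEquiv Aᵐᵒᵖ (M := A)).symm
  have : Module.Projective Aᵐᵒᵖ (ofAlgebra 𝒜).carrier :=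
    Module.Projective.of_equiv (opLinearEquiv Aᵐᵒᵖ (M := A)).symm
  refine isHatFiltered_of_genLE_eq_top (j := 0) (Submodule.eq_top_iff'.2 fun x => ?_)
    (fun i hi => ?_) h.d_zero
  · have one_mem : (1 : A) ∈ 𝒜.gr 0 := SetLike.GradedOne.one_mem
    have mem_of_one_mem (y : A) (h1 : (1 : A) ∈ (ofAlgebra 𝒜).genLE 0) :
        y ∈ (ofAlgebra 𝒜).genLE 0 := by
      have hy := ((ofAlgebra 𝒜).genLE 0).smul_mem (op y) h1
      exact (one_mul y : (op y • (1 : A) : A) = y) ▸ hy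
    exact mem_of_one_mem x ((ofAlgebra 𝒜).mem_genLE le_rfl one_mem)
  · exact AddSubgroup.ext fun (x : A) => by
      change x ∈ 𝒜.gr i ↔ x ∈ (⊥ : AddSubgroup A)
      rw [h.pos i hi]
      rfl

/-- The length of the `A`-module `M / M A⁺`, on which the construction of a filtration and the
decomposition into indecomposables proceed by induction. -/
noncomputable def topLength (M : DGMod 𝒜) : ℕ∞ := Module.length Aᵐᵒᵖ (M.carrier ⧸ M.plus)

theorem topLength_lt (h : 𝒜.IsPosSemisimple) {M N : DGMod 𝒜} [Module.Finite Aᵐᵒᵖ M.carrier]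
    (q : M.carrier →ₗ[Aᵐᵒᵖ] N.carrier) (hq : Function.Surjective q) {x : M.carrier}
    (hx : x ∉ M.plus) (hqx : q x ∈ N.plus) : N.topLength < M.topLength := by
  have := isSemisimpleModule_quotient_plus h M
  let Q := M.plus.mapQ N.plus q (plus_le_comap q)
  have hQ : Function.Surjective Q := fun y => by
    obtain ⟨y, rfl⟩ := N.plus.mkQ_surjective y
    obtain ⟨x, rfl⟩ := hq y
    exact ⟨M.plus.mkQ x, rfl⟩
  have hker : Q.ker ≠ ⊥ := fun hbot =>
    hx ((Submodule.Quotient.mk_eq_zero _).1 (LinearMap.ker_eq_bot'.1 hbot (M.plus.mkQ x)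
      ((Submodule.Quotient.mk_eq_zero _).2 hqx)))
  have := Submodule.length_quotient_lt Q.ker hker
  rwa [(Q.quotKerEquivOfSurjective hQ).length_eq] at this

end DGMod

end HatFiltered

/-! ### Submodules, quotients and graded splittings -/

theorem map_negOnePow_smul {X Y : Type*} [AddCommGroup X] [AddCommGroup Y] (f : X →+ Y) (n : ℤ)
    (x : X) : f (n.negOnePow • x) = n.negOnePow • f x := by
  rw [Units.smul_def, Units.smul_def, map_zsmul]

section Splittings

variable {k : Type w} {A : Type u} [CommRing k] [Ring A] [Algebra k A] {𝒜 : DGAlgebra k A}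

namespace DGMod

theorem DGSubmodule.proj_mem {M : DGMod 𝒜} (F : DGSubmodule M) (i : ℤ) {m : M.carrier}
    (hm : m ∈ F.toSubmodule) : M.proj i m ∈ F.toSubmodule := by
  suffices (⨆ j, M.gr j ⊓ F.toSubmodule.toAddSubgroup) ≤
      F.toSubmodule.toAddSubgroup.comap (M.proj i) from this (F.homogeneous m hm)
  refine iSup_le fun j z hz => ?_
  change M.proj i z ∈ F.toSubmodule
  rcases eq_or_ne i j with rfl | hij
  · exact (M.proj_of_mem hz.1).symm ▸ hz.2
  · exact (M.proj_of_mem_ne hz.1 hij).symm ▸ zero_mem _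

/-- A submodule that is stable under the projections and the differential, as a dg submodule. -/
def DGSubmodule.ofStable {M : DGMod 𝒜} (F : Submodule Aᵐᵒᵖ M.carrier)
    (hp : ∀ i, ∀ m ∈ F, M.proj i m ∈ F) (hd : ∀ m ∈ F, M.d m ∈ F) : DGSubmodule M where
  toSubmodule := F
  homogeneous m hm := M.mem_of_proj _ fun i =>
    AddSubgroup.mem_iSup_of_mem i ⟨M.proj_mem i m, hp i m hm⟩
  d_mem := hd

/-- The image of a morphism of dg modules, as a dg submodule of the target. -/
def range {M N : DGMod 𝒜} (f : M ⟶ N) : DGSubmodule N :=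
  DGSubmodule.ofStable (lin f).range
    (by
      rintro i _ ⟨m, rfl⟩
      exact ⟨M.proj i m, (proj_lin f i m).symm⟩)
    (by
      rintro _ ⟨m, rfl⟩
      exact ⟨M.d m, lin_comm f m⟩)

/-- The inverse image of a dg submodule under a morphism of dg modules. -/
def DGSubmodule.preimage {M N : DGMod 𝒜} (f : M ⟶ N) (F : DGSubmodule N) : DGSubmodule M :=
  DGSubmodule.ofStable (F.toSubmodule.comap (lin f))
    (fun i m hm => by
      rw [Submodule.mem_comap, ← proj_lin]
      exact F.proj_mem i hm)
    (fun m hm => by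
      rw [Submodule.mem_comap, lin_comm]
      exact F.d_mem _ hm)

/-- The zero submodule of a dg module, as a dg submodule. -/
def DGSubmodule.zero (M : DGMod 𝒜) : DGSubmodule M :=
  DGSubmodule.ofStable ⊥
    (fun i m hm => by rw [(Submodule.mem_bot _).1 hm, map_zero]; exact zero_mem _)
    (fun m hm => by rw [(Submodule.mem_bot _).1 hm, map_zero]; exact zero_mem _)

/-- The inclusion of a dg submodule in a larger one, as a morphism of dg modules. -/
def DGSubmodule.inclusion {M : DGMod 𝒜} {F G : DGSubmodule M}
    (hle : F.toSubmodule ≤ G.toSubmodule) : F.toDGMod ⟶ G.toDGMod :=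
  ofLin (M := F.toDGMod) (N := G.toDGMod) (Submodule.inclusion hle) (fun hm => hm) (fun _ => rfl)

/-- The quotient of a dg module by a dg submodule. -/
def quotient {M : DGMod 𝒜} (F : DGSubmodule M) : DGMod 𝒜 where
  carrier := M.carrier ⧸ F.toSubmodule
  gr i := (M.gr i).map F.toSubmodule.mkQ.toAddMonoidHom
  internal := by
    refine isInternal_of_proj _ (fun i => QuotientAddGroup.map F.toSubmodule.toAddSubgroup
      F.toSubmodule.toAddSubgroup (M.proj i) fun m hm => F.proj_mem i hm) ?_ ?_ ?_
    · rintro i _ ⟨m, hm, rfl⟩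
      exact congrArg F.toSubmodule.mkQ (M.proj_of_mem hm)
    · rintro i j _ ⟨m, hm, rfl⟩ hij
      exact congrArg F.toSubmodule.mkQ (M.proj_of_mem_ne hm hij)
    · intro m
      obtain ⟨m, rfl⟩ := F.toSubmodule.mkQ_surjective m
      induction m using M.homogeneous_induction with
      | hom i m hm => exact AddSubgroup.mem_iSup_of_mem i ⟨m, hm, rfl⟩
      | add x y hx hy =>
        rw [map_add]
        exact add_mem hx hy
  smul_mem := by
    rintro i j _ a ⟨m, hm, rfl⟩ ha
    exact ⟨m <• a, M.smul_mem hm ha, rfl⟩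
  d := QuotientAddGroup.map F.toSubmodule.toAddSubgroup F.toSubmodule.toAddSubgroup M.d
    fun m hm => F.d_mem m hm
  d_mem := by
    rintro i _ ⟨m, hm, rfl⟩
    exact ⟨M.d m, M.d_mem hm, rfl⟩
  d_d m := by
    obtain ⟨m, rfl⟩ := F.toSubmodule.mkQ_surjective m
    exact congrArg F.toSubmodule.mkQ (M.d_d m)
  leibniz := by
    rintro i _ ⟨m, hm, rfl⟩ a
    refine (congrArg F.toSubmodule.mkQ (M.leibniz hm a)).trans ?_
    rw [map_add]
    exact congrArg _ (map_negOnePow_smul F.toSubmodule.mkQ.toAddMonoidHom i _)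

/-- The projection of a dg module onto its quotient by a dg submodule. -/
def toQuotient {M : DGMod 𝒜} (F : DGSubmodule M) : M ⟶ quotient F :=
  ofLin (N := quotient F) F.toSubmodule.mkQ (fun hm => ⟨_, hm, rfl⟩) (fun _ => rfl)

/-- A short exact sequence `X → M → Q` of dg modules, given by `ι` and `q`, together with a
splitting, given by `ρ` and `σ`, that respects the gradings and the `A`-module structures but not
necessarily the differentials. -/
structure GradedSplit (X M Q : DGMod 𝒜) where
  ι : X ⟶ M
  q : M ⟶ Q
  ρ : M.carrier →ₗ[Aᵐᵒᵖ] X.carrier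
  σ : Q.carrier →ₗ[Aᵐᵒᵖ] M.carrier
  ρ_mem : ∀ i, ∀ m ∈ M.gr i, ρ m ∈ X.gr i
  σ_mem : ∀ i, ∀ y ∈ Q.gr i, σ y ∈ M.gr i
  ρ_ι : ∀ x, ρ (lin ι x) = x
  q_σ : ∀ y, lin q (σ y) = y
  σ_q : ∀ m, σ (lin q m) = m - lin ι (ρ m)
  q_ι : ∀ x, lin q (lin ι x) = 0

namespace GradedSplit

variable {X M Q : DGMod 𝒜}

/-- The splitting obtained from a retraction of `ι`; the quotient is the cokernel of `ι`. -/
def ofRetraction (ι : X ⟶ M) (ρ : M.carrier →ₗ[Aᵐᵒᵖ] X.carrier)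
    (hρ : ∀ i, ∀ m ∈ M.gr i, ρ m ∈ X.gr i) (hρι : ∀ x, ρ (lin ι x) = x) :
    GradedSplit X M (quotient (range ι)) where
  ι := ι
  q := toQuotient (range ι)
  ρ := ρ
  σ := (range ι).toSubmodule.liftQ (LinearMap.id - lin ι ∘ₗ ρ) (by
    rintro _ ⟨x, rfl⟩
    simp [hρι])
  ρ_mem := hρ
  σ_mem := by
    rintro i _ ⟨m, hm, rfl⟩
    exact sub_mem hm (lin_mem ι (hρ i m hm))
  ρ_ι := hρι
  q_σ y := by
    obtain ⟨m, rfl⟩ := (range ι).toSubmodule.mkQ_surjective y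
    refine (map_sub (range ι).toSubmodule.mkQ _ _).trans (sub_eq_self.2 ?_)
    exact (Submodule.Quotient.mk_eq_zero _).2 ⟨ρ m, rfl⟩
  σ_q _ := rfl
  q_ι x := (Submodule.Quotient.mk_eq_zero _).2 ⟨x, rfl⟩

/-- The splitting obtained from a section of `q`, where `ι` is a kernel of `q`. -/
noncomputable def ofSection (ι : X ⟶ M) (q : M ⟶ Q) (hι : Function.Injective (lin ι))
    (hker : (lin q).ker = (lin ι).range) (σ : Q.carrier →ₗ[Aᵐᵒᵖ] M.carrier)
    (hσ : ∀ i, ∀ y ∈ Q.gr i, σ y ∈ M.gr i) (hqσ : ∀ y, lin q (σ y) = y) : GradedSplit X M Q :=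
  have hmem (m : M.carrier) : m - σ (lin q m) ∈ (lin ι).range :=
    hker.le (by rw [LinearMap.mem_ker, map_sub, hqσ, sub_self])
  let ρ : M.carrier →ₗ[Aᵐᵒᵖ] X.carrier := (LinearEquiv.ofInjective (lin ι) hι).symm ∘ₗ
    (LinearMap.id - σ ∘ₗ lin q).codRestrict (lin ι).range hmem
  have ι_ρ (m : M.carrier) : lin ι (ρ m) = m - σ (lin q m) :=
    (LinearEquiv.ofInjective_apply (lin ι) (h := hι) _).symm.trans
      (congrArg Subtype.val ((LinearEquiv.ofInjective (lin ι) hι).apply_symm_apply ⟨_, hmem m⟩))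
  have q_ι (x : X.carrier) : lin q (lin ι x) = 0 := hker.ge ⟨x, rfl⟩
  { ι, q, ρ, σ, q_ι
    ρ_mem i m hm := by
      have hρm : ρ m = X.proj i (ρ m) := hι <| by
        rw [← proj_lin, ι_ρ, M.proj_of_mem (sub_mem hm (hσ i _ (lin_mem q hm)))]
      exact hρm ▸ X.proj_mem i _
    σ_mem := hσ
    ρ_ι x := hι <| by rw [ι_ρ, q_ι, map_zero, sub_zero]
    q_σ := hqσ
    σ_q m := by rw [ι_ρ, sub_sub_cancel] }

variable (S : GradedSplit X M Q)

theorem ρ_σ (y : Q.carrier) : S.ρ (S.σ y) = 0 := by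
  rw [← S.q_σ y, S.σ_q, map_sub, S.ρ_ι, sub_self]

/-- The map `ρ d σ` of degree `1`, which measures the failure of the splitting to respect the
differentials. -/
def twist : Q.carrier →ₗ[Aᵐᵒᵖ] X.carrier :=
  linearOfHomogeneous 𝒜 (S.ρ.toAddMonoidHom.comp (M.d.comp S.σ.toAddMonoidHom)) fun s a _ y => by
    change S.ρ (M.d (S.σ (y <• a))) = S.ρ (M.d (S.σ y)) <• a
    induction y using Q.homogeneous_induction with
    | hom i y hy =>
      rw [map_smul, M.leibniz (S.σ_mem i y hy), map_add, map_smul]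
      refine add_eq_left.2 ((map_negOnePow_smul S.ρ.toAddMonoidHom i _).trans ?_)
      rw [LinearMap.toAddMonoidHom_coe, map_smul, ρ_σ, smul_zero, smul_zero]
    | add x y hx hy => simp only [smul_add, map_add, hx, hy]

theorem twist_apply (y : Q.carrier) : S.twist y = S.ρ (M.d (S.σ y)) := rfl

theorem twist_mem {i : ℤ} {y : Q.carrier} (hy : y ∈ Q.gr i) : S.twist y ∈ X.gr (i + 1) :=
  S.ρ_mem _ _ (M.d_mem (S.σ_mem i y hy))

theorem d_σ (y : Q.carrier) : M.d (S.σ y) = S.σ (Q.d y) + lin S.ι (S.twist y) := by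
  rw [twist_apply, ← sub_eq_iff_eq_add, ← S.σ_q, lin_comm, S.q_σ]

theorem twist_d (y : Q.carrier) : S.twist (Q.d y) = -X.d (S.twist y) := by
  rw [twist_apply, eq_sub_of_add_eq (S.d_σ y).symm, map_sub, M.d_d, zero_sub, map_neg, ← lin_comm,
    S.ρ_ι]

theorem twist_q (m : M.carrier) : S.twist (lin S.q m) = S.ρ (M.d m) - X.d (S.ρ m) := by
  rw [twist_apply, S.σ_q, map_sub, map_sub, ← lin_comm, S.ρ_ι]

theorem q_surjective : Function.Surjective (lin S.q) := fun y => ⟨S.σ y, S.q_σ y⟩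

theorem eq_ι_add_σ (m : M.carrier) : m = lin S.ι (S.ρ m) + S.σ (lin S.q m) := by
  rw [S.σ_q, add_sub_cancel]

theorem eq_top_of_le_comap {F : Submodule Aᵐᵒᵖ M.carrier} (hX : ⊤ ≤ F.comap (lin S.ι))
    (hQ : ⊤ ≤ F.comap S.σ) : F = ⊤ :=
  Submodule.eq_top_iff'.2 fun m => by
    rw [S.eq_ι_add_σ m]
    exact add_mem (hX trivial) (hQ trivial)

/-- The linear equivalence `X × Q ≃ M` given by the splitting. -/
noncomputable def linearEquiv : (X.carrier × Q.carrier) ≃ₗ[Aᵐᵒᵖ] M.carrier :=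
  LinearEquiv.ofLinearMap ((lin S.ι).coprod S.σ) (S.ρ.prod (lin S.q))
    (LinearMap.ext fun m => (S.eq_ι_add_σ m).symm)
    (LinearMap.ext fun p => Prod.ext (by simp [S.ρ_ι, S.ρ_σ]) (by simp [S.q_ι, S.q_σ]))

theorem genLE_eq_top (S : GradedSplit X M Q) {j : ℤ} (hX : X.genLE j = ⊤)
    (hQ : Q.genLE j = ⊤) : M.genLE j = ⊤ :=
  S.eq_top_of_le_comap
    (hX.ge.trans (Submodule.span_le.2 fun _ ⟨_, hi, hx⟩ => M.mem_genLE hi (lin_mem S.ι hx)))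
    (hQ.ge.trans (Submodule.span_le.2 fun _ ⟨_, hi, hy⟩ => M.mem_genLE hi (S.σ_mem _ _ hy)))

theorem twist_mem_plus (h : 𝒜.IsPosSemisimple) {j : ℤ} (hX : X.genLE j = ⊤)
    (hQ : Q.genLE j = ⊤) (hQ' : ∀ i < j, Q.gr i = ⊥) (y : Q.carrier) : S.twist y ∈ X.plus := by
  suffices ⊤ ≤ X.plus.comap S.twist from this trivial
  refine hQ.ge.trans (Submodule.span_le.2 ?_)
  rintro y ⟨i, hi, hy⟩
  change S.twist y ∈ X.plus
  rcases hi.eq_or_lt with rfl | hi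
  · exact X.mem_plus_of_mem_genLE h (lt_add_one i) (hX.ge trivial) (S.twist_mem hy)
  · rw [hQ' i hi, AddSubgroup.mem_bot] at hy
    rw [hy, map_zero]
    exact zero_mem _

theorem isHatFiltered (h : 𝒜.IsPosSemisimple) (hX : X.IsHatFiltered) (hQ : Q.IsHatFiltered)
    (htwist : ∀ y, S.twist y ∈ X.plus) : M.IsHatFiltered where
  finite :=
    have := hX.finite
    have := hQ.finite
    Module.Finite.equiv S.linearEquiv
  projective :=
    have := hX.projective
    have := hQ.projective
    Module.Projective.of_equiv S.linearEquiv
  induction j F h₁ h₂ m hm := by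
    have hXF : ∀ i ≤ j, ∀ x ∈ X.gr i, lin S.ι x ∈ F := fun i hi x hx => by
      rcases hi.eq_or_lt with rfl | hi
      · refine hX.induction i (F.comap (lin S.ι)) (fun i' hi' y hy => h₁ i' hi' _ (lin_mem S.ι hy))
          (fun y hy hdy => h₂ _ (lin_mem S.ι hy) ?_) x hx
        exact lin_comm S.ι y ▸ hdy
      · exact h₁ i hi _ (lin_mem S.ι hx)
    have hgen : X.genLE j ≤ F.comap (lin S.ι) :=
      Submodule.span_le.2 fun x ⟨i, hi, hx⟩ => hXF i hi x hx
    have hQF : ∀ y ∈ Q.gr j, S.σ y ∈ F :=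
      hQ.induction j (F.comap S.σ) (fun i hi y hy => h₁ i hi _ (S.σ_mem i y hy)) fun y hy hdy => by
        have hty := X.mem_genLE_of_mem_plus h (htwist y) (S.twist_mem hy)
        rw [add_sub_cancel_right] at hty
        exact h₂ _ (S.σ_mem j y hy) (S.d_σ y ▸ add_mem hdy (hgen hty))
    rw [S.eq_ι_add_σ m]
    exact add_mem (hXF j le_rfl _ (S.ρ_mem j m hm)) (hQF _ (lin_mem S.q hm))

theorem isHatFiltered_quotient (S : GradedSplit X M Q) (hM : M.IsHatFiltered) :
    Q.IsHatFiltered := by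
  have := hM.projective
  have : Module.Projective Aᵐᵒᵖ Q.carrier :=
    Module.Projective.of_split S.σ (lin S.q) (LinearMap.ext S.q_σ)
  exact hM.of_surjective S.q S.q_surjective

end GradedSplit

end DGMod

end Splittings

/-! ### Filtrations with subquotients `{l} L ⊗_{A⁰} A` -/

section Filtrations

variable {k : Type w} {A : Type u} [CommRing k] [Ring A] [Algebra k A] {𝒜 : DGAlgebra k A}

namespace DGMod

section ShiftedHat

variable (L : Type u) [AddCommGroup L] [Module (𝒜.gr 0)ᵐᵒᵖ L] (h : 𝒜.IsPosSemisimple) (l : ℤ)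

theorem shift_hat_gr_eq_bot : ∀ i < -l, (shift l (hat 𝒜 L h)).gr i = ⊥ := fun i hi =>
  hat_gr_eq_bot L h (i := i + l) (by omega)

theorem hatMk_one_mem_shift (x : L) : hatMk 𝒜 x 1 ∈ (shift l (hat 𝒜 L h)).gr (-l) := by
  change hatMk 𝒜 x 1 ∈ (hat 𝒜 L h).gr (-l + l)
  rw [neg_add_cancel]
  exact hatMk_one_mem L h x

theorem shift_hat_genLE_eq_top : (shift l (hat 𝒜 L h)).genLE (-l) = ⊤ := by
  refine Submodule.eq_top_iff'.2 fun x => ?_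
  induction x using hat_induction with
  | h0 => exact zero_mem _
  | hmk x a =>
    rw [hatMk_eq_smul]
    exact ((shift l (hat 𝒜 L h)).genLE (-l)).smul_mem (op a)
      ((shift l (hat 𝒜 L h)).mem_genLE le_rfl (hatMk_one_mem_shift L h l x))
  | hadd x y hx hy => exact add_mem hx hy

theorem isHatFiltered_shift_hat [IsSimpleModule (𝒜.gr 0)ᵐᵒᵖ L] :
    (shift l (hat 𝒜 L h)).IsHatFiltered := by
  have : Module.Finite Aᵐᵒᵖ (shift l (hat 𝒜 L h)).carrier := finite_hat L
  have : Module.Projective Aᵐᵒᵖ (shift l (hat 𝒜 L h)).carrier := projective_hat L h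
  refine isHatFiltered_of_genLE_eq_top (shift_hat_genLE_eq_top L h l) (shift_hat_gr_eq_bot L h l)
    fun x hx => ?_
  change x ∈ (hat 𝒜 L h).gr (-l + l) at hx
  rw [neg_add_cancel] at hx
  obtain ⟨y, rfl⟩ := exists_hatMk_of_mem_zero L h hx
  change l.negOnePow • (hat 𝒜 L h).d (hatMk 𝒜 y 1) = 0
  rw [hat_d_hatMk_one]
  exact smul_zero _

end ShiftedHat

section OfFiltration

variable {h : 𝒜.IsPosSemisimple} {M : DGMod 𝒜} {F G : DGSubmodule M} {l : ℤ}

theorem IsSimpleHatSubquotient.exists_gradedSplit (hFG : IsSimpleHatSubquotient h F G l) :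
    ∃ (L : Type u) (_ : AddCommGroup L) (_ : Module (𝒜.gr 0)ᵐᵒᵖ L),
      IsSimpleModule (𝒜.gr 0)ᵐᵒᵖ L ∧
      Nonempty (GradedSplit F.toDGMod G.toDGMod (shift l (hat 𝒜 L h))) := by
  obtain ⟨hle, L, _, _, hL, π, hπ, hker⟩ := hFG
  refine ⟨L, _, _, hL, ?_⟩
  have : Module.Projective Aᵐᵒᵖ (shift l (hat 𝒜 L h)).carrier := projective_hat L h
  obtain ⟨s, hs⟩ := Module.projective_lifting_property (lin π) LinearMap.id hπ
  obtain ⟨σ, hσ⟩ := exists_gradedPart (M := shift l (hat 𝒜 L h)) (N := G.toDGMod) 0 s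
  simp only [add_zero] at hσ
  refine ⟨.ofSection (DGSubmodule.inclusion hle) π (Submodule.inclusion_injective hle)
    (Submodule.ext fun m => (hker m).trans ⟨fun hm => ⟨⟨m.1, hm⟩, rfl⟩, ?_⟩) σ
    (fun i y hy => hσ i y hy ▸ G.toDGMod.proj_mem _ _) fun y => ?_⟩
  · rintro ⟨m, rfl⟩
    exact m.2
  · induction y using (shift l (hat 𝒜 L h)).homogeneous_induction with
    | hom i y hy =>
      rw [hσ i y hy, ← proj_lin]
      exact (congrArg _ (LinearMap.congr_fun hs y)).trans (proj_of_mem _ hy)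
    | add x y hx hy => rw [map_add, map_add, hx, hy]

theorem IsSimpleHatSubquotient.isHatFiltered_and_genLE_eq_top
    (hFG : IsSimpleHatSubquotient h F G l) (hF : F.toDGMod.IsHatFiltered)
    (hgen : F.toDGMod.genLE (-l) = ⊤) :
    G.toDGMod.IsHatFiltered ∧ G.toDGMod.genLE (-l) = ⊤ := by
  obtain ⟨L, _, _, _, ⟨S⟩⟩ := hFG.exists_gradedSplit
  have hL := shift_hat_genLE_eq_top L h l
  exact ⟨S.isHatFiltered h hF (isHatFiltered_shift_hat L h l)
    (S.twist_mem_plus h hgen hL (shift_hat_gr_eq_bot L h l)), S.genLE_eq_top hgen hL⟩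

theorem isHatFiltered_of_subsingleton [Subsingleton M.carrier] : M.IsHatFiltered where
  finite := inferInstance
  projective := inferInstance
  induction _ F _ _ x _ := Subsingleton.elim 0 x ▸ zero_mem F

theorem isHatFiltered_of_eq_top (hF : F.toSubmodule = ⊤) (hF' : F.toDGMod.IsHatFiltered) :
    M.IsHatFiltered :=
  hF'.of_retract
    (ofLin (N := F.toDGMod) (LinearMap.id.codRestrict F.toSubmodule fun _ => hF ▸ trivial)
      (fun hm => hm) (fun _ => rfl))
    (ofLin (M := F.toDGMod) F.toSubmodule.subtype (fun hm => hm) (fun _ => rfl)) rfl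

theorem isHatFiltered_of_hasHatFiltration (hM : HasHatFiltration h M) : M.IsHatFiltered := by
  obtain ⟨n, F, l, hF0, hFn, hl, hF⟩ := hM
  have : Subsingleton (F 0).toSubmodule := by
    rw [hF0]
    infer_instance
  have key (i : Fin (n + 1)) : (F i).toDGMod.IsHatFiltered ∧
      ∀ i' : Fin n, i ≤ i'.castSucc → (F i).toDGMod.genLE (-l i') = ⊤ := by
    induction i using Fin.induction with
    | zero =>
      have : Subsingleton (F 0).toDGMod.carrier := this
      exact ⟨isHatFiltered_of_subsingleton, fun _ _ => Subsingleton.elim _ _⟩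
    | succ i ih =>
      obtain ⟨hGfilt, hGgen⟩ := (hF i).isHatFiltered_and_genLE_eq_top ih.1 (ih.2 i le_rfl)
      refine ⟨hGfilt, fun i' hi' => eq_top_iff.2 (hGgen.ge.trans (genLE_mono _ ?_))⟩
      exact neg_le_neg (hl (Fin.castSucc_lt_castSucc_iff.1 (Fin.castSucc_lt_succ.trans_le hi')).le)
  exact isHatFiltered_of_eq_top hFn (key (Fin.last n)).1

end OfFiltration

section ToFiltration

variable {h : 𝒜.IsPosSemisimple} {M : DGMod 𝒜} {L : Type u} [AddCommGroup L]
  [Module (𝒜.gr 0)ᵐᵒᵖ L]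

theorem exists_hatHom (h : 𝒜.IsPosSemisimple) {b : ℤ} (φ : L →+ M.carrier)
    (hφ : ∀ (a : 𝒜.gr 0) (l : L), φ (l <• a) = φ l <• (a : A))
    (hmem : ∀ l, φ l ∈ M.gr b) (hd : ∀ l, M.d (φ l) = 0) :
    ∃ ι : shift (-b) (hat 𝒜 L h) ⟶ M, ∀ l, lin ι (hatMk 𝒜 l 1) = φ l := by
  obtain ⟨Φ, hΦ⟩ := exists_hatLift φ hφ
  have hΦ' (l : L) (a : A) : Φ (hatMk 𝒜 l a) = φ l <• a := by rw [hatMk_eq_smul, map_smul, hΦ]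
  refine ⟨ofLin (M := shift (-b) (hat 𝒜 L h)) Φ (fun {i m} hm => ?_) fun x => ?_, hΦ⟩
  · have hle : hatGr 𝒜 L (i + -b) ≤ (M.gr i).comap Φ.toAddMonoidHom :=
      (AddSubgroup.closure_le _).2 <| by
        rintro _ ⟨l, a, ha, rfl⟩
        change Φ (hatMk 𝒜 l a) ∈ M.gr i
        rw [hΦ', ← add_sub_cancel b i, sub_eq_add_neg]
        exact M.smul_mem (hmem l) ha
    exact hle hm
  · let f : HatCarrier 𝒜 L →+ M.carrier :=
      Φ.toAddMonoidHom.comp (shift (-b) (hat 𝒜 L h)).d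
    let g : HatCarrier 𝒜 L →+ M.carrier := M.d.comp Φ.toAddMonoidHom
    change f x = g x
    induction x using hat_induction with
    | h0 => rw [map_zero, map_zero]
    | hmk l a =>
      change f (hatMk 𝒜 l a) = M.d (Φ (hatMk 𝒜 l a))
      refine (map_negOnePow_smul Φ.toAddMonoidHom (-b) (hatMk 𝒜 l (𝒜.d a))).trans ?_
      rw [LinearMap.toAddMonoidHom_coe, hΦ', hΦ', M.leibniz (hmem l), hd, smul_zero, zero_add,
        Int.negOnePow_neg]
    | hadd x y hx hy => rw [map_add, map_add, hx, hy]

theorem exists_gradedSplit_of_hatHom [Module.Projective Aᵐᵒᵖ M.carrier] {b : ℤ}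
    (ι : shift (-b) (hat 𝒜 L h) ⟶ M) (hι : ∀ l : L, lin ι (hatMk 𝒜 l 1) ∈ M.plus → l = 0) :
    ∃ (Q : DGMod 𝒜) (S : GradedSplit (shift (-b) (hat 𝒜 L h)) M Q), S.ι = ι := by
  obtain ⟨ρ, hρ, hρ'⟩ := exists_retraction h M ((lin ι).toAddMonoidHom.comp (hatUnit L))
    (fun a l => (congrArg (lin ι) (hatUnit_smul L a l)).trans ((lin ι).map_smul _ _))
    (fun l => neg_neg b ▸ lin_mem ι (hatMk_one_mem_shift L h (-b) l)) hι
  have hρι : ρ ∘ₗ lin ι = LinearMap.id := hat_hom_ext fun l => hρ' l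
  exact ⟨_, .ofRetraction ι ρ hρ (LinearMap.congr_fun hρι), rfl⟩

theorem IsHatFiltered.exists_simple_cycles (h : 𝒜.IsPosSemisimple) (hM : M.IsHatFiltered)
    [Nontrivial M.carrier] :
    ∃ a : ℤ, (∀ i < a, M.gr i = ⊥) ∧ M.gr a ≠ ⊥ ∧ ∃ (L : Type u) (_ : AddCommGroup L)
      (_ : Module (𝒜.gr 0)ᵐᵒᵖ L), IsSimpleModule (𝒜.gr 0)ᵐᵒᵖ L ∧ ∃ φ : L →+ M.carrier,
        (∀ (a : 𝒜.gr 0) (l : L), φ (l <• a) = φ l <• (a : A)) ∧ (∀ l, φ l ∈ M.gr a) ∧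
        (∀ l, M.d (φ l) = 0) ∧ ∀ l, φ l ∈ M.plus → l = 0 := by
  have := hM.finite
  obtain ⟨a, ha, ⟨x, hx, hx0⟩, hplus⟩ := exists_lowest_degree h M
  let _ := Module.compHom M.carrier 𝒜.zeroHom.op
  have := h.semisimple_op
  let V : Submodule (𝒜.gr 0)ᵐᵒᵖ M.carrier :=
    { M.gr a ⊓ M.d.ker with
      smul_mem' := fun b x hx => by
        refine ⟨add_zero a ▸ M.smul_mem hx.1 b.unop.2, ?_⟩
        change M.d (x <• (b.unop : A)) = 0
        rw [M.d_smul_of_mem_zero h x b.unop.2, show M.d x = 0 from hx.2, smul_zero] }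
  have : Nontrivial V := by
    rw [Submodule.nontrivial_iff_ne_bot]
    intro hbot
    refine hx0 (hM.induction a ⊥ (fun i hi y hy => ?_) (fun y hy hdy => ?_) x hx)
    · rwa [ha i hi] at hy
    · have hyV : y ∈ V := ⟨hy, hdy⟩
      rwa [hbot] at hyV
  obtain ⟨L, _, _, hL, φ, hφ⟩ := exists_simple_injective (𝒜.gr 0)ᵐᵒᵖ V
  exact ⟨a, ha, fun hbot => hx0 (by rwa [hbot] at hx), L, _, _, hL,
    (V.subtype ∘ₗ φ).toAddMonoidHom, fun b l => congrArg V.subtype (φ.map_smul (op b) l),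
    fun l => (φ l).2.1, fun l => (φ l).2.2,
    fun l hl => hφ ((Subtype.ext (hplus _ (φ l).2.1 hl)).trans (map_zero φ).symm)⟩

theorem IsHatFiltered.exists_bottom (h : 𝒜.IsPosSemisimple) (hM : M.IsHatFiltered)
    [Nontrivial M.carrier] :
    ∃ a : ℤ, (∀ i < a, M.gr i = ⊥) ∧ M.gr a ≠ ⊥ ∧ ∃ (L : Type u) (_ : AddCommGroup L)
      (_ : Module (𝒜.gr 0)ᵐᵒᵖ L) (Q : DGMod 𝒜), IsSimpleModule (𝒜.gr 0)ᵐᵒᵖ L ∧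
      Nonempty (GradedSplit (shift (-a) (hat 𝒜 L h)) M Q) ∧ Q.IsHatFiltered ∧
      Q.topLength < M.topLength := by
  obtain ⟨a, ha, ha', L, _, _, hL, φ, hφ, hφa, hφd, hφplus⟩ := hM.exists_simple_cycles h
  have := hM.finite
  have := hM.projective
  obtain ⟨ι, hι⟩ := exists_hatHom h φ hφ hφa hφd
  obtain ⟨Q, S, rfl⟩ := exists_gradedSplit_of_hatHom ι (by simpa only [hι] using hφplus)
  have := IsSimpleModule.nontrivial (𝒜.gr 0)ᵐᵒᵖ L
  obtain ⟨l, hl⟩ := exists_ne (0 : L)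
  have hqφ : lin S.q (φ l) = 0 := (congrArg _ (hι l).symm).trans (S.q_ι _)
  exact ⟨a, ha, ha', L, _, _, Q, hL, ⟨S⟩, S.isHatFiltered_quotient hM,
    topLength_lt h (lin S.q) S.q_surjective (mt (hφplus l) hl) (hqφ ▸ zero_mem _)⟩

@[elab_as_elim]
theorem IsHatFiltered.induction_bottom {motive : DGMod 𝒜 → Prop}
    (subsingleton : ∀ M : DGMod 𝒜, Subsingleton M.carrier → motive M)
    (bottom : ∀ (a : ℤ) (L : Type u) [AddCommGroup L] [Module (𝒜.gr 0)ᵐᵒᵖ L]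
      [IsSimpleModule (𝒜.gr 0)ᵐᵒᵖ L] (M Q : DGMod 𝒜)
      (_ : GradedSplit (shift (-a) (hat 𝒜 L h)) M Q), (∀ i < a, M.gr i = ⊥) → M.gr a ≠ ⊥ →
        motive Q → motive M)
    (hM : M.IsHatFiltered) : motive M := by
  induction hn : M.topLength using WellFoundedLT.induction generalizing M with
  | ind n ih =>
    cases subsingleton_or_nontrivial M.carrier with
    | inl hs => exact subsingleton M hs
    | inr hs =>
      obtain ⟨a, ha, ha', L, _, _, Q, _, ⟨S⟩, hQ, hlt⟩ := hM.exists_bottom h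
      exact bottom a L M Q S ha ha' (ih Q.topLength (hn ▸ hlt) hQ rfl)

theorem isSimpleHatSubquotient_preimage {Q : DGMod 𝒜} (q : M ⟶ Q)
    (hq : Function.Surjective (lin q)) {F G : DGSubmodule Q} {l : ℤ}
    (hFG : IsSimpleHatSubquotient h F G l) :
    IsSimpleHatSubquotient h (F.preimage q) (G.preimage q) l := by
  obtain ⟨hle, L, _, _, hL, π, hπ, hker⟩ := hFG
  let q' : (G.preimage q).toDGMod ⟶ G.toDGMod :=
    ofLin (M := (G.preimage q).toDGMod) (N := G.toDGMod)
      ((lin q).restrict (p := (G.preimage q).toSubmodule) (q := G.toSubmodule) fun m hm => hm)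
      (fun hm => lin_mem q hm) (fun m => Subtype.ext (lin_comm q m.1))
  refine ⟨fun m hm => hle hm, L, _, _, hL, q' ≫ π, fun y => ?_, fun m => hker _⟩
  obtain ⟨⟨x, hx⟩, rfl⟩ := hπ y
  obtain ⟨m, rfl⟩ := hq x
  exact ⟨⟨m, hx⟩, rfl⟩

theorem GradedSplit.isSimpleHatSubquotient [IsSimpleModule (𝒜.gr 0)ᵐᵒᵖ L] {l : ℤ} {Q : DGMod 𝒜}
    (S : GradedSplit (shift l (hat 𝒜 L h)) M Q) {G : DGSubmodule M}
    (hG : G.toSubmodule = (lin S.q).ker) : IsSimpleHatSubquotient h (.zero M) G l := by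
  have ι_ρ {m : M.carrier} (hm : m ∈ G.toSubmodule) : lin S.ι (S.ρ m) = m := by
    rw [hG, LinearMap.mem_ker] at hm
    rw [eq_comm, ← sub_eq_zero, ← S.σ_q, hm, map_zero]
  refine ⟨bot_le, L, _, _, inferInstance, ofLin (M := G.toDGMod) (S.ρ ∘ₗ G.toSubmodule.subtype)
    (fun hm => S.ρ_mem _ _ hm) (fun m => ?_), fun y => ⟨⟨lin S.ι y, ?_⟩, S.ρ_ι y⟩,
    fun m => ⟨fun hm => ?_, fun hm => ?_⟩⟩
  · change S.ρ (M.d m.1) = (shift l (hat 𝒜 L h)).d (S.ρ m.1)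
    rw [← S.ρ_ι (DGMod.d _ _), lin_comm, ι_ρ m.2]
  · rw [hG]
    exact S.q_ι y
  · exact (ι_ρ m.2).symm.trans ((congrArg (lin S.ι) hm).trans (map_zero _))
  · exact (congrArg S.ρ hm).trans (map_zero _)

/-- The condition `HasHatFiltration`, with the additional requirement that all the integers
`l_1 ≥ l_2 ≥ ⋯ ≥ l_n` be at most `c`. -/
def HasHatFiltrationLE (h : 𝒜.IsPosSemisimple) (M : DGMod 𝒜) (c : ℤ) : Prop :=
  ∃ (n : ℕ) (F : Fin (n + 1) → DGSubmodule M) (l : Fin n → ℤ),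
    (F 0).toSubmodule = ⊥ ∧ (F (Fin.last n)).toSubmodule = ⊤ ∧ Antitone l ∧
      (∀ i : Fin n, IsSimpleHatSubquotient h (F i.castSucc) (F i.succ) (l i)) ∧ ∀ i, l i ≤ c

theorem GradedSplit.hasHatFiltrationLE [IsSimpleModule (𝒜.gr 0)ᵐᵒᵖ L] {c : ℤ} {Q : DGMod 𝒜}
    (S : GradedSplit (shift c (hat 𝒜 L h)) M Q) (hQ : HasHatFiltrationLE h Q c) :
    HasHatFiltrationLE h M c := by
  obtain ⟨n, F, l, hF0, hFn, hl, hF, hlc⟩ := hQ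
  have hker : ((F 0).preimage S.q).toSubmodule = (lin S.q).ker :=
    congrArg (Submodule.comap (lin S.q)) hF0
  have htop : ((F (Fin.last n)).preimage S.q).toSubmodule = ⊤ :=
    (congrArg (Submodule.comap (lin S.q)) hFn).trans (Submodule.comap_top _)
  refine ⟨n + 1, Fin.cons (.zero M) fun i => (F i).preimage S.q, Fin.cons c l, rfl, htop,
    fun i j hij => ?_, fun i => ?_, Fin.cases le_rfl hlc⟩
  · induction i using Fin.cases with
    | zero => exact Fin.cases (motive := fun j => Fin.cons (α := fun _ => ℤ) c l j ≤ c) le_rfl hlc j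
    | succ i =>
      induction j using Fin.cases with
      | zero => exact absurd hij (Fin.succ_pos i).not_ge
      | succ j => exact hl (Fin.succ_le_succ_iff.1 hij)
  · induction i using Fin.cases with
    | zero => exact S.isSimpleHatSubquotient hker
    | succ i =>
      exact isSimpleHatSubquotient_preimage S.q S.q_surjective (hF i)

theorem IsHatFiltered.hasHatFiltrationLE (hM : M.IsHatFiltered) {c : ℤ}
    (hc : ∀ i < -c, M.gr i = ⊥) : HasHatFiltrationLE h M c := by
  refine hM.induction_bottom (h := h)
    (motive := fun M => ∀ c, (∀ i < -c, M.gr i = ⊥) → HasHatFiltrationLE h M c)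
    (fun M _ c _ => ?_) (fun a L _ _ _ M Q S ha ha' ih c hc => ?_) c hc
  · exact ⟨0, fun _ => .zero M, Fin.elim0, rfl, Subsingleton.elim _ _, fun i => i.elim0,
      fun i => i.elim0, fun i => i.elim0⟩
  · have hQ : ∀ i < - -a, Q.gr i = ⊥ := fun i hi => by
      refine (AddSubgroup.eq_bot_iff_forall _).2 fun y hy => ?_
      have hσy := S.σ_mem i y hy
      rw [ha i (by omega), AddSubgroup.mem_bot] at hσy
      rw [← S.q_σ y, hσy, map_zero]
    obtain ⟨n, F, l, hF0, hFn, hl, hF, hlc⟩ := S.hasHatFiltrationLE (ih _ hQ)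
    have hac : -a ≤ c := not_lt.1 fun hlt => ha' (hc a (by omega))
    exact ⟨n, F, l, hF0, hFn, hl, hF, fun i => (hlc i).trans hac⟩

theorem hasHatFiltration_iff : HasHatFiltration h M ↔ M.IsHatFiltered := by
  refine ⟨isHatFiltered_of_hasHatFiltration, fun hM => ?_⟩
  have := hM.finite
  obtain ⟨c, hc⟩ := exists_gr_eq_bot h M
  obtain ⟨n, F, l, hF0, hFn, hl, hF, -⟩ :=
    hM.hasHatFiltrationLE (h := h) (c := -c) (by simpa using hc)
  exact ⟨n, F, l, hF0, hFn, hl, hF⟩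

end ToFiltration

end DGMod

end Filtrations

/-! ### Cones and retracts up to homotopy -/

section HomotopyRetracts

variable {k : Type w} {A : Type u} [CommRing k] [Ring A] [Algebra k A] {𝒜 : DGAlgebra k A}

namespace DGMod

/-- `N` is a retract of `M` in the homotopy category. -/
def IsHomotopyRetract (N M : DGMod 𝒜) : Prop :=
  ∃ (i : N ⟶ M) (r : M ⟶ N), Homotopic (i ≫ r) (𝟙 N)

theorem isHomotopyRetract_iff {M N : DGMod 𝒜} : IsHomotopyRetract N M ↔
    Nonempty (Retract ((DGHot.functor 𝒜).obj N) ((DGHot.functor 𝒜).obj M)) := by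
  refine ⟨fun ⟨i, r, hir⟩ => ⟨⟨(DGHot.functor 𝒜).map i, (DGHot.functor 𝒜).map r, ?_⟩⟩,
    fun ⟨ρ⟩ => ?_⟩
  · rw [← Functor.map_comp, ← CategoryTheory.Functor.map_id]
    exact (Quotient.functor_map_eq_iff _ _ _).2 hir
  · obtain ⟨i, hi⟩ := (DGHot.functor 𝒜).map_surjective ρ.i
    obtain ⟨r, hr⟩ := (DGHot.functor 𝒜).map_surjective ρ.r
    refine ⟨i, r, (Quotient.functor_map_eq_iff _ _ _).1 ?_⟩
    rw [Functor.map_comp, CategoryTheory.Functor.map_id, hi, hr, ρ.retract]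

theorem isHomotopyRetract_of_retract {M N : DGMod 𝒜} (i : N ⟶ M) (r : M ⟶ N)
    (hir : ∀ x, lin r (lin i x) = x) : IsHomotopyRetract N M := by
  have hir' : i ≫ r = 𝟙 N := lin_injective (LinearMap.ext hir)
  exact isHomotopyRetract_iff.2 ⟨(Retract.mk i r hir').map (DGHot.functor 𝒜)⟩

/-- The shift of a morphism. -/
def shiftMap (l : ℤ) {M N : DGMod 𝒜} (f : M ⟶ N) : shift l M ⟶ shift l N :=
  ofLin (M := shift l M) (N := shift l N) (show M.carrier →ₗ[Aᵐᵒᵖ] N.carrier from lin f)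
    (fun hm => lin_mem f hm)
    fun m => (map_negOnePow_smul (lin f).toAddMonoidHom l _).trans (congrArg _ (lin_comm f m))

theorem IsHomotopyRetract.shift {M N : DGMod 𝒜} (hMN : IsHomotopyRetract N M) (l : ℤ) :
    IsHomotopyRetract (shift l N) (shift l M) := by
  obtain ⟨i, r, s, hs, hirs⟩ := hMN
  have sign (x : N.carrier) : l.negOnePow • l.negOnePow • x = x := by
    rw [smul_smul, Int.units_mul_self, one_smul]
  refine ⟨shiftMap l i, shiftMap l r, (l.negOnePow : ℤ) • s, fun j m hm => ?_,
    fun (m : N.carrier) => ?_⟩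
  · have := (N.gr _).zsmul_mem (hs _ m hm) l.negOnePow
    rwa [show j + l - 1 = j - 1 + l by ring] at this
  · change lin r (lin i m) = m + (l.negOnePow • N.d (l.negOnePow • s m) +
      l.negOnePow • s (l.negOnePow • N.d m))
    have hsd : s (l.negOnePow • N.d m) = l.negOnePow • s (N.d m) :=
      map_negOnePow_smul s.toAddMonoidHom l _
    rw [map_negOnePow_smul N.d, hsd, sign, sign]
    exact hirs m

/-- The morphism of cones induced by a square `f ≫ β ≃ α ≫ f'` commuting up to the homotopy
`s`. -/
def coneMap {M N M' N' : DGMod 𝒜} {f : M ⟶ N} {f' : M' ⟶ N'} (α : M ⟶ M') (β : N ⟶ N')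
    (s : M.carrier →ₗ[Aᵐᵒᵖ] N'.carrier) (hs : ∀ i, ∀ m ∈ M.gr i, s m ∈ N'.gr (i - 1))
    (hs' : ∀ m, lin β (lin f m) = lin f' (lin α m) + (N'.d (s m) + s (M.d m))) :
    cone f ⟶ cone f' :=
  ofLin (M := cone f) (N := cone f')
    (LinearMap.prod (lin β ∘ₗ LinearMap.fst _ _ _ + s ∘ₗ LinearMap.snd _ _ _)
      (lin α ∘ₗ LinearMap.snd Aᵐᵒᵖ N.carrier M.carrier))
    (fun {i m} hm => ⟨add_mem (lin_mem β hm.1) (add_sub_cancel_right i 1 ▸ hs _ _ hm.2),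
      lin_mem α hm.2⟩)
    (by
      rintro ⟨n, m⟩
      refine Prod.ext ?_ ?_
      · change lin β (N.d n + lin f m) + s (-M.d m) = N'.d (lin β n + s m) + lin f' (lin α m)
        simp only [map_add, map_neg, hs', lin_comm]
        abel
      · exact (map_neg (lin α) _).trans (congrArg _ (lin_comm α m)))

theorem isHomotopyRetract_cone_comp {M N N₀ : DGMod 𝒜} (f : M ⟶ N) (β : N ⟶ N₀) (β' : N₀ ⟶ N)
    (hβ : Homotopic (β ≫ β') (𝟙 N)) :
    IsHomotopyRetract (cone f) (cone (f ≫ β)) := by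
  obtain ⟨s, hs, hβs⟩ := hβ
  replace hβs : ∀ n, lin β' (lin β n) = n + (N.d (s n) + s (N.d n)) := hβs
  refine ⟨coneMap (𝟙 M) β 0 (fun _ _ _ => zero_mem _) fun m => ?_,
    coneMap (𝟙 M) β' (s ∘ₗ lin f) (fun i m hm => hs i _ (lin_mem f hm)) fun m => ?_,
    LinearMap.prod (s ∘ₗ LinearMap.fst _ _ _) (0 : N.carrier × M.carrier →ₗ[Aᵐᵒᵖ] M.carrier),
    fun i m hm => ⟨hs _ _ hm.1, zero_mem _⟩, ?_⟩
  · simp [lin_comp, lin_id]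
  · change lin β' (lin β (lin f m)) = lin f m + (N.d (s (lin f m)) + s (lin f (M.d m)))
    rw [hβs, lin_comm]
  · rintro ⟨n, m⟩
    refine Prod.ext ?_ ?_
    · change lin β' (lin β n + 0) + s (lin f m) =
        n + (N.d (s n) + lin f (0 : M.carrier) + s (N.d n + lin f m))
      simp only [map_add, map_zero, hβs]
      abel
    · change m = m + (-M.d 0 + 0)
      rw [map_zero, neg_zero, add_zero, add_zero]

theorem isHomotopyRetract_cone_of_comp {M M₀ N : DGMod 𝒜} (f : M ⟶ N) (α : M ⟶ M₀)
    (α' : M₀ ⟶ M) (hα : Homotopic (α ≫ α') (𝟙 M)) :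
    IsHomotopyRetract (cone f) (cone (α' ≫ f)) := by
  obtain ⟨s, hs, hαs⟩ := hα
  replace hαs : ∀ m, lin α' (lin α m) = m + (M.d (s m) + s (M.d m)) := hαs
  refine ⟨coneMap α (𝟙 N) (-(lin f ∘ₗ s))
      (fun i m hm => (N.gr _).neg_mem (lin_mem f (hs i m hm))) fun m => ?_,
    coneMap α' (𝟙 N) 0 (fun _ _ _ => zero_mem _) fun m => ?_,
    LinearMap.prod (0 : N.carrier × M.carrier →ₗ[Aᵐᵒᵖ] N.carrier) (-s ∘ₗ LinearMap.snd _ _ _),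
    fun i m hm => ⟨zero_mem _, (M.gr _).neg_mem ?_⟩, ?_⟩
  · change lin f m = lin f (lin α' (lin α m)) + (N.d (-lin f (s m)) + -lin f (s (M.d m)))
    simp only [map_add, map_neg, hαs, lin_comm]
    abel
  · simp [lin_comp, lin_id]
  · have := hs _ _ hm.2
    rwa [show i + 1 - 1 = i - 1 + 1 by ring] at this
  · rintro ⟨n, m⟩
    refine Prod.ext ?_ ?_
    · change n + -lin f (s m) + 0 = n + (N.d 0 + lin f (-s m) + 0)
      simp only [map_neg, map_zero]
      abel
    · change lin α' (lin α m) = m + (-M.d (-s m) + -s (-M.d m))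
      simp only [map_neg, hαs]
      abel

namespace GradedSplit

variable {X M Q : DGMod 𝒜}

theorem isHomotopyRetract_cone (S : GradedSplit X M Q) : IsHomotopyRetract (cone S.ι) Q := by
  refine ⟨ofLin (M := cone S.ι) (lin S.q ∘ₗ LinearMap.fst Aᵐᵒᵖ M.carrier X.carrier)
      (fun hm => lin_mem S.q hm.1) ?_,
    ofLin (N := cone S.ι) (LinearMap.prod S.σ (-S.twist))
      (fun {i y} hy => ⟨S.σ_mem i y hy, (X.gr _).neg_mem (S.twist_mem hy)⟩) ?_,
    LinearMap.prod (0 : M.carrier × X.carrier →ₗ[Aᵐᵒᵖ] M.carrier) (-S.ρ ∘ₗ LinearMap.fst _ _ _),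
    fun i m hm => ⟨zero_mem _, (X.gr _).neg_mem ?_⟩, ?_⟩
  · rintro ⟨m, x⟩
    change lin S.q (M.d m + lin S.ι x) = Q.d (lin S.q m)
    rw [map_add, S.q_ι, add_zero, lin_comm]
  · intro y
    refine Prod.ext ?_ ?_
    · change S.σ (Q.d y) = M.d (S.σ y) + lin S.ι (-S.twist y)
      rw [S.d_σ, map_neg, add_neg_cancel_right]
    · change -S.twist (Q.d y) = -X.d (-S.twist y)
      rw [S.twist_d, map_neg]
  · rw [sub_add_cancel]
    exact S.ρ_mem _ _ hm.1
  · rintro ⟨m, x⟩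
    refine Prod.ext ?_ ?_
    · change S.σ (lin S.q m) = m + (M.d 0 + lin S.ι (-S.ρ m) + 0)
      rw [S.σ_q, map_zero, map_neg]
      abel
    · change -S.twist (lin S.q m) = x + (-X.d (-S.ρ m) + -S.ρ (M.d m + lin S.ι x))
      rw [S.twist_q, map_neg, map_add, S.ρ_ι]
      abel

/-- The connecting morphism from `Q` to the cone of the restriction of `f` to `X`; its cone is, as
a graded module, `N × X × Q`. -/
def toCone (S : GradedSplit X M Q) {N : DGMod 𝒜} (f : M ⟶ N) : Q ⟶ cone (S.ι ≫ f) :=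
  ofLin (N := cone (S.ι ≫ f)) (LinearMap.prod (lin f ∘ₗ S.σ) (-S.twist))
    (fun {_ _} hy => ⟨lin_mem f (S.σ_mem _ _ hy), (X.gr _).neg_mem (S.twist_mem hy)⟩)
    (by
      intro y
      refine Prod.ext ?_ ?_
      · change lin f (S.σ (Q.d y)) = N.d (lin f (S.σ y)) + lin f (lin S.ι (-S.twist y))
        rw [← lin_comm, S.d_σ, map_neg, map_neg, map_add, add_neg_cancel_right]
      · change -S.twist (Q.d y) = -X.d (-S.twist y)
        rw [S.twist_d, map_neg])

theorem isHomotopyRetract_cone_toCone (S : GradedSplit X M Q) {N : DGMod 𝒜} (f : M ⟶ N) :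
    IsHomotopyRetract (cone f) (cone (S.toCone f)) := by
  refine isHomotopyRetract_of_retract
    (ofLin (M := cone f) (N := cone (S.toCone f))
      (LinearMap.prod ((LinearMap.id : N.carrier →ₗ[Aᵐᵒᵖ] N.carrier).prodMap S.ρ)
        (lin S.q ∘ₗ LinearMap.snd Aᵐᵒᵖ N.carrier M.carrier))
      (fun hm => ⟨⟨hm.1, S.ρ_mem _ _ hm.2⟩, lin_mem S.q hm.2⟩) ?_)
    (ofLin (M := cone (S.toCone f)) (N := cone f)
      (LinearMap.prod
        (LinearMap.fst _ _ _ ∘ₗ LinearMap.fst Aᵐᵒᵖ (N.carrier × X.carrier) Q.carrier)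
        (lin S.ι ∘ₗ LinearMap.snd _ _ _ ∘ₗ LinearMap.fst Aᵐᵒᵖ (N.carrier × X.carrier) Q.carrier +
          S.σ ∘ₗ LinearMap.snd Aᵐᵒᵖ (N.carrier × X.carrier) Q.carrier))
      (fun hm => ⟨hm.1.1, (M.gr _).add_mem (lin_mem S.ι hm.1.2) (S.σ_mem _ _ hm.2)⟩) ?_) ?_
  · rintro ⟨n, m⟩
    refine Prod.ext (Prod.ext ?_ ?_) ?_
    · change N.d n + lin f m = N.d n + lin f (lin S.ι (S.ρ m)) + lin f (S.σ (lin S.q m))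
      rw [add_assoc, ← map_add, ← S.eq_ι_add_σ]
    · change S.ρ (-M.d m) = -X.d (S.ρ m) + -S.twist (lin S.q m)
      rw [S.twist_q, map_neg]
      abel
    · exact (map_neg (lin S.q) _).trans (congrArg _ (lin_comm S.q m))
  · rintro ⟨⟨n, x⟩, y⟩
    refine Prod.ext ?_ ?_
    · change N.d n + lin f (lin S.ι x) + lin f (S.σ y) = N.d n + lin f (lin S.ι x + S.σ y)
      rw [map_add, add_assoc]
    · change lin S.ι (-X.d x + -S.twist y) + S.σ (-Q.d y) = -M.d (lin S.ι x + S.σ y)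
      simp only [map_add, map_neg, S.d_σ, lin_comm]
      abel
  · rintro ⟨n, m⟩
    exact Prod.ext rfl (S.eq_ι_add_σ m).symm

end GradedSplit

/-- The sequence `N → cone f → M[1]`, whose twist is `f`. -/
def coneSplit {M N : DGMod 𝒜} (f : M ⟶ N) : GradedSplit N (cone f) (shift 1 M) where
  ι := ofLin (N := cone f) (LinearMap.inl Aᵐᵒᵖ N.carrier M.carrier)
    (fun hm => ⟨hm, zero_mem _⟩) fun n => Prod.ext
      ((congrArg (N.d n + ·) (map_zero (lin f))).trans (add_zero _)).symm
      ((congrArg Neg.neg (map_zero M.d)).trans neg_zero).symm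
  q := ofLin (M := cone f) (N := shift 1 M) (LinearMap.snd Aᵐᵒᵖ N.carrier M.carrier)
    (fun hm => hm.2) fun m => by
      change -M.d m.2 = (1 : ℤ).negOnePow • M.d m.2
      rw [Int.negOnePow_one, Units.neg_smul, one_smul]
  ρ := LinearMap.fst Aᵐᵒᵖ N.carrier M.carrier
  σ := LinearMap.inr Aᵐᵒᵖ N.carrier M.carrier
  ρ_mem _ _ hm := hm.1
  σ_mem _ _ hy := ⟨zero_mem _, hy⟩
  ρ_ι _ := rfl
  q_σ _ := rfl
  σ_q m := Prod.ext (sub_self m.1).symm (sub_zero m.2).symm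
  q_ι _ := rfl

theorem coneSplit_twist {M N : DGMod 𝒜} (f : M ⟶ N) (m : M.carrier) :
    (coneSplit f).twist m = lin f m := by
  change N.d 0 + lin f m = lin f m
  rw [map_zero, zero_add]

theorem IsHatFiltered.cone {M N : DGMod 𝒜} (h : 𝒜.IsPosSemisimple) (hM : (shift 1 M).IsHatFiltered)
    (hN : N.IsHatFiltered) {f : M ⟶ N} (hf : ∀ m, lin f m ∈ N.plus) : (cone f).IsHatFiltered :=
  (coneSplit f).isHatFiltered h hN hM fun m => coneSplit_twist f m ▸ hf m

theorem isHomotopyRetract_cone_of_subsingleton {M N : DGMod 𝒜} [Subsingleton M.carrier]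
    (f : M ⟶ N) : IsHomotopyRetract (cone f) N := by
  refine isHomotopyRetract_of_retract
    (ofLin (M := cone f) (LinearMap.fst Aᵐᵒᵖ N.carrier M.carrier) (fun hm => hm.1) ?_)
    (coneSplit f).ι fun x => Prod.ext rfl (Subsingleton.elim (α := M.carrier) _ _)
  rintro ⟨n, m⟩
  change N.d n + lin f m = N.d n
  rw [Subsingleton.elim m 0, map_zero, add_zero]

theorem IsHatFiltered.shift {M : DGMod 𝒜} (hM : M.IsHatFiltered) (l : ℤ) :
    (shift l M).IsHatFiltered where
  finite := hM.finite
  projective := hM.projective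
  induction j F h₁ h₂ x hx := by
    refine hM.induction (j + l) F (fun i hi y hy => h₁ (i - l) (by omega) y ?_)
      (fun y hy hdy => h₂ y hy ?_) x hx
    · change y ∈ M.gr (i - l + l)
      rwa [sub_add_cancel]
    · exact F.toAddSubgroup.zsmul_mem hdy l.negOnePow

section ConeOfHat

variable {L : Type u} [AddCommGroup L] [Module (𝒜.gr 0)ᵐᵒᵖ L] {h : 𝒜.IsPosSemisimple} {b : ℤ}
  {N : DGMod 𝒜} (g : shift b (hat 𝒜 L h) ⟶ N)

/-- The elements of `L` that `g` maps into `N A⁺`. -/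
def hatPlus : Submodule (𝒜.gr 0)ᵐᵒᵖ L where
  carrier := {l | lin g (hatMk 𝒜 l 1) ∈ N.plus}
  zero_mem' := (congrArg (· ∈ N.plus) ((congrArg (lin g) (map_zero (hatUnit L))).trans
    (map_zero (lin g)))).mpr (zero_mem _)
  add_mem' {x y} hx hy := (congrArg (· ∈ N.plus) ((congrArg (lin g)
    (map_add (hatUnit L) x y)).trans (map_add (lin g) _ _))).mpr (add_mem hx hy)
  smul_mem' a x hx := (congrArg (· ∈ N.plus) ((congrArg (lin g)
    (hatUnit_smul L a.unop x)).trans (map_smul (lin g) _ _))).mpr (N.plus.smul_mem _ hx)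

theorem lin_mem_plus_of_hatPlus_eq_top (hg : hatPlus g = ⊤) (x : (shift b (hat 𝒜 L h)).carrier) :
    lin g x ∈ N.plus := by
  let V : Submodule Aᵐᵒᵖ (HatCarrier 𝒜 L) := N.plus.comap (lin g)
  change x ∈ V
  induction x using hat_induction with
  | h0 => exact zero_mem _
  | hmk l a =>
    rw [hatMk_eq_smul]
    exact V.smul_mem _ (hg.ge trivial : l ∈ hatPlus g)
  | hadd x y hx hy => exact add_mem hx hy

end ConeOfHat

theorem retractClosure_dgFilt_cone_hat {L : Type u} [AddCommGroup L] [Module (𝒜.gr 0)ᵐᵒᵖ L]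
    [IsSimpleModule (𝒜.gr 0)ᵐᵒᵖ L] (h : 𝒜.IsPosSemisimple) {b : ℤ} {N : DGMod 𝒜}
    (hN : N.IsHatFiltered) (g : shift (-b) (hat 𝒜 L h) ⟶ N) :
    (dgFilt h).retractClosure ((DGHot.functor 𝒜).obj (cone g)) := by
  -- Unless it maps into `N A⁺`, the morphism `g` has a graded `A`-linear retraction, and its cone
  -- is homotopy equivalent to its cokernel.
  rcases eq_bot_or_eq_top (hatPlus g) with hg | hg
  · have := hN.projective
    obtain ⟨Q, S, rfl⟩ := exists_gradedSplit_of_hatHom g fun l hl =>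
      (Submodule.mem_bot _).1 (hg.le (show l ∈ hatPlus g from hl))
    obtain ⟨ρ⟩ := isHomotopyRetract_iff.1 S.isHomotopyRetract_cone
    exact ⟨_, hasHatFiltration_iff.2 (S.isHatFiltered_quotient hN), ⟨ρ⟩⟩
  · exact ObjectProperty.le_retractClosure _ _ (hasHatFiltration_iff.2
      (.cone h ((isHatFiltered_shift_hat L h (-b)).shift 1) hN
        (lin_mem_plus_of_hatPlus_eq_top g hg)))

theorem retractClosure_dgFilt_of_isHomotopyRetract {h : 𝒜.IsPosSemisimple} {M N : DGMod 𝒜}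
    (hNM : IsHomotopyRetract N M)
    (hM : (dgFilt h).retractClosure ((DGHot.functor 𝒜).obj M)) :
    (dgFilt h).retractClosure ((DGHot.functor 𝒜).obj N) := by
  obtain ⟨ρ⟩ := isHomotopyRetract_iff.1 hNM
  exact ObjectProperty.prop_of_retract _ ρ hM

theorem exists_isHomotopyRetract {h : 𝒜.IsPosSemisimple} {M : DGMod 𝒜}
    (hM : (dgFilt h).retractClosure ((DGHot.functor 𝒜).obj M)) :
    ∃ M₀ : DGMod 𝒜, M₀.IsHatFiltered ∧ IsHomotopyRetract M M₀ := by
  obtain ⟨M₀, hM₀, ρ⟩ := hM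
  exact ⟨M₀.as, hasHatFiltration_iff.1 hM₀, isHomotopyRetract_iff.2 ρ⟩

theorem IsHatFiltered.retractClosure_dgFilt_cone {h : 𝒜.IsPosSemisimple} {M N : DGMod 𝒜}
    (hM : M.IsHatFiltered) (f : M ⟶ N)
    (hN : (dgFilt h).retractClosure ((DGHot.functor 𝒜).obj N)) :
    (dgFilt h).retractClosure ((DGHot.functor 𝒜).obj (DGMod.cone f)) := by
  refine hM.induction_bottom (h := h)
    (motive := fun M => ∀ (N : DGMod 𝒜) (f : M ⟶ N),
      (dgFilt h).retractClosure ((DGHot.functor 𝒜).obj N) →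
        (dgFilt h).retractClosure ((DGHot.functor 𝒜).obj (DGMod.cone f)))
    (fun M _ N f hN => ?_) (fun a L _ _ _ M Q S _ _ ih N f hN => ?_) N f hN
  · exact retractClosure_dgFilt_of_isHomotopyRetract (isHomotopyRetract_cone_of_subsingleton f) hN
  · refine retractClosure_dgFilt_of_isHomotopyRetract (S.isHomotopyRetract_cone_toCone f)
      (ih _ (S.toCone f) ?_)
    obtain ⟨N₀, hN₀, β, β', hβ⟩ := exists_isHomotopyRetract hN
    exact retractClosure_dgFilt_of_isHomotopyRetract (isHomotopyRetract_cone_comp _ β β' hβ)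
      (retractClosure_dgFilt_cone_hat h hN₀ _)

theorem isTriangulatedSubcategory_retractClosure_dgFilt (h : 𝒜.IsPosSemisimple) :
    IsTriangulatedSubcategory (dgFilt h).retractClosure where
  of_iso X Y e hX := ObjectProperty.prop_of_retract _ (Retract.ofIso e.symm) hX
  nonempty := ⟨_, ObjectProperty.le_retractClosure _ _
    (hasHatFiltration_iff.2 (isHatFiltered_ofAlgebra h))⟩
  shift n M hM := by
    obtain ⟨M₀, hM₀, hMM₀⟩ := exists_isHomotopyRetract hM
    exact retractClosure_dgFilt_of_isHomotopyRetract (hMM₀.shift n)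
      (ObjectProperty.le_retractClosure _ _ (hasHatFiltration_iff.2 (hM₀.shift n)))
  cone M N f hM hN := by
    obtain ⟨M₀, hM₀, α, α', hα⟩ := exists_isHomotopyRetract hM
    exact retractClosure_dgFilt_of_isHomotopyRetract (isHomotopyRetract_cone_of_comp f α α' hα)
      (hM₀.retractClosure_dgFilt_cone (α' ≫ f) hN)

theorem dgPer_le_retractClosure_dgFilt (h : 𝒜.IsPosSemisimple) :
    dgPer 𝒜 ≤ (dgFilt h).retractClosure := fun X hX => by
  refine hX _ (isTriangulatedSubcategory_retractClosure_dgFilt h) (fun Y Z W ⟨b, _, ⟨e⟩⟩ hY => ?_)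
    (ObjectProperty.le_retractClosure _ _ (hasHatFiltration_iff.2 (isHatFiltered_ofAlgebra h)))
  exact ObjectProperty.prop_of_retract _ (b.retract_left.trans (.ofIso e.symm)) hY

end DGMod

end HomotopyRetracts

/-! ### Decompositions of dg modules -/

section DecompositionDGMod

variable {k : Type w} {A : Type u} [CommRing k] [Ring A] [Algebra k A] {𝒜 : DGAlgebra k A}

namespace DGMod

theorem isZero_of_subsingleton (M : DGMod 𝒜) [Subsingleton M.carrier] : IsZero M :=
  (IsZero.iff_id_eq_zero M).2 (lin_injective (LinearMap.ext fun _ =>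
    Subsingleton.elim (α := M.carrier) _ _))

variable (𝒜) in
theorem exists_isZero_isHatFiltered : ∃ Z : DGMod 𝒜, IsZero Z ∧ Z.IsHatFiltered :=
  have : Subsingleton (DGSubmodule.zero (ofAlgebra 𝒜)).toDGMod.carrier :=
    inferInstanceAs (Subsingleton (⊥ : Submodule Aᵐᵒᵖ A))
  ⟨_, isZero_of_subsingleton (DGSubmodule.zero (ofAlgebra 𝒜)).toDGMod,
    isHatFiltered_of_subsingleton⟩

instance : IsIdempotentComplete (DGMod 𝒜) where
  idempotents_split M e he := by
    let r : M ⟶ (range e).toDGMod := ofLin (N := (range e).toDGMod) (lin e).rangeRestrict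
      (fun hm => lin_mem e hm) fun m => Subtype.ext (lin_comm e m)
    refine ⟨(range e).toDGMod, ofLin (M := (range e).toDGMod) (lin e).range.subtype
      (fun hm => hm) fun _ => rfl, r, lin_injective (LinearMap.ext ?_), rfl⟩
    rintro ⟨_, x, rfl⟩
    exact Subtype.ext (LinearMap.congr_fun (congrArg lin he) x)

namespace IsHatFiltered

theorem exists_notMem_plus (h : 𝒜.IsPosSemisimple) {M : DGMod 𝒜} (hM : M.IsHatFiltered)
    (hM0 : ¬ IsZero M) : ∃ x, x ∉ M.plus := by
  have := hM.finite
  have : Nontrivial M.carrier :=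
    not_subsingleton_iff_nontrivial.1 fun _ => hM0 M.isZero_of_subsingleton
  obtain ⟨_, -, ⟨x, hx, hx0⟩, hplus⟩ := exists_lowest_degree h M
  exact ⟨x, fun hxp => hx0 (hplus x hx hxp)⟩

theorem isStronglyPiRegular_end (h : 𝒜.IsPosSemisimple) {M : DGMod 𝒜} (hM : M.IsHatFiltered) :
    IsStronglyPiRegular (End M) :=
  have := hM.finite
  have := hM.projective
  DGMod.isStronglyPiRegular_end h M

theorem hasFittingEnd (h : 𝒜.IsPosSemisimple) {M : DGMod 𝒜} (hM : M.IsHatFiltered)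
    (hMi : IsIndecomposable M) : HasFittingEnd M :=
  hasFittingEnd_of_isStronglyPiRegular hMi.1 (hM.isStronglyPiRegular_end h)
    fun _ he => hMi.eq_zero_or_one he

theorem of_isBinaryDirectSum {M N N' : DGMod 𝒜} (hM : M.IsHatFiltered)
    (hs : IsBinaryDirectSum M N N') : N.IsHatFiltered := by
  obtain ⟨i, r, _, _, hir, -⟩ := hs.exists_total
  exact hM.of_retract i r hir

theorem topLength_lt_of_isBinaryDirectSum (h : 𝒜.IsPosSemisimple) {M N N' : DGMod 𝒜}
    (hM : M.IsHatFiltered) (hs : IsBinaryDirectSum M N N') (hN' : ¬ IsZero N') :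
    N.topLength < M.topLength := by
  have := hM.finite
  obtain ⟨x, hx⟩ := (hM.of_isBinaryDirectSum hs.symm).exists_notMem_plus h hN'
  obtain ⟨i, r, i', r', hir, hir', -, hi'r, -⟩ := hs.exists_total
  have hir (y : N.carrier) : lin r (lin i y) = y := LinearMap.congr_fun (congrArg lin hir) y
  have hir' : lin r' (lin i' x) = x := LinearMap.congr_fun (congrArg lin hir') x
  have hi'r : lin r (lin i' x) = 0 := LinearMap.congr_fun (congrArg lin hi'r) x
  refine topLength_lt h (lin r) (fun y => ⟨lin i y, hir y⟩) (x := lin i' x) (fun hix => hx ?_)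
    (hi'r ▸ zero_mem _)
  exact hir' ▸ plus_le_comap (lin r') hix

theorem exists_decomposition (h : 𝒜.IsPosSemisimple) {M : DGMod 𝒜} (hM : M.IsHatFiltered) :
    ∃ (n : ℕ) (Y : Fin n → DGMod 𝒜),
      (∀ j, (Y j).IsHatFiltered ∧ IsLocalRing (End (Y j))) ∧ IsDirectSumOf M Y := by
  obtain ⟨n, Y, hY, hs⟩ := exists_isDirectSumOf_isIndecomposable DGMod.IsHatFiltered topLength
    (fun _ _ _ hX hs => hX.of_isBinaryDirectSum hs)
    (fun _ _ _ hX hs hZ => hX.topLength_lt_of_isBinaryDirectSum h hs hZ) hM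
  exact ⟨n, Y, fun j => ⟨(hY j).1, ((hY j).1.hasFittingEnd h (hY j).2).2.2⟩, hs⟩

end IsHatFiltered

/-- The direct sum of two dg modules, as the cone of a zero morphism. -/
def directSum (M N : DGMod 𝒜) : DGMod 𝒜 := cone (0 : shift (-1) N ⟶ M)

theorem isBinaryDirectSum_directSum (M N : DGMod 𝒜) : IsBinaryDirectSum (directSum M N) M N := by
  have hd (n : N.carrier) : -(shift (-1) N).d n = N.d n := by
    change -((-1 : ℤ).negOnePow • N.d n) = N.d n
    rw [Int.negOnePow_odd (-1) (by decide), Units.neg_smul, one_smul, neg_neg]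
  refine .of_total (coneSplit (0 : shift (-1) N ⟶ M)).ι
    (ofLin (M := directSum M N) (LinearMap.fst Aᵐᵒᵖ M.carrier N.carrier) (fun hm => hm.1)
      fun x => add_zero (M.d x.1))
    (ofLin (N := directSum M N) (LinearMap.inr Aᵐᵒᵖ M.carrier N.carrier)
      (fun {i n} hn => ⟨zero_mem _, ?_⟩)
      fun n => Prod.ext ((add_zero (M.d 0)).trans (map_zero M.d)).symm (hd n).symm)
    (ofLin (M := directSum M N) (LinearMap.snd Aᵐᵒᵖ M.carrier N.carrier)
      (fun {i x} hx => ?_) fun x => hd x.2)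
    rfl rfl rfl rfl
    (lin_injective (LinearMap.ext fun x => Prod.ext (add_zero x.1) (zero_add x.2)))
  · change n ∈ N.gr (i + 1 + -1)
    rwa [add_neg_cancel_right]
  · have : x.2 ∈ N.gr (i + 1 + -1) := hx.2
    rwa [add_neg_cancel_right] at this

theorem IsHatFiltered.directSum (h : 𝒜.IsPosSemisimple) {M N : DGMod 𝒜} (hM : M.IsHatFiltered)
    (hN : N.IsHatFiltered) : (directSum M N).IsHatFiltered :=
  .cone h ((hN.shift (-1)).shift 1) hM fun _ => zero_mem _

end DGMod

end DecompositionDGMod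

/-! ### Idempotents in the homotopy category -/

section HotIdempotents

variable {k : Type w} {A : Type u} [CommRing k] [Ring A] [Algebra k A] {𝒜 : DGAlgebra k A}

instance : (DGHot.functor 𝒜).Additive where
  map_add := rfl

namespace DGMod.IsHatFiltered

variable {M : DGMod 𝒜}

theorem isZero_of_isZero_obj (h : 𝒜.IsPosSemisimple) (hM : M.IsHatFiltered)
    (hM0 : IsZero ((DGHot.functor 𝒜).obj M)) : IsZero M := by
  by_contra hM0'
  obtain ⟨x, hx⟩ := hM.exists_notMem_plus h hM0'
  rw [IsZero.iff_id_eq_zero, ← CategoryTheory.Functor.map_id, ← Functor.map_zero] at hM0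
  obtain ⟨s, -, hs⟩ := (Quotient.functor_map_eq_iff _ _ _).1 hM0
  have hsx : x = M.d (s x) + s (M.d x) := (hs x).trans (zero_add _)
  rw [hsx] at hx
  exact hx (add_mem (hM.d_mem_plus h _) (plus_le_comap s (hM.d_mem_plus h _)))

theorem isLocalRing_end_obj (h : 𝒜.IsPosSemisimple) (hM : M.IsHatFiltered)
    [hl : IsLocalRing (End M)] : IsLocalRing (End ((DGHot.functor 𝒜).obj M)) :=
  _root_.isLocalRing_end_obj _ fun h0 =>
    nontrivial_end_iff.1 hl.toNontrivial (hM.isZero_of_isZero_obj h h0)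

theorem exists_split_obj (h : 𝒜.IsPosSemisimple) (hM : M.IsHatFiltered)
    {e : End ((DGHot.functor 𝒜).obj M)} (he : IsIdempotentElem e) :
    ∃ E : DGMod 𝒜, E.IsHatFiltered ∧ ∃ ρ : Retract ((DGHot.functor 𝒜).obj E)
      ((DGHot.functor 𝒜).obj M), ρ.r ≫ ρ.i = e := by
  obtain ⟨p, hp, rfl⟩ := (hM.isStronglyPiRegular_end h).exists_lift_isIdempotentElem
    ((DGHot.functor 𝒜).mapEnd M) (DGHot.functor 𝒜).map_surjective he
  obtain ⟨E, i, r, hir, hri⟩ := IsIdempotentComplete.idempotents_split M p hp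
  refine ⟨E, hM.of_retract i r hir, (Retract.mk i r hir).map (DGHot.functor 𝒜), ?_⟩
  exact ((DGHot.functor 𝒜).map_comp r i).symm.trans (congrArg _ hri)

end DGMod.IsHatFiltered

variable {h : 𝒜.IsPosSemisimple} {X : DGHot 𝒜}

theorem dgFilt_iff : dgFilt h X ↔ X.as.IsHatFiltered :=
  DGMod.hasHatFiltration_iff

theorem retractClosure_dgFilt (h : 𝒜.IsPosSemisimple) :
    (dgFilt h).retractClosure = (dgFilt h).isoClosure := by
  refine le_antisymm ?_ ((dgFilt h).isoClosure_le_iff _ |>.2 (dgFilt h).le_retractClosure)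
  rintro X ⟨Y, hY, ⟨ρ⟩⟩
  obtain ⟨E, hE, σ, hσ⟩ := (dgFilt_iff.1 hY).exists_split_obj h (isIdempotentElem_of_retract ρ)
  exact ⟨_, dgFilt_iff.2 hE, nonempty_iso_of_comp_eq ρ σ hσ.symm⟩

theorem exists_split_of_isoClosure_dgFilt (hX : (dgFilt h).isoClosure X) {e : End X}
    (he : IsIdempotentElem e) :
    ∃ (Y : DGHot 𝒜) (i : Y ⟶ X) (r : X ⟶ Y), i ≫ r = 𝟙 Y ∧ r ≫ i = e := by
  obtain ⟨M, hM, ⟨φ⟩⟩ := hX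
  obtain ⟨E, -, ρ, hρ⟩ := (dgFilt_iff.1 hM).exists_split_obj h (he.map φ.conj)
  exact Idempotents.split_imp_of_iso φ.symm (φ.conj e) e (by simp [Iso.conj_apply])
    ⟨_, ρ.i, ρ.r, ρ.retract, hρ⟩

theorem isStronglyPiRegular_end_of_isoClosure_dgFilt (hX : (dgFilt h).isoClosure X) :
    IsStronglyPiRegular (End X) := by
  obtain ⟨M, hM, ⟨φ⟩⟩ := hX
  have hM' : IsStronglyPiRegular (End M) :=
    ((dgFilt_iff.1 hM).isStronglyPiRegular_end h).of_surjective
      ((DGHot.functor 𝒜).mapEnd M.as) (DGHot.functor 𝒜).map_surjective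
  exact hM'.of_surjective φ.symm.conj.toMonoidHom φ.symm.conj.surjective

end HotIdempotents

section Subcategories

variable {k : Type w} {A : Type u} [CommRing k] [Ring A] [Algebra k A] {𝒜 : DGAlgebra k A}

/-! ### The category `dgPer` -/

namespace dgPer

theorem isoClosure_dgFilt (h : 𝒜.IsPosSemisimple) {X : DGHot 𝒜} (hX : dgPer 𝒜 X) :
    (dgFilt h).isoClosure X :=
  (retractClosure_dgFilt h).le _ (DGMod.dgPer_le_retractClosure_dgFilt h _ hX)

theorem of_retract (h : 𝒜.IsPosSemisimple) {X Y : DGHot 𝒜} (hY : dgPer 𝒜 Y)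
    (ρ : Retract X Y) : dgPer 𝒜 X := by
  obtain ⟨Z, i, r, hir, hri⟩ := exists_split_of_isoClosure_dgFilt (hY.isoClosure_dgFilt h)
    (isIdempotentElem_of_retract ρ).one_sub
  exact fun P hP hsummand hA => hsummand Y X Z (.of_split ρ.retract rfl hir hri)
    (hY P hP hsummand hA)

theorem directSum {M N : DGMod 𝒜} (hM : dgPer 𝒜 ((DGHot.functor 𝒜).obj M))
    (hN : dgPer 𝒜 ((DGHot.functor 𝒜).obj N)) :
    dgPer 𝒜 ((DGHot.functor 𝒜).obj (DGMod.directSum M N)) :=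
  fun P hP hsummand hA =>
    hP.cone _ _ _ (hP.shift _ _ (hN P hP hsummand hA)) (hM P hP hsummand hA)

theorem containsZero (h : 𝒜.IsPosSemisimple) : (dgPer 𝒜).ContainsZero := by
  obtain ⟨Z, hZ, -⟩ := DGMod.exists_isZero_isHatFiltered 𝒜
  have hZ' := (DGHot.functor 𝒜).map_isZero hZ
  have hA : dgPer 𝒜 ((DGHot.functor 𝒜).obj (DGMod.ofAlgebra 𝒜)) := fun _ _ _ hA => hA
  exact ⟨_, hZ', hA.of_retract h ⟨0, 0, hZ'.eq_of_src _ _⟩⟩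

theorem isIdempotentComplete (h : 𝒜.IsPosSemisimple) :
    IsIdempotentComplete (dgPer 𝒜).FullSubcategory where
  idempotents_split N e he := by
    have he' : IsIdempotentElem (M := End N) e := he
    obtain ⟨Y, i, r, hir, hri⟩ := exists_split_of_isoClosure_dgFilt
      (isoClosure_dgFilt h N.property) (he'.map ((dgPer 𝒜).ι.mapEnd N))
    exact ⟨⟨Y, of_retract h N.property ⟨i, r, hir⟩⟩, ObjectProperty.homMk i,
      ObjectProperty.homMk r, ObjectProperty.hom_ext _ hir, ObjectProperty.hom_ext _ hri⟩

theorem hasFittingEnd (h : 𝒜.IsPosSemisimple) {N : (dgPer 𝒜).FullSubcategory}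
    (hN : IsIndecomposable N) : HasFittingEnd N.obj := by
  have := isIdempotentComplete h
  refine hasFittingEnd_of_isStronglyPiRegular (fun h0 => hN.1 (isZero_of_map (dgPer 𝒜).ι h0))
    (isStronglyPiRegular_end_of_isoClosure_dgFilt (isoClosure_dgFilt h N.property)) fun e he => ?_
  have he' : IsIdempotentElem (M := End N) (ObjectProperty.homMk e) := ObjectProperty.hom_ext _ he
  exact (hN.eq_zero_or_one he').imp (congrArg (dgPer 𝒜).ι.map) (congrArg (dgPer 𝒜).ι.map)

theorem exists_decomposition (h : 𝒜.IsPosSemisimple) (N : (dgPer 𝒜).FullSubcategory) :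
    ∃ (n : ℕ) (Y : Fin n → (dgPer 𝒜).FullSubcategory),
      (∀ j, IsLocalRing (End (Y j))) ∧ IsDirectSumOf N Y := by
  obtain ⟨M, hM, ⟨φ⟩⟩ := isoClosure_dgFilt h N.property
  obtain ⟨n, Y, hY, hs⟩ := (dgFilt_iff.1 hM).exists_decomposition h
  have hs' : IsDirectSumOf N.obj fun j => (DGHot.functor 𝒜).obj (Y j) :=
    (hs.map (DGHot.functor 𝒜)).of_iso φ.symm
  have hYper (j) : dgPer 𝒜 ((DGHot.functor 𝒜).obj (Y j)) := by
    obtain ⟨i, r, hir, -⟩ := hs'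
    exact of_retract h N.property ⟨i j, r j, hir j⟩
  have hYloc (j) : IsLocalRing (End ((DGHot.functor 𝒜).obj (Y j))) :=
    have := (hY j).2
    (hY j).1.isLocalRing_end_obj h
  exact ⟨n, fun j => ⟨_, hYper j⟩, fun j => isLocalRing_end_of_obj (dgPer 𝒜).ι (hX := hYloc j),
    .of_map (dgPer 𝒜).ι hs'⟩

theorem isKrullRemakSchmidt (h : 𝒜.IsPosSemisimple) :
    IsKrullRemakSchmidt (dgPer 𝒜).FullSubcategory where
  hasFiniteBiproducts :=
    have := containsZero h
    hasFiniteBiproducts_fullSubcategory _ fun X Y hX hY =>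
      ⟨_, directSum hX hY, (DGMod.isBinaryDirectSum_directSum X.as Y.as).map (DGHot.functor 𝒜)⟩
  exists_decomposition N := by
    obtain ⟨n, Y, hY, hs⟩ := exists_decomposition h N
    exact ⟨n, Y, hY, hs.isFiniteDirectSum⟩

end dgPer

/-! ### The category `dgFilt` -/

namespace dgFilt

theorem isIndecomposable_as {h : 𝒜.IsPosSemisimple} {M : (dgFilt h).FullSubcategory}
    (hM : IsIndecomposable M) : IsIndecomposable M.obj.as := by
  refine ⟨fun h0 => hM.1 (isZero_of_map (dgFilt h).ι ((DGHot.functor 𝒜).map_isZero h0)),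
    fun Y Z hs => ?_⟩
  have hY := (dgFilt_iff.1 M.property).of_isBinaryDirectSum hs
  have hZ := (dgFilt_iff.1 M.property).of_isBinaryDirectSum hs.symm
  let FY : (dgFilt h).FullSubcategory := ⟨(DGHot.functor 𝒜).obj Y, dgFilt_iff.2 hY⟩
  let FZ : (dgFilt h).FullSubcategory := ⟨(DGHot.functor 𝒜).obj Z, dgFilt_iff.2 hZ⟩
  have hs' : IsBinaryDirectSum M FY FZ := .of_map (dgFilt h).ι (hs.map (DGHot.functor 𝒜))
  refine (hM.2 FY FZ hs').imp (fun hY0 => hY.isZero_of_isZero_obj h ?_)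
    fun hZ0 => hZ.isZero_of_isZero_obj h ?_
  · exact (dgFilt h).ι.map_isZero hY0
  · exact (dgFilt h).ι.map_isZero hZ0

theorem exists_decomposition {h : 𝒜.IsPosSemisimple} (M : (dgFilt h).FullSubcategory) :
    ∃ (n : ℕ) (Y : Fin n → (dgFilt h).FullSubcategory),
      (∀ j, IsLocalRing (End (Y j)) ∧ IsLocalRing (End (Y j).obj.as)) ∧
      IsDirectSumOf M Y ∧ IsDirectSumOf M.obj.as fun j => (Y j).obj.as := by
  obtain ⟨n, Y, hY, hs⟩ := (dgFilt_iff.1 M.property).exists_decomposition h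
  have hYloc (j) : IsLocalRing (End ((DGHot.functor 𝒜).obj (Y j))) :=
    have := (hY j).2
    (hY j).1.isLocalRing_end_obj h
  exact ⟨n, fun j => ⟨(DGHot.functor 𝒜).obj (Y j), dgFilt_iff.2 (hY j).1⟩,
    fun j => ⟨isLocalRing_end_of_obj (dgFilt h).ι (hX := hYloc j), (hY j).2⟩,
    .of_map (dgFilt h).ι (hs.map (DGHot.functor 𝒜)), hs⟩

theorem containsZero (h : 𝒜.IsPosSemisimple) : (dgFilt h).ContainsZero := by
  obtain ⟨Z, hZ, hZfilt⟩ := DGMod.exists_isZero_isHatFiltered 𝒜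
  exact ⟨_, (DGHot.functor 𝒜).map_isZero hZ, dgFilt_iff.2 hZfilt⟩

theorem isKrullRemakSchmidt (h : 𝒜.IsPosSemisimple) :
    IsKrullRemakSchmidt (dgFilt h).FullSubcategory where
  hasFiniteBiproducts :=
    have := containsZero h
    hasFiniteBiproducts_fullSubcategory _ fun X Y hX hY =>
      ⟨_, dgFilt_iff.2 ((dgFilt_iff.1 hX).directSum h (dgFilt_iff.1 hY)),
        (DGMod.isBinaryDirectSum_directSum X.as Y.as).map (DGHot.functor 𝒜)⟩
  exists_decomposition M := by
    obtain ⟨n, Y, hY, hs, -⟩ := exists_decomposition M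
    exact ⟨n, Y, fun j => (hY j).1, hs.isFiniteDirectSum⟩

end dgFilt

end Subcategories

theorem proposition8p6 {k : Type w} {A : Type u} [CommRing k] [Ring A] [Algebra k A]
    (𝒜 : DGAlgebra k A) (h : 𝒜.IsPosSemisimple) :
    -- (1) indecomposables of `dgFilt`, in `dgMod` or equivalently in `dgFilt`, and of `dgPer`
    (∀ M : (dgFilt h).FullSubcategory, (IsIndecomposable M.obj.as ∨ IsIndecomposable M) →
      HasFittingEnd M.obj.as) ∧
    (∀ N : (dgPer 𝒜).FullSubcategory, IsIndecomposable N → HasFittingEnd N.obj) ∧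
    -- (2) decompositions into indecomposables
    (∀ M : (dgFilt h).FullSubcategory, ∃ (n : ℕ) (Y : Fin n → (dgFilt h).FullSubcategory),
      (∀ i, IsIndecomposable (Y i) ∧ IsIndecomposable (Y i).obj.as) ∧
      IsFiniteDirectSum M Y ∧ IsFiniteDirectSum M.obj.as (fun i => (Y i).obj.as)) ∧
    (∀ N : (dgPer 𝒜).FullSubcategory, ∃ (n : ℕ) (Y : Fin n → (dgPer 𝒜).FullSubcategory),
      (∀ i, IsIndecomposable (Y i)) ∧ IsFiniteDirectSum N Y) ∧
    -- (3) the Krull-Remak-Schmidt property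
    IsKrullRemakSchmidt (dgFilt h).FullSubcategory ∧
    IsKrullRemakSchmidt (dgPer 𝒜).FullSubcategory := by
  refine ⟨fun M hM => ?_, fun N hN => dgPer.hasFittingEnd h hN, fun M => ?_, fun N => ?_,
    dgFilt.isKrullRemakSchmidt h, dgPer.isKrullRemakSchmidt h⟩
  · exact (dgFilt_iff.1 M.property).hasFittingEnd h (hM.elim id dgFilt.isIndecomposable_as)
  · obtain ⟨n, Y, hY, hs, hs'⟩ := dgFilt.exists_decomposition M
    refine ⟨n, Y, fun i => ?_, hs.isFiniteDirectSum, hs'.isFiniteDirectSum⟩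
    obtain ⟨_, _⟩ := hY i
    exact ⟨isIndecomposable_of_isLocalRing_end, isIndecomposable_of_isLocalRing_end⟩
  · obtain ⟨n, Y, hY, hs⟩ := dgPer.exists_decomposition h N
    exact ⟨n, Y, fun i => have := hY i; isIndecomposable_of_isLocalRing_end,
      hs.isFiniteDirectSum⟩
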